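/- Let $F,f:(0,\infty)\to\mathbb R$ be the functions of the linear sieve, i.e. the continuous functions determined by $F(u)=2e^{\gamma}/u$ and $f(u)=0$ for $0<u\le 2$, and $(uF(u))'=f(u-1)$, $(uf(u))'=F(u-1)$ for $u>2$, where $\gamma$ is Euler's constant. Let $B$ be a finite set of primes, and for an integer $r\ge 0$ let $P_r(B)$ be the set of positive integers having at most $r$ distinct prime divisors outside $B$. Let $\tau,A,A_1,A_2$ be real constants with $0<\tau<1$, $A\ge 2$, $A_1\ge 1$, $A_2\ge 2$. Let $\mathscr A=(a_n)_{n\ge 1}$ be a finite sequence of non-negative real numbers with $a_n=0$ for $n>X$, and let $\omega$ be a non-negative multiplicative function with $\omega(1)=1$, $\omega(p)<p$ for primes $p\notin B$ and $\omega(p)=0$ for $p\in B$, such that $$\prod_{z_1\le p<z}\Big(1-\frac{\omega(p)}p\Big)^{-1}\le\frac{\log z}{\log z_1}\Big(1+\frac{A}{\log z_1}\Big)\qquad(2\le z_1<z).$$ Put $|\mathscr A_d|=\sum_{d\mid n}a_n$ and $R_d=|\mathscr A_d|-\frac{\omega(d)}dX$, and suppose that $$\sum_{\substack{d<X^{\tau}(\log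 X)^{-A_1}\\(d,p)=1\ \forall p\in B}}\mu^2(d)\,4^{\nu(d)}|R_d|\le A_2\frac{X}{\log^2X},$$ where $\nu(d)$ is the number of prime factors of $d$. Let $1\le a<3<a+5<b\le 8$ be real numbers. Then $$\sum_{n\in P_r(B)}a_n\gg X\prod_{p<X^{\tau/b}}\Big(1-\frac{\omega(p)}p\Big)$$ for every integer $$r>\frac{b}{(b-a)\tau}-1+\frac{2e^{\gamma}}{f(b)}(I_1+I_2+I_3),$$ where $$I_1=\frac1b\log\frac{(b-1)(b-a)}a-\frac1{b-a}\log\frac{b-1}a,$$ $$I_2=\int_3^{b-1}\frac1t\Big(\frac1{b-t}-\frac1{b-a}\Big)\int_2^{t-1}\frac{\log(u-1)}u\,du\,dt,$$ $$I_3=\int_5^{b-1}\frac1t\Big(\frac1{b-t}-\frac1{b-a}\Big)\int_2^{t-3}\frac{\log(u-1)}u\int_{u+2}^{t-1}\frac1v\log\frac{v-1}{u+1}\,dv\,du\,dt.$$ Here $\gg$ means that there are $c>0$ and $X_0$, depending only on $B,\tau,A,A_1,A_2,a,b,r$, such that for all $X\ge X_0$ and all $\mathscr A$ and $\omega$ as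 above the left side is at least $c$ times the right side. -/

import Mathlib

open scoped BigOperators

namespace LinearSieve

noncomputable section

/-! ### The functions `F` and `f` of the linear sieve -/

/-- The simultaneous differential-difference system of the linear sieve (sieve dimension `1`,
where both switching points are equal to `2`):
`F(u) = 2 e^γ / u` and `f(u) = 0` for `0 < u ≤ 2`, and `(u F(u))' = f(u - 1)`,
`(u f(u))' = F(u - 1)` for `u > 2`, with `F` and `f` continuous on `(0, ∞)`.
These conditions determine `F` and `f` on `(0, ∞)`. -/
structure IsSystemSolution (F f : ℝ → ℝ) : Prop where
  continuousOn_upper : ContinuousOn F (Set.Ioi 0)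
  continuousOn_lower : ContinuousOn f (Set.Ioi 0)
  upper_init : ∀ u : ℝ, 0 < u → u ≤ 2 → F u = 2 * Real.exp Real.eulerMascheroniConstant / u
  lower_init : ∀ u : ℝ, 0 < u → u ≤ 2 → f u = 0
  upper_deriv : ∀ u : ℝ, 2 < u → HasDerivAt (fun s => s * F s) (f (u - 1)) u
  lower_deriv : ∀ u : ℝ, 2 < u → HasDerivAt (fun s => s * f s) (F (u - 1)) u

/-- Solving the system in steps of length one: the `k`-th pair is the solution `(F, f)` on
`(0, k + 2]`. -/
def steps : ℕ → (ℝ → ℝ) × (ℝ → ℝ)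
  | 0 => (fun s => 2 * Real.exp Real.eulerMascheroniConstant / s, fun _ => 0)
  | k + 1 =>
    (fun s => (2 * Real.exp Real.eulerMascheroniConstant +
        ∫ t in (2 : ℝ)..max 2 s, (steps k).2 (t - 1)) / s,
     fun s => (∫ t in (2 : ℝ)..max 2 s, (steps k).1 (t - 1)) / s)

/-- The upper function `F` of the linear sieve. -/
def upperFun (s : ℝ) : ℝ := (steps ⌈s⌉₊).1 s

/-- The lower function `f` of the linear sieve. -/
def lowerFun (s : ℝ) : ℝ := (steps ⌈s⌉₊).2 s

theorem steps_succ_fst (k : ℕ) (s : ℝ) : (steps (k + 1)).1 s =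
    (2 * Real.exp Real.eulerMascheroniConstant +
      ∫ t in (2 : ℝ)..max 2 s, (steps k).2 (t - 1)) / s := rfl

theorem steps_succ_snd (k : ℕ) (s : ℝ) : (steps (k + 1)).2 s =
    (∫ t in (2 : ℝ)..max 2 s, (steps k).1 (t - 1)) / s := rfl

theorem steps_succ_eq (k : ℕ) : ∀ s : ℝ, s ≤ k + 2 →
    (steps (k + 1)).1 s = (steps k).1 s ∧ (steps (k + 1)).2 s = (steps k).2 s := by
  induction k with
  | zero =>
    intro s hs
    have h : max (2 : ℝ) s = 2 := max_eq_left (by simpa using hs)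
    simp [steps, h]
  | succ k ih =>
    intro s hs
    have key : ∀ t ∈ Set.uIcc (2 : ℝ) (max 2 s), t - 1 ≤ k + 2 := by
      intro t ht
      rw [Set.uIcc_of_le (le_max_left _ _)] at ht
      have h2 : max (2 : ℝ) s ≤ k + 3 := by
        apply max_le
        · have : (0 : ℝ) ≤ k := Nat.cast_nonneg k
          linarith
        · push_cast at hs
          linarith
      linarith [ht.2]
    constructor
    · rw [steps_succ_fst (k + 1), steps_succ_fst k,
        intervalIntegral.integral_congr (fun t ht => (ih (t - 1) (key t ht)).2)]
    · rw [steps_succ_snd (k + 1), steps_succ_snd k,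
        intervalIntegral.integral_congr (fun t ht => (ih (t - 1) (key t ht)).1)]

theorem steps_add_eq (k m : ℕ) (s : ℝ) (hs : s ≤ k + 2) :
    (steps (k + m)).1 s = (steps k).1 s ∧ (steps (k + m)).2 s = (steps k).2 s := by
  induction m with
  | zero => simp
  | succ m ih =>
    have h := steps_succ_eq (k + m) s (by
      push_cast
      have : (0 : ℝ) ≤ m := Nat.cast_nonneg m
      linarith)
    rw [← add_assoc]
    exact ⟨h.1.trans ih.1, h.2.trans ih.2⟩

theorem upperFun_eq_steps (k : ℕ) (s : ℝ) (hs : s ≤ k + 2) : upperFun s = (steps k).1 s := by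
  have h1 : s ≤ (⌈s⌉₊ : ℝ) + 2 := by linarith [Nat.le_ceil s]
  rw [upperFun, ← (steps_add_eq ⌈s⌉₊ k s h1).1, add_comm, (steps_add_eq k ⌈s⌉₊ s hs).1]

theorem lowerFun_eq_steps (k : ℕ) (s : ℝ) (hs : s ≤ k + 2) : lowerFun s = (steps k).2 s := by
  have h1 : s ≤ (⌈s⌉₊ : ℝ) + 2 := by linarith [Nat.le_ceil s]
  rw [lowerFun, ← (steps_add_eq ⌈s⌉₊ k s h1).2, add_comm, (steps_add_eq k ⌈s⌉₊ s hs).2]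

theorem steps_continuousOn (k : ℕ) :
    ContinuousOn (steps k).1 (Set.Ioi 0) ∧ ContinuousOn (steps k).2 (Set.Ioi 0) := by
  have aux : ∀ g : ℝ → ℝ, ContinuousOn g (Set.Ioi 0) →
      Continuous (fun s : ℝ => ∫ t in (2 : ℝ)..max 2 s, g (t - 1)) := by
    intro g hg
    have hg' : Continuous (fun t : ℝ => g (max 2 t - 1)) := by
      apply hg.comp_continuous (by fun_prop)
      intro t
      have := le_max_left (2 : ℝ) t
      simp only [Set.mem_Ioi]
      linarith
    have h2 : Continuous (fun x : ℝ => ∫ t in (2 : ℝ)..x, g (max 2 t - 1)) :=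
      intervalIntegral.continuous_primitive (fun a b => hg'.intervalIntegrable a b) 2
    have h3 := h2.comp (continuous_const.max continuous_id : Continuous fun s : ℝ => max 2 s)
    refine h3.congr (fun s => ?_)
    apply intervalIntegral.integral_congr
    intro t ht
    rw [Set.uIcc_of_le (le_max_left _ _)] at ht
    simp [max_eq_right ht.1]
  induction k with
  | zero =>
    refine ⟨?_, continuousOn_const⟩
    exact continuousOn_const.div continuousOn_id (fun x hx => ne_of_gt hx)
  | succ k ih =>
    constructor
    · exact (continuousOn_const.add (aux _ ih.2).continuousOn).div continuousOn_id
        (fun x hx => ne_of_gt hx)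
    · exact (aux _ ih.1).continuousOn.div continuousOn_id (fun x hx => ne_of_gt hx)

theorem continuousOn_of_steps {g : ℝ → ℝ} {h : ℕ → ℝ → ℝ}
    (hc : ∀ k, ContinuousOn (h k) (Set.Ioi 0))
    (hg : ∀ (k : ℕ) (s : ℝ), s ≤ k + 2 → g s = h k s) : ContinuousOn g (Set.Ioi 0) := by
  intro x hx
  have h1 := (hc ⌈x⌉₊).continuousAt (Ioi_mem_nhds hx)
  refine (h1.congr ?_).continuousWithinAt
  filter_upwards [Iio_mem_nhds (show x < x + 1 by linarith)] with s hs
  refine (hg _ s ?_).symm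
  linarith [Nat.le_ceil x, Set.mem_Iio.1 hs]

theorem mul_hasDerivAt {g φ : ℝ → ℝ} {C : ℝ} (hφ : ContinuousOn φ (Set.Ioi 0))
    (hg : ∀ s : ℝ, 2 < s → g s = (C + ∫ t in (2 : ℝ)..s, φ (t - 1)) / s) (u : ℝ) (hu : 2 < u) :
    HasDerivAt (fun s => s * g s) (φ (u - 1)) u := by
  have hc : ContinuousOn (fun t : ℝ => φ (t - 1)) (Set.Ioi 1) :=
    hφ.comp (by fun_prop) (fun t ht => by
      simp only [Set.mem_Ioi] at ht ⊢
      linarith)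
  have hint : IntervalIntegrable (fun t : ℝ => φ (t - 1)) MeasureTheory.volume 2 u := by
    apply (hc.mono ?_).intervalIntegrable
    intro t ht
    rw [Set.uIcc_of_le hu.le] at ht
    simp only [Set.mem_Ioi]
    linarith [ht.1]
  have hat : ContinuousAt (fun t : ℝ => φ (t - 1)) u :=
    hc.continuousAt (Ioi_mem_nhds (by linarith))
  have hmeas := hc.stronglyMeasurableAtFilter isOpen_Ioi (μ := MeasureTheory.volume) u
    (by simp only [Set.mem_Ioi]; linarith)
  have hd := (intervalIntegral.integral_hasDerivAt_right hint hmeas hat).const_add C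
  refine hd.congr_of_eventuallyEq ?_
  filter_upwards [Ioi_mem_nhds hu] with s hs
  have hs' : (2 : ℝ) < s := hs
  have hs0 : s ≠ 0 := by linarith
  rw [hg s hs']
  field_simp

/-- The functions `F = upperFun` and `f = lowerFun` solve the linear sieve system. -/
theorem isSystemSolution : IsSystemSolution upperFun lowerFun where
  continuousOn_upper :=
    continuousOn_of_steps (fun k => (steps_continuousOn k).1) upperFun_eq_steps
  continuousOn_lower :=
    continuousOn_of_steps (fun k => (steps_continuousOn k).2) lowerFun_eq_steps
  upper_init u _ hu := by
    rw [upperFun_eq_steps 0 u (by simpa using hu), steps]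
  lower_init u _ hu := by
    rw [lowerFun_eq_steps 0 u (by simpa using hu), steps]
  upper_deriv := by
    refine mul_hasDerivAt
      (continuousOn_of_steps (fun k => (steps_continuousOn k).2) lowerFun_eq_steps)
      (C := 2 * Real.exp Real.eulerMascheroniConstant) ?_
    intro s hs
    have hs1 : s ≤ (⌈s⌉₊ : ℝ) := Nat.le_ceil s
    rw [upperFun_eq_steps (⌈s⌉₊ + 1) s (by push_cast; linarith), steps]
    simp only [max_eq_right hs.le]
    congr 2
    apply intervalIntegral.integral_congr
    intro t ht
    rw [Set.uIcc_of_le hs.le] at ht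
    exact (lowerFun_eq_steps _ _ (by linarith [ht.2])).symm
  lower_deriv := by
    refine mul_hasDerivAt
      (continuousOn_of_steps (fun k => (steps_continuousOn k).1) upperFun_eq_steps)
      (C := 0) ?_
    intro s hs
    have hs1 : s ≤ (⌈s⌉₊ : ℝ) := Nat.le_ceil s
    rw [lowerFun_eq_steps (⌈s⌉₊ + 1) s (by push_cast; linarith), steps]
    simp only [max_eq_right hs.le, zero_add]
    congr 1
    apply intervalIntegral.integral_congr
    intro t ht
    rw [Set.uIcc_of_le hs.le] at ht
    exact (upperFun_eq_steps _ _ (by linarith [ht.2])).symm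

/-! ### The sieve setup -/

/-- `P_r(B)`: the positive integers with at most `r` prime divisors outside `B`. -/
def almostPrimes (r : ℕ) (B : Finset ℕ) : Set ℕ :=
  {n : ℕ | 0 < n ∧ (n.primeFactors \ B).card ≤ r}

instance (r : ℕ) (B : Finset ℕ) : DecidablePred (fun n : ℕ => n ∈ almostPrimes r B) :=
  fun n => inferInstanceAs (Decidable (0 < n ∧ (n.primeFactors \ B).card ≤ r))

/-- `|𝒜_d|`: the sum of the `a_n` with `d ∣ n`. -/
def congruenceSum (a : ℕ →₀ ℝ) (d : ℕ) : ℝ :=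
  ∑ n ∈ a.support with d ∣ n, a n

/-- `R_d = |𝒜_d| - (ω(d) / d) X`. -/
def remainder (a : ℕ →₀ ℝ) (ω : ArithmeticFunction ℝ) (X : ℝ) (d : ℕ) : ℝ :=
  congruenceSum a d - ω d / d * X

/-- The setup of the linear sieve (dimension `1`): a finite sequence of weights `a_n ≥ 0` on the
positive integers, an approximation `X` to its total mass, and a density function `ω`, with level
of distribution `τ`. The parameters `A`, `A₁`, `A₂` are the constants in the hypotheses. -/
structure IsSetup (B : Finset ℕ) (τ A A₁ A₂ : ℝ) (X : ℝ) (ω : ArithmeticFunction ℝ)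
    (a : ℕ →₀ ℝ) : Prop where
  nonneg : ∀ n : ℕ, 0 ≤ a n
  index_pos : ∀ n ∈ a.support, 0 < n
  /-- the largest index occurring in the sequence is at most `X` -/
  index_le : ∀ n ∈ a.support, (n : ℝ) ≤ X
  multiplicative : ω.IsMultiplicative
  density_nonneg : ∀ d : ℕ, 0 ≤ ω d
  density_lt : ∀ p : ℕ, p.Prime → p ∉ B → ω p < p
  density_bad : ∀ p ∈ B, ω p = 0
  /-- the sieve has dimension at most `1`; the product is over the primes `z₁ ≤ p < z` -/
  dimension : ∀ z₁ z : ℝ, 2 ≤ z₁ → z₁ < z →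
    ∏ p ∈ (Finset.range ⌈z⌉₊).filter (fun p : ℕ => p.Prime ∧ z₁ ≤ (p : ℝ)), (1 - ω p / p)⁻¹ ≤
      (Real.log z / Real.log z₁) * (1 + A / Real.log z₁)
  /-- the sum is over the `d < X ^ τ (log X) ^ (-A₁)` that are coprime to all primes in `B` -/
  distribution :
    ∑ d ∈ Finset.range ⌈X ^ τ * Real.log X ^ (-A₁)⌉₊ with ∀ p ∈ B, Nat.Coprime d p,
      (ArithmeticFunction.moebius d : ℝ) ^ 2 * 4 ^ (ArithmeticFunction.cardDistinctFactors d) *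
        |remainder a ω X d| ≤ A₂ * (X / Real.log X ^ 2)

/-! ### The three explicit quantities -/

/-- `I₁`. -/
def I₁ (a b : ℝ) : ℝ :=
  1 / b * Real.log ((b - 1) * (b - a) / a) - 1 / (b - a) * Real.log ((b - 1) / a)

/-- `I₂`. -/
def I₂ (a b : ℝ) : ℝ :=
  ∫ t in (3 : ℝ)..(b - 1), 1 / t * (1 / (b - t) - 1 / (b - a)) *
    ∫ u in (2 : ℝ)..(t - 1), Real.log (u - 1) / u

/-- `I₃`. -/
def I₃ (a b : ℝ) : ℝ :=
  ∫ t in (5 : ℝ)..(b - 1), 1 / t * (1 / (b - t) - 1 / (b - a)) *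
    ∫ u in (2 : ℝ)..(t - 3), Real.log (u - 1) / u *
      ∫ v in (u + 2)..(t - 1), 1 / v * Real.log ((v - 1) / (u + 1))

end

end LinearSieve

namespace LinearSieve
noncomputable section
open Set Filter Topology MeasureTheory

/-! ### Basic properties of the functions `F` and `f` -/

/-! The proof is a weighted linear sieve. Put z = X^(τ/b) and y = z^(b-a), and sum a_n times 1 - λ Σ
(1 - log p / log y) over the n free of primes below z outside B, where the inner sum runs over the
primes z ≤ p < y outside B that divide n. If n ≤ X has more than r prime divisors outside B, the
inner sum is at least ρ = r + 1 - log X / log y = r + 1 - b/((b-a)τ). With λ = 1/ρ such n get a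
weight ≤ 0, and every weight is at most 1, so the weighted sum bounds the sum over P_r(B) from below
(`weighted_sum_le`).

Sieving the unweighted part from below and the parts with p ∣ n from above gives, up to small
errors, X V(z) (f(b) - λ ∫ (1 - u/(b-a)) F(b-u) du/u) over 1 ≤ u ≤ b-a, where V is the sieve product
and u = log p / log z (`weighted_sieve`). Solving the system for F up to 7 turns the integral into
2e^γ (I₁ + I₂ + I₃) (`integral_weight_upperFun`), and the bracket is positive exactly under the
hypothesis on r. The remainder is O(X / log² X), while V(z) ≫ 1 / log z, so it is negligible.

The linear sieve itself (`linear_sieve`) is proved by induction on ⌈z⌉ through Buchstab's identity,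
upper bounds coming from lower bounds at smaller primes and conversely. Partial summation turns the
sum over primes into an integral of F(t-1) or f(t-1), and the differential-difference equations
reproduce the main term. The relative error ε, coming from the ratio V(u)/V(z), must not grow along
the induction. It is carried with a profile like e^(-s), which each step multiplies by a factor
below 1 (`upper_error_step`, `lower_error_step`). A small ε is available only for primes beyond some
u₀; the finitely many smaller primes are removed beforehand by the exact sieve of Legendre
(`sieve_upper_and_lower`).

The induction needs f ≤ 1 ≤ F, monotonicity, and exponentially fast convergence to 1. Monotonicity
and convergence to a common limit come from the Dickman-type equation for s(F - f). That the limit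
equals 1, which is where the constant 2e^γ matters, follows from a conserved pairing of F + f with
the adjoint solution ∫ e^(-sx - Ein(x)) dx, whose value at 1 is e^(-γ) (`pairing_eq`,
`pairing_two`). -/

theorem pos_of_continuousOn_Ici {φ : ℝ → ℝ} {a : ℝ} (hc : ContinuousOn φ (Ici a))
    (h : ∀ s, a ≤ s → (∀ t, a ≤ t → t < s → 0 < φ t) → 0 < φ s) : ∀ s, a ≤ s → 0 < φ s := by
  by_contra! hcon
  obtain ⟨s₁, hs₁, hs₁'⟩ := hcon
  -- The failure set is closed, so it has a least element; positivity holds at all earlier points,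
  -- and `h` gives a contradiction there.
  set S : Set ℝ := Ici a ∩ φ ⁻¹' Iic 0 with hS
  have hclosed : IsClosed S := hc.preimage_isClosed_of_isClosed isClosed_Ici isClosed_Iic
  have hne : S.Nonempty := ⟨s₁, hs₁, hs₁'⟩
  have hbdd : BddBelow S := ⟨a, fun x hx => hx.1⟩
  have hmem := hclosed.csInf_mem hne hbdd
  have h2 := h (sInf S) hmem.1 (fun t hat ht => by
    by_contra! h3
    exact absurd (csInf_le hbdd (show t ∈ S from ⟨hat, h3⟩)) (not_le.2 ht))
  exact absurd hmem.2 (not_le.2 h2)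

theorem eq_of_hasDerivAt_zero_Ioi {φ : ℝ → ℝ} {a : ℝ} (hc : ContinuousOn φ (Ici a))
    (hd : ∀ s, a < s → HasDerivAt φ 0 s) (s : ℝ) (hs : a ≤ s) : φ s = φ a := by
  have h1 : MonotoneOn φ (Ici a) := monotoneOn_of_deriv_nonneg (convex_Ici a) hc
    (fun x hx => by
      rw [interior_Ici] at hx
      exact (hd x hx).differentiableAt.differentiableWithinAt)
    (fun x hx => by
      rw [interior_Ici] at hx
      exact (hd x hx).deriv.ge)
  have h2 : AntitoneOn φ (Ici a) := antitoneOn_of_deriv_nonpos (convex_Ici a) hc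
    (fun x hx => by
      rw [interior_Ici] at hx
      exact (hd x hx).differentiableAt.differentiableWithinAt)
    (fun x hx => by
      rw [interior_Ici] at hx
      exact (hd x hx).deriv.le)
  exact le_antisymm (h2 self_mem_Ici hs hs) (h1 self_mem_Ici hs hs)

/-- The constant `2 e ^ γ`. -/
def sieveConst : ℝ := 2 * Real.exp Real.eulerMascheroniConstant

theorem sieveConst_pos : 0 < sieveConst := by unfold sieveConst; positivity

theorem upperFun_of_le_two {u : ℝ} (h0 : 0 < u) (h2 : u ≤ 2) : upperFun u = sieveConst / u :=
  isSystemSolution.upper_init u h0 h2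

theorem lowerFun_of_le_two {u : ℝ} (h0 : 0 < u) (h2 : u ≤ 2) : lowerFun u = 0 :=
  isSystemSolution.lower_init u h0 h2

theorem continuousOn_upperFun : ContinuousOn upperFun (Ioi 0) := isSystemSolution.continuousOn_upper

theorem continuousOn_lowerFun : ContinuousOn lowerFun (Ioi 0) := isSystemSolution.continuousOn_lower

theorem ContinuousOn.intervalIntegrable_of_pos {g : ℝ → ℝ} (hg : ContinuousOn g (Ioi 0)) {s t : ℝ}
    (hs : 0 < s) (ht : 0 < t) : IntervalIntegrable g volume s t := by
  refine (hg.mono fun x hx => ?_).intervalIntegrable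
  have := hx.1
  simp only [mem_Ioi]
  exact lt_of_lt_of_le (lt_min hs ht) this

theorem continuousOn_comp_sub_one {g : ℝ → ℝ} (hg : ContinuousOn g (Ioi 0)) :
    ContinuousOn (fun t => g (t - 1)) (Ioi 1) :=
  hg.comp (by fun_prop) (fun t ht => by simp only [mem_Ioi] at ht ⊢; linarith)

theorem intervalIntegrable_comp_sub_one {g : ℝ → ℝ} (hg : ContinuousOn g (Ioi 0)) {s t : ℝ}
    (hs : 1 < s) (ht : 1 < t) : IntervalIntegrable (fun t => g (t - 1)) volume s t := by
  refine ((continuousOn_comp_sub_one hg).mono fun x hx => ?_).intervalIntegrable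
  exact lt_of_lt_of_le (lt_min hs ht) hx.1

theorem integral_lowerFun_sub_one {s t : ℝ} (hs : 2 ≤ s) (hst : s ≤ t) :
    ∫ x in s..t, lowerFun (x - 1) = t * upperFun t - s * upperFun s := by
  refine intervalIntegral.integral_eq_sub_of_hasDerivAt_of_le (f := fun s => s * upperFun s) hst ?_
    (fun x hx => isSystemSolution.upper_deriv x (lt_of_le_of_lt hs hx.1))
    (intervalIntegrable_comp_sub_one continuousOn_lowerFun (by linarith) (by linarith))
  refine continuousOn_id.mul (continuousOn_upperFun.mono fun x hx => ?_)
  simp only [mem_Ioi]; linarith [hx.1]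

theorem integral_upperFun_sub_one {s t : ℝ} (hs : 2 ≤ s) (hst : s ≤ t) :
    ∫ x in s..t, upperFun (x - 1) = t * lowerFun t - s * lowerFun s := by
  refine intervalIntegral.integral_eq_sub_of_hasDerivAt_of_le (f := fun s => s * lowerFun s) hst ?_
    (fun x hx => isSystemSolution.lower_deriv x (lt_of_le_of_lt hs hx.1))
    (intervalIntegrable_comp_sub_one continuousOn_upperFun (by linarith) (by linarith))
  refine continuousOn_id.mul (continuousOn_lowerFun.mono fun x hx => ?_)
  simp only [mem_Ioi]; linarith [hx.1]

/-- `s (F(s) - f(s))`, a multiple of the shifted Dickman function. -/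
def gapFun (s : ℝ) : ℝ := s * upperFun s - s * lowerFun s

theorem continuousOn_gapFun : ContinuousOn gapFun (Ioi 0) :=
  (continuousOn_id.mul continuousOn_upperFun).sub (continuousOn_id.mul continuousOn_lowerFun)

theorem gapFun_of_le_two {u : ℝ} (h0 : 0 < u) (h2 : u ≤ 2) : gapFun u = sieveConst := by
  rw [gapFun, upperFun_of_le_two h0 h2, lowerFun_of_le_two h0 h2]
  field_simp
  ring

theorem hasDerivAt_gapFun {s : ℝ} (hs : 2 < s) :
    HasDerivAt gapFun (-(gapFun (s - 1) / (s - 1))) s := by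
  refine ((isSystemSolution.upper_deriv s hs).sub (isSystemSolution.lower_deriv s hs)).congr_deriv ?_
  have : s - 1 ≠ 0 := by linarith
  rw [gapFun]
  field_simp
  ring

theorem hasDerivAt_integral_window {g : ℝ → ℝ} (hg : ContinuousOn g (Ioi 0)) {s : ℝ} (hs : 1 < s) :
    HasDerivAt (fun s => ∫ t in (s - 1)..s, g t) (g s - g (s - 1)) s := by
  have hat : ∀ x : ℝ, 0 < x → HasDerivAt (fun y => ∫ t in (1 : ℝ)..y, g t) (g x) x := fun x hx =>
    intervalIntegral.integral_hasDerivAt_right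
      (ContinuousOn.intervalIntegrable_of_pos hg one_pos hx)
      (hg.stronglyMeasurableAtFilter isOpen_Ioi x hx) (hg.continuousAt (Ioi_mem_nhds hx))
  have h1 := (hat s (by linarith)).sub
    ((hat (s - 1) (by linarith)).comp s ((hasDerivAt_id s).sub_const 1))
  simp only [mul_one] at h1
  refine h1.congr_of_eventuallyEq ?_
  filter_upwards [Ioi_mem_nhds hs] with x hx
  have hx' : (1 : ℝ) < x := hx
  simp only [Pi.sub_apply, Function.comp, id]
  rw [eq_comm, intervalIntegral.integral_interval_sub_left
    (ContinuousOn.intervalIntegrable_of_pos hg one_pos (by linarith))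
    (ContinuousOn.intervalIntegrable_of_pos hg one_pos (by linarith))]

/-- Both sides have derivative `gapFun s - gapFun (s - 1)` and equal `sieveConst` at 2. In this
integrated form the delay equation shows positivity and fast decay directly. -/
theorem integral_gapFun {s : ℝ} (hs : 2 ≤ s) : ∫ t in (s - 1)..s, gapFun t = (s - 1) * gapFun s := by
  have h := eq_of_hasDerivAt_zero_Ioi (a := 2)
    (φ := fun s => (∫ t in (s - 1)..s, gapFun t) - (s - 1) * gapFun s) ?_ ?_ s hs
  · have h2 : ∫ t in ((2 : ℝ) - 1)..2, gapFun t = sieveConst := by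
      rw [intervalIntegral.integral_congr (g := fun _ => sieveConst)]
      · simp
      · intro t ht
        rw [uIcc_of_le (by norm_num)] at ht
        exact gapFun_of_le_two (by linarith [ht.1]) ht.2
    have h3 := gapFun_of_le_two (u := 2) two_pos le_rfl
    simp only [h2, h3] at h
    linarith
  · intro x hx
    have hx' : (2 : ℝ) ≤ x := hx
    refine ContinuousAt.continuousWithinAt ?_
    refine (hasDerivAt_integral_window continuousOn_gapFun (by linarith)).continuousAt.sub
      ((by fun_prop : ContinuousAt (fun s : ℝ => s - 1) x).mul
        (continuousOn_gapFun.continuousAt (Ioi_mem_nhds (by linarith))))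
  · intro x hx
    refine ((hasDerivAt_integral_window continuousOn_gapFun (by linarith)).sub
      (((hasDerivAt_id x).sub_const 1).mul (hasDerivAt_gapFun hx))).congr_deriv ?_
    have : x - 1 ≠ 0 := by linarith
    simp only [id]
    field_simp
    ring

theorem gapFun_pos {s : ℝ} (hs : 0 < s) : 0 < gapFun s := by
  rcases le_or_gt s 2 with h | h
  · rw [gapFun_of_le_two hs h]; exact sieveConst_pos
  refine pos_of_continuousOn_Ici (a := 2)
    (continuousOn_gapFun.mono fun x (hx : (2 : ℝ) ≤ x) => by simp only [mem_Ioi]; linarith)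
    (fun x hx ih => ?_) s h.le
  have h1 := integral_gapFun hx
  have h2 : 0 < ∫ t in (x - 1)..x, gapFun t := by
    refine intervalIntegral.intervalIntegral_pos_of_pos_on
      (ContinuousOn.intervalIntegrable_of_pos continuousOn_gapFun (by linarith) (by linarith))
      (fun t ht => ?_) (by linarith)
    rcases le_or_gt t 2 with h | h
    · rw [gapFun_of_le_two (by linarith [ht.1]) h]; exact sieveConst_pos
    · exact ih t h.le ht.2
  rw [h1] at h2
  exact pos_of_mul_pos_right h2 (by linarith)

theorem gapFun_antitoneOn : AntitoneOn gapFun (Ici 2) := by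
  refine antitoneOn_of_deriv_nonpos (convex_Ici 2)
    (continuousOn_gapFun.mono fun x (hx : (2 : ℝ) ≤ x) => by simp only [mem_Ioi]; linarith)
    (fun x hx => ?_) (fun x hx => ?_)
  · rw [interior_Ici] at hx
    exact (hasDerivAt_gapFun hx).differentiableAt.differentiableWithinAt
  · rw [interior_Ici] at hx
    have hx' : (2 : ℝ) < x := hx
    rw [(hasDerivAt_gapFun hx).deriv, neg_nonpos]
    exact div_nonneg (gapFun_pos (by linarith)).le (by linarith)

theorem gapFun_step {s : ℝ} (hs : 3 ≤ s) : (s - 1) * gapFun s ≤ gapFun (s - 1) := by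
  rw [← integral_gapFun (by linarith)]
  calc ∫ t in (s - 1)..s, gapFun t ≤ ∫ t in (s - 1)..s, gapFun (s - 1) := by
        refine intervalIntegral.integral_mono_on (by linarith)
          (ContinuousOn.intervalIntegrable_of_pos continuousOn_gapFun (by linarith) (by linarith))
          (by simp) (fun t ht => ?_)
        exact gapFun_antitoneOn (by simp only [mem_Ici]; linarith)
          (by simp only [mem_Ici]; linarith [ht.1]) ht.1
    _ = gapFun (s - 1) := by simp

/-- Beyond 4, `gapFun_step` gains a factor 1/(s-1) ≤ 1/3 < 1/e per unit step. Up to 4 the function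
is at most `sieveConst`, which the factor e^4 absorbs. -/
theorem gapFun_le_exp {s : ℝ} (hs : 1 ≤ s) :
    gapFun s ≤ sieveConst * Real.exp 4 * Real.exp (-s) := by
  have key : ∀ n : ℕ, ∀ s : ℝ, 1 ≤ s → s ≤ n + 4 →
      gapFun s ≤ sieveConst * Real.exp 4 * Real.exp (-s) := by
    intro n
    induction n with
    | zero =>
      intro s hs hs4
      have h1 : gapFun s ≤ sieveConst := by
        rcases le_or_gt s 2 with h | h
        · exact (gapFun_of_le_two (by linarith) h).le
        · rw [← gapFun_of_le_two (u := 2) two_pos le_rfl]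
          exact gapFun_antitoneOn self_mem_Ici h.le h.le
      rw [mul_assoc, ← Real.exp_add]
      have h2 : (1 : ℝ) ≤ Real.exp (4 + -s) := by
        apply Real.one_le_exp
        push_cast at hs4
        linarith
      nlinarith [sieveConst_pos]
    | succ n ih =>
      intro s hs hsn
      rcases le_or_gt s (n + 4) with h | h
      · exact ih s hs h
      have hn : (0 : ℝ) ≤ n := n.cast_nonneg
      have h1 := ih (s - 1) (by linarith) (by push_cast at hsn; linarith)
      have h2 := gapFun_step (s := s) (by linarith)
      have h3 : Real.exp (-(s - 1)) = Real.exp 1 * Real.exp (-s) := by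
        rw [← Real.exp_add]; ring_nf
      have h4 := Real.exp_one_lt_d9
      rw [h3] at h1
      have h5 : 0 < gapFun s := gapFun_pos (by linarith)
      have h6 : 0 < sieveConst * Real.exp 4 * Real.exp (-s) := by
        have := sieveConst_pos; positivity
      nlinarith
  exact key ⌈s⌉₊ s hs (by linarith [Nat.le_ceil s])

theorem lowerFun_lt_upperFun {s : ℝ} (hs : 0 < s) : lowerFun s < upperFun s := by
  have h := gapFun_pos hs
  rw [gapFun, ← mul_sub] at h
  exact sub_pos.1 (pos_of_mul_pos_right h hs.le)

theorem upperFun_sub_lowerFun_le {s : ℝ} (hs : 1 ≤ s) :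
    upperFun s - lowerFun s ≤ sieveConst * Real.exp 4 * Real.exp (-s) := by
  have h1 := gapFun_le_exp hs
  have h2 := lowerFun_lt_upperFun (s := s) (by linarith)
  rw [gapFun, ← mul_sub] at h1
  nlinarith

theorem hasDerivAt_upperFun {s : ℝ} (hs : 2 < s) :
    HasDerivAt upperFun ((lowerFun (s - 1) - upperFun s) / s) s := by
  have hs0 : s ≠ 0 := by linarith
  have h := (isSystemSolution.upper_deriv s hs).div (hasDerivAt_id s) hs0
  refine (h.congr_deriv ?_).congr_of_eventuallyEq ?_
  · simp only [id]
    field_simp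
  · filter_upwards [Ioi_mem_nhds hs] with x hx
    have : x ≠ 0 := by have : (2 : ℝ) < x := hx; linarith
    simp only [Pi.div_apply, id]
    field_simp

theorem hasDerivAt_lowerFun {s : ℝ} (hs : 2 < s) :
    HasDerivAt lowerFun ((upperFun (s - 1) - lowerFun s) / s) s := by
  have hs0 : s ≠ 0 := by linarith
  have h := (isSystemSolution.lower_deriv s hs).div (hasDerivAt_id s) hs0
  refine (h.congr_deriv ?_).congr_of_eventuallyEq ?_
  · simp only [id]
    field_simp
  · filter_upwards [Ioi_mem_nhds hs] with x hx
    have : x ≠ 0 := by have : (2 : ℝ) < x := hx; linarith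
    simp only [Pi.div_apply, id]
    field_simp

/-! ### Monotonicity and the common limit of `F` and `f`. -/

theorem antitoneOn_upperFun_of {S : ℝ} (h : ∀ t, 2 ≤ t → t < S → lowerFun (t - 1) ≤ upperFun t) :
    AntitoneOn upperFun (Ioc 0 S) := by
  have h1 : AntitoneOn upperFun (Ioc 0 2) := fun x hx y hy hxy => by
    rw [upperFun_of_le_two hx.1 hx.2, upperFun_of_le_two hy.1 hy.2]
    exact div_le_div_of_nonneg_left sieveConst_pos.le hx.1 hxy
  have h2 : AntitoneOn upperFun (Icc 2 S) := by
    refine antitoneOn_of_deriv_nonpos (convex_Icc 2 S)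
      (continuousOn_upperFun.mono fun x hx => by simp only [mem_Ioi]; linarith [hx.1])
      (fun x hx => ?_) (fun x hx => ?_)
    · rw [interior_Icc] at hx
      exact (hasDerivAt_upperFun hx.1).differentiableAt.differentiableWithinAt
    · rw [interior_Icc] at hx
      rw [(hasDerivAt_upperFun hx.1).deriv]
      exact div_nonpos_of_nonpos_of_nonneg (by linarith [h x hx.1.le hx.2]) (by linarith [hx.1])
  intro x hx y hy hxy
  rcases le_or_gt y 2 with hy2 | hy2
  · exact h1 ⟨hx.1, by linarith⟩ ⟨hy.1, hy2⟩ hxy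
  rcases le_or_gt x 2 with hx2 | hx2
  · exact (h2 ⟨le_rfl, by linarith [hy.2]⟩ ⟨hy2.le, hy.2⟩ hy2.le).trans
      (h1 ⟨hx.1, hx2⟩ ⟨two_pos, le_rfl⟩ hx2)
  · exact h2 ⟨hx2.le, hx.2⟩ ⟨hy2.le, hy.2⟩ hxy

theorem monotoneOn_lowerFun_of {S : ℝ} (h : ∀ t, 2 ≤ t → t < S → lowerFun t ≤ upperFun (t - 1)) :
    MonotoneOn lowerFun (Ioc 0 S) := by
  have h2 : MonotoneOn lowerFun (Icc 2 S) := by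
    refine monotoneOn_of_deriv_nonneg (convex_Icc 2 S)
      (continuousOn_lowerFun.mono fun x hx => by simp only [mem_Ioi]; linarith [hx.1])
      (fun x hx => ?_) (fun x hx => ?_)
    · rw [interior_Icc] at hx
      exact (hasDerivAt_lowerFun hx.1).differentiableAt.differentiableWithinAt
    · rw [interior_Icc] at hx
      rw [(hasDerivAt_lowerFun hx.1).deriv]
      exact div_nonneg (by linarith [h x hx.1.le hx.2]) (by linarith [hx.1])
  intro x hx y hy hxy
  rcases le_or_gt y 2 with hy2 | hy2
  · rw [lowerFun_of_le_two hx.1 (by linarith), lowerFun_of_le_two hy.1 hy2]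
  rcases le_or_gt x 2 with hx2 | hx2
  · have := h2 ⟨le_rfl, by linarith [hy.2]⟩ ⟨hy2.le, hy.2⟩ hy2.le
    rwa [lowerFun_of_le_two hx.1 hx2, ← lowerFun_of_le_two two_pos le_rfl]
  · exact h2 ⟨hx2.le, hx.2⟩ ⟨hy2.le, hy.2⟩ hxy

/-- These two differences govern the signs of F' and f'. If both are positive before x, then F
decreases and f increases up to x, so F(x) > f(x) ≥ f(x-1) and F(x-1) ≥ F(x) > f(x); hence they stay
positive at x. -/
theorem cross_differences_pos {s : ℝ} (hs : 2 ≤ s) :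
    0 < min (upperFun s - lowerFun (s - 1)) (upperFun (s - 1) - lowerFun s) := by
  refine pos_of_continuousOn_Ici (a := 2)
    (φ := fun s => min (upperFun s - lowerFun (s - 1)) (upperFun (s - 1) - lowerFun s))
    ?_ (fun x hx ih => ?_) s hs
  · intro x hx
    have hx' : (2 : ℝ) ≤ x := hx
    have h1 := continuousOn_upperFun.continuousAt (Ioi_mem_nhds (show 0 < x by linarith))
    have h2 := continuousOn_lowerFun.continuousAt (Ioi_mem_nhds (show 0 < x by linarith))
    have h3 := (continuousOn_comp_sub_one continuousOn_upperFun).continuousAt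
      (Ioi_mem_nhds (show 1 < x by linarith))
    have h4 := (continuousOn_comp_sub_one continuousOn_lowerFun).continuousAt
      (Ioi_mem_nhds (show 1 < x by linarith))
    exact ContinuousAt.continuousWithinAt ((h1.sub h4).min (h3.sub h2))
  · have h1 : AntitoneOn upperFun (Ioc 0 x) := antitoneOn_upperFun_of fun t ht htx => by
      have := lt_min_iff.1 (ih t ht htx)
      linarith [this.1]
    have h2 : MonotoneOn lowerFun (Ioc 0 x) := monotoneOn_lowerFun_of fun t ht htx => by
      have := lt_min_iff.1 (ih t ht htx)
      linarith [this.2]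
    have hm1 : x - 1 ∈ Ioc 0 x := ⟨by linarith, by linarith⟩
    have hm2 : x ∈ Ioc 0 x := ⟨by linarith, le_rfl⟩
    have h3 := h1 hm1 hm2 (by linarith)
    have h4 := h2 hm1 hm2 (by linarith)
    have h5 := lowerFun_lt_upperFun (s := x) (by linarith)
    refine lt_min ?_ ?_ <;> linarith

theorem antitoneOn_upperFun : AntitoneOn upperFun (Ioi 0) := fun x hx y hy hxy =>
  antitoneOn_upperFun_of (S := y) (fun t ht _ => by
    have := lt_min_iff.1 (cross_differences_pos ht)
    linarith [this.1]) ⟨hx, hxy⟩ ⟨hy, le_rfl⟩ hxy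

theorem monotoneOn_lowerFun : MonotoneOn lowerFun (Ioi 0) := fun x hx y hy hxy =>
  monotoneOn_lowerFun_of (S := y) (fun t ht _ => by
    have := lt_min_iff.1 (cross_differences_pos ht)
    linarith [this.2]) ⟨hx, hxy⟩ ⟨hy, le_rfl⟩ hxy

theorem lowerFun_lt_upperFun_of_pos {s t : ℝ} (hs : 0 < s) (ht : 0 < t) :
    lowerFun s < upperFun t := by
  have h1 := monotoneOn_lowerFun hs (lt_max_of_lt_left hs : 0 < max s t) (le_max_left s t)
  have h2 := antitoneOn_upperFun ht (lt_max_of_lt_left hs : 0 < max s t) (le_max_right s t)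
  have h3 := lowerFun_lt_upperFun (s := max s t) (lt_max_of_lt_left hs)
  linarith

theorem lowerFun_nonneg {s : ℝ} (hs : 0 < s) : 0 ≤ lowerFun s := by
  rcases le_or_gt s 2 with h | h
  · exact (lowerFun_of_le_two hs h).ge
  · rw [← lowerFun_of_le_two one_pos one_le_two]
    exact monotoneOn_lowerFun (mem_Ioi.2 one_pos) hs (by linarith)

/-- The supremum of f lies below every value of F, and F - f decays exponentially, so both functions
are squeezed onto it. -/
theorem exists_common_limit : ∃ l : ℝ, Tendsto upperFun atTop (𝓝 l) ∧
    Tendsto lowerFun atTop (𝓝 l) ∧ (∀ s, 0 < s → l ≤ upperFun s) ∧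
    ∀ s, 0 < s → lowerFun s ≤ l := by
  set S := lowerFun '' Ioi 0
  have hne : S.Nonempty := ⟨lowerFun 1, 1, mem_Ioi.2 one_pos, rfl⟩
  have hb : ∀ t, 0 < t → upperFun t ∈ upperBounds S := by
    rintro t ht _ ⟨s, hs, rfl⟩
    exact (lowerFun_lt_upperFun_of_pos hs ht).le
  have h1 : ∀ s, 0 < s → sSup S ≤ upperFun s := fun s hs => csSup_le hne (hb s hs)
  have h2 : ∀ s, 0 < s → lowerFun s ≤ sSup S := fun s hs =>
    le_csSup ⟨_, hb 1 one_pos⟩ ⟨s, hs, rfl⟩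
  have h3 : Tendsto (fun s : ℝ => sieveConst * Real.exp 4 * Real.exp (-s)) atTop (𝓝 0) := by
    have := (Real.tendsto_exp_neg_atTop_nhds_zero).const_mul (sieveConst * Real.exp 4)
    simpa using this
  refine ⟨sSup S, ?_, ?_, h1, h2⟩
  · have h4 := h3.const_add (sSup S)
    rw [add_zero] at h4
    refine tendsto_of_tendsto_of_tendsto_of_le_of_le' tendsto_const_nhds h4 ?_ ?_
    · filter_upwards [eventually_gt_atTop 0] with s hs using h1 s hs
    · filter_upwards [eventually_ge_atTop 1] with s hs
      linarith [upperFun_sub_lowerFun_le hs, h2 s (by linarith)]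
  · have h4 := h3.const_sub (sSup S)
    rw [sub_zero] at h4
    refine tendsto_of_tendsto_of_tendsto_of_le_of_le' h4 tendsto_const_nhds ?_ ?_
    · filter_upwards [eventually_ge_atTop 1] with s hs
      linarith [upperFun_sub_lowerFun_le hs, h1 s (by linarith)]
    · filter_upwards [eventually_gt_atTop 0] with s hs using h2 s hs

/-! ### The adjoint function and the limits of `F` and `f` at infinity -/

/-- `(1 - e^{-t}) / t`. -/
def einKernel (t : ℝ) : ℝ := (1 - Real.exp (-t)) / t

theorem einKernel_nonneg {t : ℝ} (ht : 0 ≤ t) : 0 ≤ einKernel t :=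
  div_nonneg (by linarith [Real.exp_le_one_iff.2 (neg_nonpos.2 ht)]) ht

theorem einKernel_le_one {t : ℝ} (ht : 0 ≤ t) : einKernel t ≤ 1 :=
  div_le_one_of_le₀ (by linarith [Real.add_one_le_exp (-t)]) ht

theorem continuousOn_einKernel : ContinuousOn einKernel (Ioi 0) :=
  ContinuousOn.div (by fun_prop) continuousOn_id fun x hx => ne_of_gt hx

theorem intervalIntegrable_of_bounded_pos {g : ℝ → ℝ} {C : ℝ} (hg : ContinuousOn g (Ioi 0))
    (hC : ∀ t, 0 ≤ t → |g t| ≤ C) {x y : ℝ} (hx : 0 ≤ x) (hy : 0 ≤ y) :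
    IntervalIntegrable g volume x y := by
  rw [intervalIntegrable_iff]
  have hsub : uIoc x y ⊆ Ioi 0 := fun t ht => lt_of_le_of_lt (le_min hx hy) ht.1
  have h0 : IntegrableOn (fun _ : ℝ => C) (uIoc x y) volume :=
    intervalIntegrable_iff.1 intervalIntegrable_const
  refine h0.mono' ?_ ?_
  · exact (hg.mono hsub).aestronglyMeasurable measurableSet_uIoc
  · refine (ae_restrict_iff' measurableSet_uIoc).2 (Eventually.of_forall fun t ht => ?_)
    exact hC t (hsub ht : (0 : ℝ) < t).le

theorem intervalIntegrable_einKernel {x y : ℝ} (hx : 0 ≤ x) (hy : 0 ≤ y) :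
    IntervalIntegrable einKernel volume x y :=
  intervalIntegrable_of_bounded_pos continuousOn_einKernel (C := 1) (fun t ht => by
    rw [abs_of_nonneg (einKernel_nonneg ht)]; exact einKernel_le_one ht) hx hy

/-- The entire exponential integral `∫₀ˣ (1 - e^{-t}) / t dt`. -/
def ein (x : ℝ) : ℝ := ∫ t in (0 : ℝ)..x, einKernel t

theorem hasDerivAt_ein {x : ℝ} (hx : 0 < x) : HasDerivAt ein (einKernel x) x :=
  intervalIntegral.integral_hasDerivAt_right (intervalIntegrable_einKernel le_rfl hx.le)
    (continuousOn_einKernel.stronglyMeasurableAtFilter isOpen_Ioi x hx)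
    (continuousOn_einKernel.continuousAt (Ioi_mem_nhds hx))

theorem ein_nonneg {x : ℝ} (hx : 0 ≤ x) : 0 ≤ ein x :=
  intervalIntegral.integral_nonneg hx fun _ ht => einKernel_nonneg ht.1

theorem ein_le {x : ℝ} (hx : 0 ≤ x) : ein x ≤ x := by
  calc ein x ≤ ∫ _ in (0 : ℝ)..x, (1 : ℝ) :=
        intervalIntegral.integral_mono_on hx (intervalIntegrable_einKernel le_rfl hx) (by simp)
          fun t ht => einKernel_le_one ht.1
    _ = x := by simp

theorem continuousOn_ein : ContinuousOn ein (Ioi 0) := fun _ hx =>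
  (hasDerivAt_ein hx).continuousAt.continuousWithinAt

/-- `∫₀ⁿ (1 - (1 - t/n)ⁿ) / t dt` is the `n`-th harmonic number. -/
theorem integral_harmonic (n : ℕ) (hn : 0 < n) :
    ∫ t in (0 : ℝ)..n, (1 - (1 - t / n) ^ n) / t = harmonic n := by
  have hn0 : (n : ℝ) ≠ 0 := by positivity
  have h1 : ∀ t : ℝ, t ≠ 0 →
      (1 - (1 - t / n) ^ n) / t = ∑ i ∈ Finset.range n, (1 - t / n) ^ i * (n : ℝ)⁻¹ := by
    intro t ht
    have h := geom_sum_mul (1 - t / (n : ℝ)) n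
    rw [← Finset.sum_mul, div_eq_iff ht]
    have h2 : (1 - t / (n : ℝ) - 1) = -(t * (n : ℝ)⁻¹) := by field_simp; ring
    rw [h2] at h
    linarith
  rw [intervalIntegral.integral_congr_ae (g := fun t =>
    ∑ i ∈ Finset.range n, (1 - t / n) ^ i * (n : ℝ)⁻¹) ?_]
  · rw [intervalIntegral.integral_finsetSum]
    · rw [harmonic, Rat.cast_sum]
      refine Finset.sum_congr rfl fun i _ => ?_
      have hd : ∀ t : ℝ, HasDerivAt (fun t : ℝ => -((1 - t / n) ^ (i + 1) * ((i : ℝ) + 1)⁻¹))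
          ((1 - t / n) ^ i * (n : ℝ)⁻¹) t := fun t => by
        refine (((((hasDerivAt_id t).div_const (n : ℝ)).const_sub 1).pow (i + 1)).mul_const
          ((i : ℝ) + 1)⁻¹).neg.congr_deriv ?_
        have : (i : ℝ) + 1 ≠ 0 := by positivity
        simp only [id, Nat.add_sub_cancel]
        push_cast
        field_simp
      rw [intervalIntegral.integral_eq_sub_of_hasDerivAt (fun t _ => hd t)
        ((by fun_prop : Continuous fun t : ℝ => (1 - t / n) ^ i * (n : ℝ)⁻¹).intervalIntegrable _ _)]
      rw [div_self hn0]
      simp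
    · intro i _
      exact (by fun_prop : Continuous fun t : ℝ => (1 - t / n) ^ i * (n : ℝ)⁻¹).intervalIntegrable _ _
  · exact Eventually.of_forall fun t ht => h1 t (by
      rw [uIoc_of_le (by positivity)] at ht
      exact ht.1.ne')

/-- Replacing e^(-t) by (1 - t/n)^n turns `ein n` into the harmonic number. The difference of the
two lies between 0 and t² e^(-t) / n, and ∫ t e^(-t) dt ≤ 1. -/
theorem abs_ein_sub_harmonic_le (n : ℕ) (hn : 0 < n) : |ein n - harmonic n| ≤ 1 / n := by
  have hn0 : (0 : ℝ) < n := by positivity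
  have hb : ∀ t : ℝ, 0 < t → t ≤ n →
      0 ≤ Real.exp (-t) - (1 - t / n) ^ n ∧
        Real.exp (-t) - (1 - t / n) ^ n ≤ t * (t * Real.exp (-t)) / n := by
    intro t ht htn
    refine ⟨sub_nonneg.2 (Real.one_sub_div_pow_le_exp_neg htn), ?_⟩
    have h1 : t / n ≤ 1 := div_le_one_of_le₀ htn hn0.le
    -- Since (1 - x) e^x ≥ 1 - x², Bernoulli's inequality bounds the n-th power from below.
    have h2 : 1 - t ^ 2 / n ≤ ((1 - t / n) * Real.exp (t / n)) ^ n := by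
      have h3 : (1 - t / n) * (1 + t / n) ≤ (1 - t / n) * Real.exp (t / n) :=
        mul_le_mul_of_nonneg_left (by linarith [Real.add_one_le_exp (t / n)]) (by linarith)
      have h5 : 0 ≤ t / n := by positivity
      have h4 : 1 + n * (-(t / n) ^ 2) ≤ (1 + -(t / n) ^ 2) ^ n :=
        one_add_mul_le_pow (by nlinarith) n
      calc 1 - t ^ 2 / n = 1 + n * (-(t / n) ^ 2) := by field_simp; ring
        _ ≤ (1 + -(t / n) ^ 2) ^ n := h4
        _ ≤ _ := pow_le_pow_left₀ (by nlinarith) (by linarith) n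
    rw [mul_pow, ← Real.exp_nat_mul, mul_div_cancel₀ _ hn0.ne'] at h2
    have h6 := mul_le_mul_of_nonneg_right h2 (Real.exp_pos (-t)).le
    rw [mul_assoc, ← Real.exp_add, add_neg_cancel, Real.exp_zero, mul_one] at h6
    have h7 : (1 - t ^ 2 / n) * Real.exp (-t) =
        Real.exp (-t) - t * (t * Real.exp (-t)) / n := by ring
    linarith
  have hint : ∫ t in (0 : ℝ)..n, t * Real.exp (-t) / n ≤ 1 / n := by
    have hd : ∀ t : ℝ, HasDerivAt (fun t : ℝ => -((t + 1) * Real.exp (-t) / n))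
        (t * Real.exp (-t) / n) t := fun t => by
      refine ((((hasDerivAt_id t).add_const 1).mul ((hasDerivAt_id t).neg.exp)).div_const
        (n : ℝ)).neg.congr_deriv ?_
      simp only [id, Pi.neg_apply]
      ring
    rw [intervalIntegral.integral_eq_sub_of_hasDerivAt (fun t _ => hd t)
      ((by fun_prop : Continuous fun t : ℝ => t * Real.exp (-t) / n).intervalIntegrable _ _)]
    have : 0 ≤ ((n : ℝ) + 1) * Real.exp (-n) / n := by positivity
    simp only [zero_add, neg_zero, Real.exp_zero, mul_one]
    linarith
  have hh : IntervalIntegrable (fun t : ℝ => (1 - (1 - t / n) ^ n) / t) volume 0 n := by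
    refine (intervalIntegrable_einKernel le_rfl hn0.le).add
      (g := fun t => (Real.exp (-t) - (1 - t / n) ^ n) / t) ?_ |>.congr_ae ?_
    · rw [intervalIntegrable_iff, uIoc_of_le hn0.le]
      refine ((by fun_prop : Continuous fun t : ℝ =>
        t * Real.exp (-t) / n).continuousOn.integrableOn_Icc.mono_set Ioc_subset_Icc_self).mono'
        ((ContinuousOn.div (by fun_prop) continuousOn_id
          fun x hx => ne_of_gt hx.1).aestronglyMeasurable measurableSet_Ioc) ?_
      refine (ae_restrict_iff' measurableSet_Ioc).2 (Eventually.of_forall fun t ht => ?_)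
      obtain ⟨h1, h2⟩ := hb t ht.1 ht.2
      rw [Real.norm_eq_abs, abs_of_nonneg (div_nonneg h1 ht.1.le), div_le_iff₀ ht.1]
      exact h2.trans_eq (by ring)
    · refine Eventually.of_forall fun t => ?_
      simp only [einKernel]
      ring
  rw [← integral_harmonic n hn, ein,
    ← intervalIntegral.integral_sub (intervalIntegrable_einKernel le_rfl hn0.le) hh]
  refine le_trans ?_ hint
  rw [← Real.norm_eq_abs]
  refine intervalIntegral.norm_integral_le_of_norm_le hn0.le ?_
    ((by fun_prop : Continuous fun t : ℝ => t * Real.exp (-t) / n).intervalIntegrable _ _)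
  refine Eventually.of_forall fun t ht => ?_
  obtain ⟨h1, h2⟩ := hb t ht.1 ht.2
  have h3 : einKernel t - (1 - (1 - t / n) ^ n) / t =
      -((Real.exp (-t) - (1 - t / n) ^ n) / t) := by rw [einKernel]; ring
  rw [h3, norm_neg, Real.norm_eq_abs, abs_of_nonneg (div_nonneg h1 ht.1.le), div_le_iff₀ ht.1]
  exact h2.trans_eq (by ring)

theorem tendsto_ein_sub_log : Tendsto (fun n : ℕ => ein n - Real.log n) atTop
    (𝓝 Real.eulerMascheroniConstant) := by
  have h1 : Tendsto (fun n : ℕ => ein n - harmonic n) atTop (𝓝 0) := by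
    refine squeeze_zero_norm' ?_ (tendsto_one_div_atTop_nhds_zero_nat (𝕜 := ℝ))
    filter_upwards [eventually_gt_atTop 0] with n hn using abs_ein_sub_harmonic_le n hn
  have h2 := h1.add Real.tendsto_harmonic_sub_log
  simpa using h2

theorem antitoneOn_ein_sub_log : AntitoneOn (fun x => ein x - Real.log x) (Ioi 0) := by
  have hd : ∀ x : ℝ, 0 < x → HasDerivAt (fun x => ein x - Real.log x) (einKernel x - x⁻¹) x :=
    fun x hx => (hasDerivAt_ein hx).sub (Real.hasDerivAt_log hx.ne')
  refine antitoneOn_of_deriv_nonpos (convex_Ioi 0)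
    (fun x hx => (hd x hx).continuousAt.continuousWithinAt) (fun x hx => ?_) (fun x hx => ?_)
  · rw [interior_Ioi] at hx
    exact (hd x hx).differentiableAt.differentiableWithinAt
  · rw [interior_Ioi] at hx
    have hx' : 0 < x := hx
    rw [(hd x hx).deriv, einKernel]
    have : 0 < Real.exp (-x) / x := by positivity
    rw [sub_div, inv_eq_one_div]
    linarith

/-- The difference is decreasing, so its value at x lies between those at the ceiling and the floor
of x, where the limit is known. -/
theorem tendsto_ein_sub_log_real : Tendsto (fun x : ℝ => ein x - Real.log x) atTop
    (𝓝 Real.eulerMascheroniConstant) := by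
  refine tendsto_of_tendsto_of_tendsto_of_le_of_le'
    (tendsto_ein_sub_log.comp (tendsto_nat_ceil_atTop (α := ℝ)))
    (tendsto_ein_sub_log.comp (tendsto_nat_floor_atTop (α := ℝ))) ?_ ?_
  · filter_upwards [eventually_ge_atTop 1] with x hx
    exact antitoneOn_ein_sub_log (by simp only [mem_Ioi]; linarith)
      (by simp only [mem_Ioi]; linarith [Nat.le_ceil x]) (Nat.le_ceil x)
  · filter_upwards [eventually_ge_atTop 1] with x hx
    exact antitoneOn_ein_sub_log
      (by simp only [mem_Ioi, Nat.cast_pos]; exact Nat.floor_pos.2 hx)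
      (by simp only [mem_Ioi]; linarith) (Nat.floor_le (by linarith))

theorem tendsto_mul_exp_neg_ein : Tendsto (fun x : ℝ => x * Real.exp (-ein x)) atTop
    (𝓝 (Real.exp (-Real.eulerMascheroniConstant))) := by
  have h := (Real.continuous_exp.tendsto _).comp tendsto_ein_sub_log_real.neg
  refine h.congr' ?_
  filter_upwards [eventually_gt_atTop 0] with x hx
  simp only [Function.comp, neg_sub]
  rw [Real.exp_sub, Real.exp_log hx, Real.exp_neg]
  rfl

/-- The adjoint function `∫₀^∞ e^{-sx - Ein(x)} dx`. -/
def adjointFun (s : ℝ) : ℝ := ∫ x in Ioi (0 : ℝ), Real.exp (-(s * x) - ein x)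

theorem continuousOn_adjoint_integrand (s : ℝ) :
    ContinuousOn (fun x => Real.exp (-(s * x) - ein x)) (Ioi 0) :=
  Real.continuous_exp.comp_continuousOn ((by fun_prop : ContinuousOn (fun x : ℝ => -(s * x))
    (Ioi 0)).sub continuousOn_ein)

theorem integrableOn_exp_neg_mul {s : ℝ} (hs : 0 < s) :
    IntegrableOn (fun x : ℝ => Real.exp (-(s * x))) (Ioi 0) := by
  have := integrableOn_exp_mul_Ioi (neg_lt_zero.2 hs) 0
  simpa using this

theorem integral_exp_neg_mul {s : ℝ} (hs : 0 < s) :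
    ∫ x in Ioi (0 : ℝ), Real.exp (-(s * x)) = 1 / s := by
  have := integral_exp_mul_Ioi (neg_lt_zero.2 hs) 0
  simpa using this

theorem integrableOn_adjoint {s : ℝ} (hs : 0 < s) :
    IntegrableOn (fun x => Real.exp (-(s * x) - ein x)) (Ioi 0) := by
  refine (integrableOn_exp_neg_mul hs).mono'
    ((continuousOn_adjoint_integrand s).aestronglyMeasurable measurableSet_Ioi) ?_
  refine (ae_restrict_iff' measurableSet_Ioi).2 (Eventually.of_forall fun x hx => ?_)
  rw [Real.norm_eq_abs, Real.abs_exp]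
  exact Real.exp_le_exp.2 (by linarith [ein_nonneg (le_of_lt hx)])

theorem integrableOn_mul_exp_neg_mul {s : ℝ} (hs : 0 < s) :
    IntegrableOn (fun x : ℝ => x * Real.exp (-(s * x))) (Ioi 0) := by
  have := integrableOn_rpow_mul_exp_neg_mul_rpow (s := 1) (p := 1) (b := s) (by norm_num) one_pos hs
  refine this.congr_fun (fun x _ => ?_) measurableSet_Ioi
  simp

theorem integrableOn_mul_adjoint {s : ℝ} (hs : 0 < s) :
    IntegrableOn (fun x => x * Real.exp (-(s * x) - ein x)) (Ioi 0) := by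
  refine (integrableOn_mul_exp_neg_mul hs).mono'
    ((continuousOn_id.mul (continuousOn_adjoint_integrand s)).aestronglyMeasurable
      measurableSet_Ioi) ?_
  refine (ae_restrict_iff' measurableSet_Ioi).2 (Eventually.of_forall fun x hx => ?_)
  have hx' : (0 : ℝ) < x := hx
  rw [norm_mul, Real.norm_eq_abs, Real.norm_eq_abs, Real.abs_exp, abs_of_pos hx']
  exact mul_le_mul_of_nonneg_left (Real.exp_le_exp.2 (by linarith [ein_nonneg hx'.le])) hx'.le

theorem adjointFun_nonneg (s : ℝ) : 0 ≤ adjointFun s :=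
  setIntegral_nonneg measurableSet_Ioi fun _ _ => (Real.exp_pos _).le

theorem adjointFun_le {s : ℝ} (hs : 0 < s) : adjointFun s ≤ 1 / s := by
  rw [← integral_exp_neg_mul hs]
  exact setIntegral_mono_on (integrableOn_adjoint hs) (integrableOn_exp_neg_mul hs)
    measurableSet_Ioi fun x hx => Real.exp_le_exp.2 (by linarith [ein_nonneg (le_of_lt hx)])

theorem le_adjointFun {s : ℝ} (hs : 0 < s) : 1 / (s + 1) ≤ adjointFun s := by
  rw [← integral_exp_neg_mul (by linarith : 0 < s + 1)]
  exact setIntegral_mono_on (integrableOn_exp_neg_mul (by linarith)) (integrableOn_adjoint hs)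
    measurableSet_Ioi fun x hx => Real.exp_le_exp.2 (by linarith [ein_le (le_of_lt hx)])

/-- Because x Ein'(x) = 1 - e^(-x), differentiating produces the adjoint integrand with s shifted to
s + 1. Integrating this over (0, ∞) yields both the value at 1 (from s = 0) and the recurrence. -/
theorem hasDerivAt_mul_exp_neg {s x : ℝ} (hx : 0 < x) :
    HasDerivAt (fun x => x * Real.exp (-(s * x) - ein x))
      (Real.exp (-((s + 1) * x) - ein x) - s * (x * Real.exp (-(s * x) - ein x))) x := by
  have h0 : HasDerivAt (fun x => -(s * x) - ein x) (-s - einKernel x) x :=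
    (((hasDerivAt_id x).const_mul s).neg.sub (hasDerivAt_ein hx)).congr_deriv (by simp)
  have h1 := (hasDerivAt_id x).mul h0.exp
  refine h1.congr_deriv ?_
  have h2 : Real.exp (-((s + 1) * x) - ein x) = Real.exp (-x) * Real.exp (-(s * x) - ein x) := by
    rw [← Real.exp_add]; ring_nf
  simp only [id, einKernel]
  rw [h2]
  field_simp
  ring

theorem continuousWithinAt_mul_exp_neg (s : ℝ) :
    ContinuousWithinAt (fun x => x * Real.exp (-(s * x) - ein x)) (Ici 0) 0 := by
  have h1 : ContinuousWithinAt (fun x : ℝ => x * Real.exp (|s| * x)) (Ici 0) 0 :=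
    Continuous.continuousWithinAt (by fun_prop)
  unfold ContinuousWithinAt at h1 ⊢
  simp only [zero_mul] at h1 ⊢
  refine squeeze_zero' ?_ ?_ h1
  · filter_upwards [self_mem_nhdsWithin] with x hx using mul_nonneg hx (Real.exp_pos _).le
  · filter_upwards [self_mem_nhdsWithin] with x hx
    refine mul_le_mul_of_nonneg_left (Real.exp_le_exp.2 ?_) hx
    have := mul_le_mul_of_nonneg_right (neg_abs_le s) (hx : (0 : ℝ) ≤ x)
    linarith [ein_nonneg (hx : (0 : ℝ) ≤ x)]

/-- The integrand is the derivative of x e^(-Ein(x)), which vanishes at 0 and tends to e^(-γ)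
because Ein(x) - log x → γ. -/
theorem adjointFun_one : adjointFun 1 = Real.exp (-Real.eulerMascheroniConstant) := by
  have h := integral_Ioi_of_hasDerivAt_of_tendsto (continuousWithinAt_mul_exp_neg 0)
    (f' := fun x => Real.exp (-(1 * x) - ein x))
    (fun x hx => (hasDerivAt_mul_exp_neg (s := 0) hx).congr_deriv (by simp))
    (integrableOn_adjoint one_pos) (m := Real.exp (-Real.eulerMascheroniConstant)) (by
      simpa using tendsto_mul_exp_neg_ein)
  simpa [adjointFun] using h

theorem adjointFun_add_one {s : ℝ} (hs : 0 < s) :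
    adjointFun (s + 1) = s * ∫ x in Ioi (0 : ℝ), x * Real.exp (-(s * x) - ein x) := by
  have h1 : IntegrableOn (fun x => s * (x * Real.exp (-(s * x) - ein x))) (Ioi 0) :=
    (integrableOn_mul_adjoint hs).const_mul s
  have h := integral_Ioi_of_hasDerivAt_of_tendsto (continuousWithinAt_mul_exp_neg s)
    (fun x hx => hasDerivAt_mul_exp_neg (s := s) hx)
    ((integrableOn_adjoint (by linarith : 0 < s + 1)).sub h1) (m := 0) ?_
  · rw [integral_sub (integrableOn_adjoint (by linarith : 0 < s + 1)) h1,
      integral_const_mul] at h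
    simp only [zero_mul, sub_zero] at h
    rw [adjointFun]
    linarith
  · have h2 : Tendsto (fun x : ℝ => x ^ (1 : ℝ) * Real.exp (-s * x)) atTop (𝓝 0) :=
      tendsto_rpow_mul_exp_neg_mul_atTop_nhds_zero 1 s hs
    refine squeeze_zero' ?_ ?_ h2
    · filter_upwards [eventually_ge_atTop 0] with x hx using mul_nonneg hx (Real.exp_pos _).le
    · filter_upwards [eventually_ge_atTop 0] with x hx
      rw [Real.rpow_one]
      exact mul_le_mul_of_nonneg_left (Real.exp_le_exp.2 (by linarith [ein_nonneg hx])) hx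

/-- Differentiation under the integral gives -∫ x e^(-sx - Ein(x)) dx, which `adjointFun_add_one`
evaluates. The result is the advanced equation dual to the delay equation of F + f. -/
theorem hasDerivAt_adjointFun {s : ℝ} (hs : 0 < s) :
    HasDerivAt adjointFun (-(adjointFun (s + 1) / s)) s := by
  have h := (hasDerivAt_integral_of_dominated_loc_of_deriv_le (μ := volume.restrict (Ioi (0 : ℝ)))
    (F := fun s x => Real.exp (-(s * x) - ein x))
    (F' := fun s x => -(x * Real.exp (-(s * x) - ein x)))
    (bound := fun x => x * Real.exp (-(s / 2 * x))) (s := Ioi (s / 2))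
    (Ioi_mem_nhds (by linarith))
    (Eventually.of_forall fun t =>
      (continuousOn_adjoint_integrand t).aestronglyMeasurable measurableSet_Ioi)
    (integrableOn_adjoint hs) (integrableOn_mul_adjoint hs).neg.aestronglyMeasurable
    ?_ (integrableOn_mul_exp_neg_mul (by linarith)) ?_).2
  · refine h.congr_deriv ?_
    rw [adjointFun_add_one hs, integral_neg, mul_div_cancel_left₀ _ hs.ne']
  · refine (ae_restrict_iff' measurableSet_Ioi).2 (Eventually.of_forall fun x hx t ht => ?_)
    have hx' : (0 : ℝ) < x := hx
    rw [norm_neg, norm_mul, Real.norm_eq_abs, Real.norm_eq_abs, Real.abs_exp, abs_of_pos hx']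
    have : s / 2 * x ≤ t * x := mul_le_mul_of_nonneg_right (le_of_lt ht) hx'.le
    exact mul_le_mul_of_nonneg_left (Real.exp_le_exp.2 (by linarith [ein_nonneg hx'.le])) hx'.le
  · refine Eventually.of_forall fun x t _ => ?_
    refine ((((hasDerivAt_id t).mul_const x).neg.sub_const (ein x)).exp).congr_deriv ?_
    simp only [id, Pi.neg_apply]
    ring

theorem continuousOn_adjointFun : ContinuousOn adjointFun (Ioi 0) := fun _ hx =>
  (hasDerivAt_adjointFun hx).continuousAt.continuousWithinAt

theorem tendsto_mul_adjointFun : Tendsto (fun s => s * adjointFun s) atTop (𝓝 1) := by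
  have h1 : Tendsto (fun s : ℝ => 1 - 1 / (s + 1)) atTop (𝓝 1) := by
    have h2 : Tendsto (fun s : ℝ => 1 / (s + 1)) atTop (𝓝 0) :=
      tendsto_const_nhds.div_atTop (tendsto_atTop_add_const_right _ 1 tendsto_id)
    simpa using h2.const_sub 1
  refine tendsto_of_tendsto_of_tendsto_of_le_of_le' h1 tendsto_const_nhds ?_ ?_
  · filter_upwards [eventually_gt_atTop 0] with s hs
    have := mul_le_mul_of_nonneg_left (le_adjointFun hs) hs.le
    have h3 : s * (1 / (s + 1)) = 1 - 1 / (s + 1) := by field_simp; ring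
    linarith
  · filter_upwards [eventually_gt_atTop 0] with s hs
    have := mul_le_mul_of_nonneg_left (adjointFun_le hs) hs.le
    rwa [mul_one_div_cancel hs.ne'] at this

/-- The pairing of `F + f` with the adjoint function. -/
def pairing (s : ℝ) : ℝ := (s * upperFun s + s * lowerFun s) * adjointFun s +
  ∫ t in (s - 1)..s, (upperFun t + lowerFun t) * adjointFun (t + 1)

theorem continuousOn_pairing_integrand :
    ContinuousOn (fun t => (upperFun t + lowerFun t) * adjointFun (t + 1)) (Ioi 0) :=
  (continuousOn_upperFun.add continuousOn_lowerFun).mul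
    (continuousOn_adjointFun.comp (by fun_prop) fun t (ht : (0 : ℝ) < t) => by
      simp only [mem_Ioi]; linarith)

/-- The derivative vanishes: the delayed values of F + f cancel against the lower end of the moving
window, and the advanced value of the adjoint function against its upper end. -/
theorem pairing_eq {s : ℝ} (hs : 2 ≤ s) : pairing s = pairing 2 := by
  refine eq_of_hasDerivAt_zero_Ioi (a := 2) ?_ (fun x hx => ?_) s hs
  · intro x hx
    have hx' : (2 : ℝ) ≤ x := hx
    have hx0 : Ioi (0 : ℝ) ∈ 𝓝 x := Ioi_mem_nhds (by linarith)
    refine ContinuousAt.continuousWithinAt (ContinuousAt.add ?_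
      (hasDerivAt_integral_window continuousOn_pairing_integrand (by linarith)).continuousAt)
    exact ((continuousAt_id.mul (continuousOn_upperFun.continuousAt hx0)).add
      (continuousAt_id.mul (continuousOn_lowerFun.continuousAt hx0))).mul
      (continuousOn_adjointFun.continuousAt hx0)
  · refine ((((isSystemSolution.upper_deriv x hx).add (isSystemSolution.lower_deriv x hx)).mul
      (hasDerivAt_adjointFun (by linarith))).add
      (hasDerivAt_integral_window continuousOn_pairing_integrand (by linarith))).congr_deriv ?_
    have : x ≠ 0 := by linarith
    rw [sub_add_cancel]
    simp only [Pi.add_apply]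
    field_simp
    ring

/-- On [1, 2] the integrand is the derivative of `-sieveConst * adjointFun`, so the terms at 2
cancel and 2e^γ · `adjointFun 1` = 2e^γ e^(-γ) remains. -/
theorem pairing_two : pairing 2 = 2 := by
  have h1 : ∫ t in ((2 : ℝ) - 1)..2, (upperFun t + lowerFun t) * adjointFun (t + 1) =
      -(sieveConst * adjointFun 2) - -(sieveConst * adjointFun 1) := by
    rw [show (2 : ℝ) - 1 = 1 by norm_num, intervalIntegral.integral_congr
      (g := fun t => -(sieveConst * -(adjointFun (t + 1) / t)))]
    · refine intervalIntegral.integral_eq_sub_of_hasDerivAt_of_le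
        (f := fun t => -(sieveConst * adjointFun t)) one_le_two ?_ ?_ ?_
      · exact (continuousOn_const.mul (continuousOn_adjointFun.mono fun x hx => by
          simp only [mem_Ioi]; linarith [hx.1])).neg
      · intro x hx
        exact ((hasDerivAt_adjointFun (by linarith [hx.1])).const_mul _).neg
      · refine ContinuousOn.intervalIntegrable_of_pos
          (g := fun t => -(sieveConst * -(adjointFun (t + 1) / t))) ?_ one_pos two_pos
        refine (continuousOn_const.mul (ContinuousOn.div ?_ continuousOn_id
          fun x (hx : (0 : ℝ) < x) => hx.ne').neg).neg
        exact continuousOn_adjointFun.comp (by fun_prop) fun t (ht : (0 : ℝ) < t) => by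
          simp only [mem_Ioi]; linarith
    · intro t ht
      rw [uIcc_of_le one_le_two] at ht
      simp only
      rw [upperFun_of_le_two (by linarith [ht.1]) ht.2, lowerFun_of_le_two (by linarith [ht.1]) ht.2]
      ring
  rw [pairing, h1, upperFun_of_le_two two_pos le_rfl, lowerFun_of_le_two two_pos le_rfl,
    adjointFun_one, sieveConst, Real.exp_neg]
  have := Real.exp_ne_zero Real.eulerMascheroniConstant
  field_simp
  ring

theorem tendsto_pairing {l : ℝ} (h1 : Tendsto upperFun atTop (𝓝 l))
    (h2 : Tendsto lowerFun atTop (𝓝 l)) : Tendsto pairing atTop (𝓝 (2 * l)) := by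
  have h3 : Tendsto (fun s => ∫ t in (s - 1)..s, (upperFun t + lowerFun t) * adjointFun (t + 1))
      atTop (𝓝 0) := by
    have h4 : Tendsto (fun s : ℝ => 2 * sieveConst * (1 / s)) atTop (𝓝 0) := by
      simpa using (tendsto_inv_atTop_zero (𝕜 := ℝ)).const_mul (2 * sieveConst)
    refine squeeze_zero' ?_ ?_ h4
    · filter_upwards [eventually_ge_atTop 2] with s hs
      refine intervalIntegral.integral_nonneg (by linarith) fun t ht => ?_
      have ht0 : 0 < t := by linarith [ht.1]
      exact mul_nonneg (add_nonneg ((lowerFun_nonneg ht0).trans (lowerFun_lt_upperFun ht0).le)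
        (lowerFun_nonneg ht0)) (adjointFun_nonneg _)
    · filter_upwards [eventually_ge_atTop 2] with s hs
      calc ∫ t in (s - 1)..s, (upperFun t + lowerFun t) * adjointFun (t + 1)
          ≤ ∫ t in (s - 1)..s, 2 * sieveConst * (1 / s) := by
            refine intervalIntegral.integral_mono_on (by linarith)
              (ContinuousOn.intervalIntegrable_of_pos continuousOn_pairing_integrand
                (by linarith) (by linarith)) (by simp) fun t ht => ?_
            have ht0 : 0 < t := by linarith [ht.1]
            have h5 : upperFun t ≤ sieveConst := by
              have := antitoneOn_upperFun (mem_Ioi.2 one_pos) (mem_Ioi.2 ht0) (by linarith [ht.1])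
              rwa [upperFun_of_le_two one_pos one_le_two, div_one] at this
            have h6 : adjointFun (t + 1) ≤ 1 / s := (adjointFun_le (by linarith)).trans
              (one_div_le_one_div_of_le (by linarith) (by linarith [ht.1]))
            have h7 := lowerFun_lt_upperFun ht0
            exact mul_le_mul (by linarith) h6 (adjointFun_nonneg _)
              (by linarith [sieveConst_pos])
        _ = 2 * sieveConst * (1 / s) := by simp
  have h5 := ((h1.add h2).mul tendsto_mul_adjointFun).add h3
  rw [mul_one, add_zero, ← two_mul] at h5
  refine h5.congr fun s => ?_
  rw [pairing]
  ring

/-- The constant pairing equals 2 and tends to twice the common limit, so the limit is 1. -/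
theorem one_le_upperFun_and_lowerFun_le_one : (∀ s, 0 < s → 1 ≤ upperFun s) ∧
    (∀ s, 0 < s → lowerFun s ≤ 1) := by
  obtain ⟨l, h1, h2, h3, h4⟩ := exists_common_limit
  have h5 := tendsto_pairing h1 h2
  have h6 : Tendsto pairing atTop (𝓝 2) := by
    refine tendsto_const_nhds.congr' ?_
    filter_upwards [eventually_ge_atTop 2] with s hs
    rw [pairing_eq hs, pairing_two]
  have h7 := tendsto_nhds_unique h5 h6
  have h8 : l = 1 := by linarith
  subst h8
  exact ⟨h3, h4⟩

theorem one_le_upperFun {s : ℝ} (hs : 0 < s) : 1 ≤ upperFun s := one_le_upperFun_and_lowerFun_le_one.1 s hs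

theorem lowerFun_le_one {s : ℝ} (hs : 0 < s) : lowerFun s ≤ 1 := one_le_upperFun_and_lowerFun_le_one.2 s hs

/-- The integral is s(F(s) - 1) - t(F(t) - 1), and the discarded endpoint term has a favourable sign
because F ≥ 1. Divided by s, the bound is what Buchstab's identity needs to reproduce F(s) - 1; the
next lemma does the same for f. -/
theorem integral_one_sub_lowerFun_le {s t : ℝ} (hs : 2 ≤ s) (hst : s ≤ t) :
    ∫ x in s..t, (1 - lowerFun (x - 1)) ≤ s * (upperFun s - 1) := by
  rw [intervalIntegral.integral_sub (by simp)
    (intervalIntegrable_comp_sub_one continuousOn_lowerFun (by linarith) (by linarith)),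
    integral_lowerFun_sub_one hs hst]
  have := one_le_upperFun (s := t) (by linarith)
  simp only [intervalIntegral.integral_const, smul_eq_mul, mul_one]
  nlinarith

theorem integral_upperFun_sub_one_le {s t : ℝ} (hs : 2 ≤ s) (hst : s ≤ t) :
    ∫ x in s..t, (upperFun (x - 1) - 1) ≤ s * (1 - lowerFun s) := by
  rw [intervalIntegral.integral_sub
    (intervalIntegrable_comp_sub_one continuousOn_upperFun (by linarith) (by linarith)) (by simp),
    integral_upperFun_sub_one hs hst]
  have := lowerFun_le_one (s := t) (by linarith)
  simp only [intervalIntegral.integral_const, smul_eq_mul, mul_one]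
  nlinarith

theorem upperFun_sub_one_le {s : ℝ} (hs : 1 ≤ s) :
    upperFun s - 1 ≤ sieveConst * Real.exp 4 * Real.exp (-s) := by
  linarith [upperFun_sub_lowerFun_le hs, lowerFun_le_one (s := s) (by linarith)]

theorem one_sub_lowerFun_le {s : ℝ} (hs : 1 ≤ s) :
    1 - lowerFun s ≤ sieveConst * Real.exp 4 * Real.exp (-s) := by
  linarith [upperFun_sub_lowerFun_le hs, one_le_upperFun (s := s) (by linarith)]

/-! ### Explicit formulas for `F` and `f` on short intervals -/

theorem integral_triangle_swap {α β : ℝ} (h : α ≤ β) {G : ℝ → ℝ → ℝ}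
    (hG : ContinuousOn (Function.uncurry G) (Icc α β ×ˢ Icc α β)) :
    ∫ y in α..β, ∫ u in α..y, G u y = ∫ u in α..β, ∫ y in u..β, G u y := by
  set H : ℝ × ℝ → ℝ := {p : ℝ × ℝ | p.1 ≤ p.2}.indicator (Function.uncurry G) with hH
  have hmeas : MeasurableSet {p : ℝ × ℝ | p.1 ≤ p.2} := measurableSet_le measurable_fst measurable_snd
  have hint : Integrable H ((volume.restrict (Ioc α β)).prod (volume.restrict (Ioc α β))) := by
    rw [Measure.prod_restrict]
    have h1 : IntegrableOn (Function.uncurry G) (Icc α β ×ˢ Icc α β) (volume.prod volume) :=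
      hG.integrableOn_compact (isCompact_Icc.prod isCompact_Icc)
    exact (h1.mono_set (prod_mono Ioc_subset_Icc_self Ioc_subset_Icc_self)).indicator hmeas
  have h1 : ∀ y ∈ uIcc α β, ∫ u in α..y, G u y = ∫ u in Ioc α β, H (u, y) := by
    intro y hy
    rw [uIcc_of_le h] at hy
    rw [intervalIntegral.integral_of_le hy.1]
    have h2 : (fun u => H (u, y)) = (Iic y).indicator (fun u => G u y) := by
      funext u
      by_cases hu : u ≤ y <;> simp [hH, indicator, hu]
    rw [h2, setIntegral_indicator measurableSet_Iic, Ioc_inter_Iic, min_eq_right hy.2]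
  have h3 : ∀ u ∈ uIcc α β, ∫ y in u..β, G u y = ∫ y in Ioc α β, H (u, y) := by
    intro u hu
    rw [uIcc_of_le h] at hu
    rw [intervalIntegral.integral_of_le hu.2, ← integral_Icc_eq_integral_Ioc]
    have h2 : (fun y => H (u, y)) = (Ici u).indicator (fun y => G u y) := by
      funext y
      by_cases hy : u ≤ y <;> simp [hH, indicator, hy]
    rw [h2, setIntegral_indicator measurableSet_Ici]
    refine setIntegral_congr_set ?_
    rcases eq_or_lt_of_le hu.1 with rfl | hlt
    · have : Ioc α β ∩ Ici α = Ioc α β := inter_eq_left.2 fun x hx => hx.1.le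
      rw [this]
      exact Ioc_ae_eq_Icc.symm
    · have : Ioc α β ∩ Ici u = Icc u β := by
        ext x
        simp only [mem_inter_iff, mem_Ioc, mem_Ici, mem_Icc]
        constructor
        · rintro ⟨⟨_, h4⟩, h5⟩
          exact ⟨h5, h4⟩
        · rintro ⟨h4, h5⟩
          exact ⟨⟨by linarith, h5⟩, h4⟩
      exact this.symm ▸ ae_eq_refl _
  rw [intervalIntegral.integral_congr h1, intervalIntegral.integral_congr h3,
    intervalIntegral.integral_of_le h, intervalIntegral.integral_of_le h]
  exact (integral_integral_swap (f := fun u y => H (u, y)) hint).symm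

theorem upperFun_of_le_three {t : ℝ} (h0 : 0 < t) (h3 : t ≤ 3) : upperFun t = sieveConst / t := by
  rcases le_or_gt t 2 with h | h
  · exact upperFun_of_le_two h0 h
  have h1 := integral_lowerFun_sub_one le_rfl h.le
  rw [upperFun_of_le_two two_pos le_rfl, intervalIntegral.integral_congr (g := fun _ => 0)] at h1
  · simp only [intervalIntegral.integral_const, smul_zero] at h1
    rw [eq_div_iff h0.ne']
    linarith
  · intro x hx
    rw [uIcc_of_le h.le] at hx
    exact lowerFun_of_le_two (by linarith [hx.1]) (by linarith [hx.2])

/-- `log (u - 1) / u`. -/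
def logKernel (u : ℝ) : ℝ := Real.log (u - 1) / u

theorem continuousOn_logKernel : ContinuousOn logKernel (Ioi 1) :=
  ContinuousOn.div (ContinuousOn.log (by fun_prop) fun x (hx : (1 : ℝ) < x) => by linarith)
    continuousOn_id fun x (hx : (1 : ℝ) < x) => by linarith [show id x = x from rfl]

theorem intervalIntegrable_logKernel {x y : ℝ} (hx : 1 < x) (hy : 1 < y) :
    IntervalIntegrable logKernel volume x y :=
  (continuousOn_logKernel.mono fun _ ht => lt_of_lt_of_le (lt_min hx hy) ht.1).intervalIntegrable

/-- `∫₂^{t-1} log (u - 1) / u du`. -/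
def logIntegral (t : ℝ) : ℝ := ∫ u in (2 : ℝ)..(t - 1), logKernel u

theorem hasDerivAt_logIntegral {t : ℝ} (ht : 2 < t) :
    HasDerivAt logIntegral (logKernel (t - 1)) t := by
  have h := intervalIntegral.integral_hasDerivAt_right (a := 2) (b := t - 1)
    (intervalIntegrable_logKernel (by norm_num) (by linarith))
    (continuousOn_logKernel.stronglyMeasurableAtFilter isOpen_Ioi (t - 1)
      (by simp only [mem_Ioi]; linarith))
    (continuousOn_logKernel.continuousAt (Ioi_mem_nhds (by linarith)))
  exact (HasDerivAt.comp t (h₂ := fun y => ∫ u in (2 : ℝ)..y, logKernel u) h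
    ((hasDerivAt_id t).sub_const 1)).congr_deriv (mul_one _)

theorem continuousOn_logIntegral : ContinuousOn logIntegral (Ioi 2) := fun _ hx =>
  (hasDerivAt_logIntegral hx).continuousAt.continuousWithinAt

theorem logIntegral_three : logIntegral 3 = 0 := by
  rw [logIntegral]; norm_num

theorem integral_logKernel_sub_one {s t : ℝ} (hs : 3 ≤ s) (hst : s ≤ t) :
    ∫ x in s..t, logKernel (x - 1) = logIntegral t - logIntegral s := by
  refine intervalIntegral.integral_eq_sub_of_hasDerivAt (fun x hx => ?_) ?_
  · rw [uIcc_of_le hst] at hx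
    exact hasDerivAt_logIntegral (by linarith [hx.1])
  · refine ((continuousOn_logKernel.comp (f := fun x => x - 1) (s := Ioi 2) (by fun_prop)
      fun x (hx : (2 : ℝ) < x) => by simp only [mem_Ioi]; linarith).mono fun x hx => ?_).intervalIntegrable
    rw [uIcc_of_le hst] at hx
    simp only [mem_Ioi]; linarith [hx.1]

theorem mul_lowerFun_of_le_four {s : ℝ} (h2 : 2 ≤ s) (h4 : s ≤ 4) :
    s * lowerFun s = sieveConst * Real.log (s - 1) := by
  have h1 := integral_upperFun_sub_one le_rfl h2
  rw [lowerFun_of_le_two two_pos le_rfl, intervalIntegral.integral_congr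
    (g := fun x => sieveConst * (1 / (x - 1)))] at h1
  · have h3 : ∫ x in (2 : ℝ)..s, sieveConst * (1 / (x - 1)) =
        sieveConst * Real.log (s - 1) - sieveConst * Real.log (2 - 1) := by
      refine intervalIntegral.integral_eq_sub_of_hasDerivAt
        (f := fun x => sieveConst * Real.log (x - 1)) (fun x hx => ?_) ?_
      · rw [uIcc_of_le h2] at hx
        exact (((hasDerivAt_id x).sub_const 1).log (by simp only [id]; linarith [hx.1])).const_mul _
      · refine ContinuousOn.intervalIntegrable (continuousOn_const.mul
          (continuousOn_const.div (by fun_prop) fun x hx => ?_))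
        rw [uIcc_of_le h2] at hx
        linarith [hx.1]
    rw [h3] at h1
    norm_num at h1
    linarith
  · intro x hx
    rw [uIcc_of_le h2] at hx
    simp only
    rw [upperFun_of_le_three (by linarith [hx.1]) (by linarith [hx.2])]
    ring

theorem mul_upperFun_of_le_five {t : ℝ} (h3 : 3 ≤ t) (h5 : t ≤ 5) :
    t * upperFun t = sieveConst * (1 + logIntegral t) := by
  have h1 := integral_lowerFun_sub_one (s := 3) (by norm_num) h3
  rw [upperFun_of_le_three three_pos le_rfl, intervalIntegral.integral_congr
    (g := fun x => sieveConst * logKernel (x - 1)), intervalIntegral.integral_const_mul,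
    integral_logKernel_sub_one le_rfl h3, logIntegral_three] at h1
  · linarith
  · intro x hx
    rw [uIcc_of_le h3] at hx
    have h4 := mul_lowerFun_of_le_four (s := x - 1) (by linarith [hx.1]) (by linarith [hx.2])
    have h6 : x - 1 ≠ 0 := by linarith [hx.1]
    simp only [logKernel]
    rw [mul_div_assoc', eq_div_iff h6]
    linarith

/-- `∫₄ˢ L(x - 1) / (x - 1) dx` for the function `L = logIntegral`. -/
def logIntegral₂ (s : ℝ) : ℝ := ∫ x in (4 : ℝ)..s, logIntegral (x - 1) / (x - 1)

theorem continuousOn_logIntegral₂_integrand :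
    ContinuousOn (fun x => logIntegral (x - 1) / (x - 1)) (Ioi 3) :=
  (continuousOn_logIntegral.comp (by fun_prop) fun x (hx : (3 : ℝ) < x) => by
    simp only [mem_Ioi]; linarith).div (by fun_prop) fun x (hx : (3 : ℝ) < x) => by linarith

theorem mul_lowerFun_of_le_six {s : ℝ} (h4 : 4 ≤ s) (h6 : s ≤ 6) :
    s * lowerFun s = sieveConst * (Real.log (s - 1) + logIntegral₂ s) := by
  have h1 := integral_upperFun_sub_one (s := 4) (by norm_num) h4
  have hI : IntervalIntegrable (fun x => logIntegral (x - 1) / (x - 1)) volume 4 s := by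
    refine (continuousOn_logIntegral₂_integrand.mono fun x hx => ?_).intervalIntegrable
    rw [uIcc_of_le h4] at hx
    simp only [mem_Ioi]; linarith [hx.1]
  have hJ : IntervalIntegrable (fun x : ℝ => 1 / (x - 1)) volume 4 s := by
    refine ContinuousOn.intervalIntegrable (continuousOn_const.div (by fun_prop) fun x hx => ?_)
    rw [uIcc_of_le h4] at hx
    linarith [hx.1]
  rw [mul_lowerFun_of_le_four (by norm_num) le_rfl, intervalIntegral.integral_congr
    (g := fun x => sieveConst * (1 / (x - 1) + logIntegral (x - 1) / (x - 1))),
    intervalIntegral.integral_const_mul, intervalIntegral.integral_add hJ hI] at h1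
  · have h3 : ∫ x in (4 : ℝ)..s, 1 / (x - 1) = Real.log (s - 1) - Real.log (4 - 1) := by
      refine intervalIntegral.integral_eq_sub_of_hasDerivAt
        (f := fun x => Real.log (x - 1)) (fun x hx => ?_) hJ
      rw [uIcc_of_le h4] at hx
      exact ((hasDerivAt_id x).sub_const 1).log (by simp only [id]; linarith [hx.1])
    rw [h3] at h1
    rw [logIntegral₂]
    linarith
  · intro x hx
    rw [uIcc_of_le h4] at hx
    have h4 := mul_upperFun_of_le_five (t := x - 1) (by linarith [hx.1]) (by linarith [hx.2])
    have h6 : x - 1 ≠ 0 := by linarith [hx.1]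
    simp only
    rw [← add_div, mul_div_assoc', eq_div_iff h6]
    linarith

/-- The inner double integral of `I₃`. -/
def logIntegral₃ (t : ℝ) : ℝ := ∫ u in (2 : ℝ)..(t - 3), Real.log (u - 1) / u *
      ∫ v in (u + 2)..(t - 1), 1 / v * Real.log ((v - 1) / (u + 1))

/-- Exchanging the order over the triangle lets the outer variable be integrated explicitly, giving
the logarithm in the kernel of `I₃`. -/
theorem logIntegral₂_eq {v : ℝ} (hv : 4 ≤ v) :
    logIntegral₂ v = ∫ u in (2 : ℝ)..(v - 2), logKernel u * Real.log ((v - 1) / (u + 1)) := by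
  have h1 : logIntegral₂ v = ∫ y in (2 : ℝ)..(v - 2), ∫ u in (2 : ℝ)..y, logKernel u * (1 / (y + 1)) := by
    have h2 := intervalIntegral.integral_comp_sub_right (a := 4) (b := v)
      (fun y => ∫ u in (2 : ℝ)..y, logKernel u * (1 / (y + 1))) 2
    rw [show (4 : ℝ) - 2 = 2 by norm_num] at h2
    rw [← h2, logIntegral₂]
    refine intervalIntegral.integral_congr fun x _ => ?_
    rw [intervalIntegral.integral_mul_const, logIntegral, show x - 1 - 1 = x - 2 by ring,
      show x - 2 + 1 = x - 1 by ring, mul_one_div]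
  rw [h1, integral_triangle_swap (by linarith) (G := fun u y => logKernel u * (1 / (y + 1)))]
  · refine intervalIntegral.integral_congr fun u hu => ?_
    rw [uIcc_of_le (by linarith)] at hu
    rw [intervalIntegral.integral_const_mul]
    congr 1
    rw [intervalIntegral.integral_eq_sub_of_hasDerivAt (f := fun y => Real.log (y + 1))]
    · rw [Real.log_div (by linarith) (by linarith [hu.1])]
      ring_nf
    · intro x hx
      rw [uIcc_of_le hu.2] at hx
      exact ((hasDerivAt_id x).add_const 1).log (by simp only [id]; linarith [hx.1, hu.1])
    · refine ContinuousOn.intervalIntegrable (continuousOn_const.div (by fun_prop) fun x hx => ?_)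
      rw [uIcc_of_le hu.2] at hx
      linarith [hx.1, hu.1]
  · refine ContinuousOn.mul (continuousOn_logKernel.comp continuousOn_fst fun p hp => ?_)
      (continuousOn_const.div (by fun_prop) fun p hp => ?_)
    · simp only [mem_Ioi]; linarith [hp.1.1]
    · linarith [hp.2.1]

theorem integral_logIntegral₂ {t : ℝ} (ht : 5 ≤ t) :
    ∫ x in (5 : ℝ)..t, logIntegral₂ (x - 1) / (x - 1) = logIntegral₃ t := by
  have h1 : ∫ x in (5 : ℝ)..t, logIntegral₂ (x - 1) / (x - 1) =
      ∫ v in (2 : ℝ)..(t - 3), ∫ u in (2 : ℝ)..v,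
        logKernel u * (1 / (v + 2) * Real.log ((v + 1) / (u + 1))) := by
    have h2 := intervalIntegral.integral_comp_sub_right (a := 5) (b := t)
      (fun v => ∫ u in (2 : ℝ)..v, logKernel u * (1 / (v + 2) * Real.log ((v + 1) / (u + 1)))) 3
    rw [show (5 : ℝ) - 3 = 2 by norm_num] at h2
    rw [← h2]
    refine intervalIntegral.integral_congr fun x hx => ?_
    rw [uIcc_of_le ht] at hx
    rw [logIntegral₂_eq (by linarith [hx.1]), div_eq_mul_one_div, mul_comm,
      ← intervalIntegral.integral_const_mul, show x - 1 - 2 = x - 3 by ring]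
    refine intervalIntegral.integral_congr fun u _ => ?_
    rw [show x - 1 - 1 = x - 3 + 1 by ring, show x - 1 = x - 3 + 2 by ring]
    ring
  rw [h1, integral_triangle_swap (by linarith)
    (G := fun u v => logKernel u * (1 / (v + 2) * Real.log ((v + 1) / (u + 1))))]
  · rw [logIntegral₃]
    refine intervalIntegral.integral_congr fun u _ => ?_
    rw [intervalIntegral.integral_const_mul, logKernel]
    congr 1
    have h3 := intervalIntegral.integral_comp_add_right (a := u) (b := t - 3)
      (fun v => 1 / v * Real.log ((v - 1) / (u + 1))) 2
    rw [show t - 3 + 2 = t - 1 by ring] at h3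
    rw [← h3]
    refine intervalIntegral.integral_congr fun v _ => ?_
    rw [show v + 2 - 1 = v + 1 by ring]
  · refine ContinuousOn.mul (continuousOn_logKernel.comp continuousOn_fst fun p hp => ?_)
      (ContinuousOn.mul (continuousOn_const.div (by fun_prop) fun p hp => ?_)
        (ContinuousOn.log (ContinuousOn.div (by fun_prop) (by fun_prop) fun p hp => ?_)
          fun p hp => ?_))
    · simp only [mem_Ioi]; linarith [hp.1.1]
    · linarith [hp.2.1]
    · linarith [hp.1.1]
    · have h1 := hp.1.1
      have h2 := hp.2.1
      exact (div_pos (by linarith) (by linarith)).ne'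

theorem mul_upperFun_of_le_seven {t : ℝ} (h5 : 5 ≤ t) (h7 : t ≤ 7) :
    t * upperFun t = sieveConst * (1 + logIntegral t + logIntegral₃ t) := by
  have h1 := integral_lowerFun_sub_one (s := 5) (by norm_num) h5
  have hI : IntervalIntegrable (fun x => logKernel (x - 1)) volume 5 t := by
    refine ((continuousOn_logKernel.comp (f := fun x => x - 1) (s := Ioi 2) (by fun_prop)
      fun x (hx : (2 : ℝ) < x) => by simp only [mem_Ioi]; linarith).mono fun x hx => ?_).intervalIntegrable
    rw [uIcc_of_le h5] at hx
    simp only [mem_Ioi]; linarith [hx.1]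
  have hcongr : EqOn (fun x => lowerFun (x - 1))
      (fun x => sieveConst * (logKernel (x - 1) + logIntegral₂ (x - 1) / (x - 1))) (uIcc 5 t) := by
    intro x hx
    rw [uIcc_of_le h5] at hx
    have h4 := mul_lowerFun_of_le_six (s := x - 1) (by linarith [hx.1]) (by linarith [hx.2])
    have h6 : x - 1 ≠ 0 := by linarith [hx.1]
    simp only [logKernel]
    rw [← add_div, mul_div_assoc', eq_div_iff h6]
    linarith
  -- Integrability is read off from the formula for f: the function is a difference of two
  -- integrable ones.
  have hJ : IntervalIntegrable (fun x => logIntegral₂ (x - 1) / (x - 1)) volume 5 t := by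
    have h2 := ((intervalIntegrable_comp_sub_one continuousOn_lowerFun (s := 5) (t := t)
      (by norm_num) (by linarith)).const_mul sieveConst⁻¹).sub hI
    refine h2.congr fun x hx => ?_
    have h3 := hcongr (uIoc_subset_uIcc hx)
    simp only at h3 ⊢
    rw [h3, inv_mul_cancel_left₀ sieveConst_pos.ne']
    ring
  rw [mul_upperFun_of_le_five (by norm_num) le_rfl, intervalIntegral.integral_congr hcongr,
    intervalIntegral.integral_const_mul, intervalIntegral.integral_add hI hJ,
    integral_logKernel_sub_one (by norm_num) h5, integral_logIntegral₂ h5] at h1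
  linarith

/-- With t = b - u the integrand becomes κ(t) · tF(t) on [a, b-1]. Since a < 3 and 5 < b - 1 ≤ 7,
the explicit formulas for tF(t) on the ranges up to 3, 5 and 7 cover it. The constant term gives
`I₁`, the single logarithmic integral `I₂`, and the iterated one `I₃`. -/
theorem integral_weight_upperFun {a b : ℝ} (ha₁ : 1 ≤ a) (ha₃ : a < 3) (hab : a + 5 < b)
    (hb : b ≤ 8) :
    ∫ u in (1 : ℝ)..(b - a), (1 - u / (b - a)) * upperFun (b - u) / u =
      sieveConst * (I₁ a b + I₂ a b + I₃ a b) := by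
  set κ : ℝ → ℝ := fun t => 1 / t * (1 / (b - t) - 1 / (b - a)) with hκ
  have hκc : ContinuousOn κ (Icc a (b - 1)) := by
    refine ContinuousOn.mul (continuousOn_const.div continuousOn_id fun x hx => ?_)
      ((continuousOn_const.div (by fun_prop) fun x hx => ?_).sub continuousOn_const)
    · linarith [hx.1, show id x = x from rfl]
    · linarith [hx.2]
  have hint : ∀ {g : ℝ → ℝ} {x y : ℝ}, ContinuousOn g (Icc x y) → a ≤ x → x ≤ y → y ≤ b - 1 →
      IntervalIntegrable (fun t => κ t * g t) volume x y := fun hg h1 h2 h3 => by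
    refine ContinuousOn.intervalIntegrable ?_
    rw [uIcc_of_le h2]
    exact (hκc.mono (Icc_subset_Icc h1 h3)).mul hg
  have hF : ∀ {x y : ℝ}, a ≤ x → ContinuousOn (fun t => t * upperFun t) (Icc x y) := fun h1 =>
    continuousOn_id.mul (continuousOn_upperFun.mono fun t ht => by
      simp only [mem_Ioi]; linarith [ht.1])
  have hL : ∀ {x y : ℝ}, 3 ≤ x → ContinuousOn logIntegral (Icc x y) := fun h1 =>
    continuousOn_logIntegral.mono fun t ht => by simp only [mem_Ioi]; linarith [ht.1]
  have h0 : ∫ u in (1 : ℝ)..(b - a), (1 - u / (b - a)) * upperFun (b - u) / u =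
      ∫ t in a..(b - 1), κ t * (t * upperFun t) := by
    have h := intervalIntegral.integral_comp_sub_left (a := 1) (b := b - a)
      (fun t => κ t * (t * upperFun t)) b
    rw [sub_sub_cancel] at h
    rw [← h]
    refine intervalIntegral.integral_congr fun u hu => ?_
    rw [uIcc_of_le (by linarith)] at hu
    have h1 : u ≠ 0 := by linarith [hu.1]
    have h2 : b - u ≠ 0 := by linarith [hu.2]
    have h3 : b - a ≠ 0 := by linarith
    simp only [hκ, sub_sub_cancel]
    field_simp
  have e1 : ∫ t in a..3, κ t * (t * upperFun t) = ∫ t in a..3, κ t * sieveConst := by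
    refine intervalIntegral.integral_congr fun t ht => ?_
    rw [uIcc_of_le ha₃.le] at ht
    rw [upperFun_of_le_three (by linarith [ht.1]) ht.2, mul_div_cancel₀]
    linarith [ht.1]
  have e2 : ∫ t in (3 : ℝ)..5, κ t * (t * upperFun t) =
      ∫ t in (3 : ℝ)..5, (κ t * sieveConst + sieveConst * (κ t * logIntegral t)) := by
    refine intervalIntegral.integral_congr fun t ht => ?_
    rw [uIcc_of_le (by norm_num)] at ht
    rw [mul_upperFun_of_le_five ht.1 ht.2]
    ring
  have hcongr : EqOn (fun t => κ t * (t * upperFun t)) (fun t => κ t * sieveConst +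
      sieveConst * (κ t * logIntegral t) + sieveConst * (κ t * logIntegral₃ t))
      (uIcc 5 (b - 1)) := by
    intro t ht
    rw [uIcc_of_le (by linarith)] at ht
    simp only
    rw [mul_upperFun_of_le_seven ht.1 (by linarith [ht.2])]
    ring
  have hc : ∀ {x y : ℝ}, a ≤ x → x ≤ y → y ≤ b - 1 →
      IntervalIntegrable (fun t => κ t * sieveConst) volume x y := fun h1 h2 h3 =>
    hint continuousOn_const h1 h2 h3
  have hl : ∀ {x y : ℝ}, 3 ≤ x → x ≤ y → y ≤ b - 1 →
      IntervalIntegrable (fun t => κ t * logIntegral t) volume x y := fun h1 h2 h3 =>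
    hint (hL h1) (by linarith) h2 h3
  have h3 : IntervalIntegrable (fun t => sieveConst * (κ t * logIntegral₃ t)) volume 5 (b - 1) := by
    have h4 := (hint (hF (x := 5) (y := b - 1) (by linarith)) (by linarith) (by linarith) le_rfl).sub
      ((hc (x := 5) (y := b - 1) (by linarith) (by linarith) le_rfl).add
        ((hl (x := 5) (y := b - 1) (by linarith) (by linarith) le_rfl).const_mul sieveConst))
    refine h4.congr fun t ht => ?_
    have h5 := hcongr (uIoc_subset_uIcc ht)
    simp only at h5 ⊢
    rw [h5]
    ring
  have e3 : ∫ t in (5 : ℝ)..(b - 1), κ t * (t * upperFun t) =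
      (∫ t in (5 : ℝ)..(b - 1), κ t * sieveConst) +
      sieveConst * (∫ t in (5 : ℝ)..(b - 1), κ t * logIntegral t) + sieveConst * I₃ a b := by
    rw [intervalIntegral.integral_congr hcongr, intervalIntegral.integral_add
      ((hc (by linarith) (by linarith) le_rfl).add
        ((hl (by linarith) (by linarith) le_rfl).const_mul sieveConst)) h3,
      intervalIntegral.integral_add (hc (by linarith) (by linarith) le_rfl)
        ((hl (by linarith) (by linarith) le_rfl).const_mul sieveConst),
      intervalIntegral.integral_const_mul, intervalIntegral.integral_const_mul]
    rfl
  rw [intervalIntegral.integral_add (hc (by linarith) (by norm_num) (by linarith))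
    ((hl le_rfl (by norm_num) (by linarith)).const_mul sieveConst),
    intervalIntegral.integral_const_mul] at e2
  have hI2 : I₂ a b = (∫ t in (3 : ℝ)..5, κ t * logIntegral t) +
      ∫ t in (5 : ℝ)..(b - 1), κ t * logIntegral t :=
    (intervalIntegral.integral_add_adjacent_intervals (hl le_rfl (by norm_num) (by linarith))
      (hl (by norm_num) (by linarith) le_rfl)).symm
  have hI1 : ∫ t in a..(b - 1), κ t * sieveConst = I₁ a b * sieveConst := by
    rw [intervalIntegral.integral_mul_const]
    congr 1
    have h2 := hint (g := fun _ => 1) (x := a) (y := b - 1) continuousOn_const le_rfl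
      (by linarith) le_rfl
    simp only [mul_one] at h2
    rw [intervalIntegral.integral_eq_sub_of_hasDerivAt (f := fun t => 1 / b * (Real.log t -
      Real.log (b - t)) - 1 / (b - a) * Real.log t) (fun t ht => ?_) h2]
    · rw [I₁, Real.log_div (by nlinarith) (by linarith), Real.log_div (by linarith) (by linarith),
        Real.log_mul (by linarith) (by linarith), sub_sub_cancel, Real.log_one]
      ring
    · rw [uIcc_of_le (by linarith)] at ht
      have h4 : t ≠ 0 := by linarith [ht.1]
      have h5 : b - t ≠ 0 := by linarith [ht.2]
      have h6 : b ≠ 0 := by linarith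
      refine (((((hasDerivAt_id t).log h4).sub (((hasDerivAt_id t).const_sub b).log
        h5)).const_mul (1 / b)).sub (((hasDerivAt_id t).log h4).const_mul
        (1 / (b - a)))).congr_deriv ?_
      have h7 : b - a ≠ 0 := by linarith
      simp only [hκ, id]
      field_simp
      ring
  rw [h0, ← intervalIntegral.integral_add_adjacent_intervals
    (hint (hF le_rfl) le_rfl ha₃.le (by linarith))
    (hint (hF (x := 3) (y := b - 1) ha₃.le) ha₃.le (by linarith) le_rfl),
    ← intervalIntegral.integral_add_adjacent_intervals
    (hint (hF (x := 3) (y := 5) ha₃.le) ha₃.le (by norm_num) (by linarith))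
    (hint (hF (x := 5) (y := b - 1) (by linarith)) (by linarith) (by linarith) le_rfl), e1, e2, e3]
  rw [← intervalIntegral.integral_add_adjacent_intervals (hc le_rfl ha₃.le (by linarith))
    (hc (x := 3) (y := b - 1) ha₃.le (by linarith) le_rfl),
    ← intervalIntegral.integral_add_adjacent_intervals (hc (x := 3) (y := 5) ha₃.le (by norm_num)
      (by linarith)) (hc (x := 5) (y := b - 1) (by linarith) (by linarith) le_rfl)] at hI1
  rw [hI2]
  linarith

/-! ### Partial summation -/

/-- Abel summation in inductive form: the deficit Σ(c - ℓ) - δ is never positive, so carrying it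
with the latest, smallest value of H only weakens the bound. The next lemma is the mirror image, for
increasing H and sums over tails. -/
theorem sum_mul_le_of_partial_sums {c ℓ H : ℕ → ℝ} {δ : ℝ} {k N : ℕ} (hk : k < N)
    (hsum : ∀ m, k ≤ m → m ≤ N → ∑ i ∈ Finset.Ico k m, c i ≤ δ + ∑ i ∈ Finset.Ico k m, ℓ i)
    (hH : ∀ m, k ≤ m → m + 1 < N → H (m + 1) ≤ H m) (h0 : 0 ≤ H (N - 1)) :
    ∑ i ∈ Finset.Ico k N, c i * H i ≤ δ * H k + ∑ i ∈ Finset.Ico k N, ℓ i * H i := by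
  have key : ∀ m, k + 1 ≤ m → m ≤ N → ∑ i ∈ Finset.Ico k m, (c i - ℓ i) * H i ≤
      δ * H k + (∑ i ∈ Finset.Ico k m, (c i - ℓ i) - δ) * H (m - 1) := by
    intro m hm
    induction m, hm using Nat.le_induction with
    | base => intro _; simp; linarith
    | succ m hm ih =>
      intro hmN
      have h1 := ih (by omega)
      have h2 := hsum m (by omega) (by omega)
      have h3 := hH (m - 1) (by omega) (by omega)
      rw [Nat.sub_add_cancel (by omega)] at h3
      rw [Finset.sum_Ico_succ_top (by omega), Finset.sum_Ico_succ_top (by omega), Nat.add_sub_cancel]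
      have h4 : ∑ i ∈ Finset.Ico k m, (c i - ℓ i) - δ ≤ 0 := by
        rw [Finset.sum_sub_distrib]; linarith
      nlinarith
  have h1 := key N hk le_rfl
  have h2 := hsum N hk.le le_rfl
  have h4 : ∑ i ∈ Finset.Ico k N, (c i - ℓ i) - δ ≤ 0 := by
    rw [Finset.sum_sub_distrib]; linarith
  have h5 : ∑ i ∈ Finset.Ico k N, (c i - ℓ i) * H i =
      ∑ i ∈ Finset.Ico k N, c i * H i - ∑ i ∈ Finset.Ico k N, ℓ i * H i := by
    rw [← Finset.sum_sub_distrib]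
    exact Finset.sum_congr rfl fun i _ => sub_mul _ _ _
  nlinarith

theorem sum_mul_le_of_tail_sums {c ℓ H : ℕ → ℝ} {δ : ℝ} {k N : ℕ} (hk : k < N)
    (hsum : ∀ m, k ≤ m → m ≤ N → ∑ i ∈ Finset.Ico m N, c i ≤ δ + ∑ i ∈ Finset.Ico m N, ℓ i)
    (hH : ∀ m, k ≤ m → m + 1 < N → H m ≤ H (m + 1)) (h0 : 0 ≤ H k) :
    ∑ i ∈ Finset.Ico k N, c i * H i ≤ δ * H (N - 1) + ∑ i ∈ Finset.Ico k N, ℓ i * H i := by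
  have key : ∀ j m, k ≤ m → m + j + 1 = N → ∑ i ∈ Finset.Ico m N, (c i - ℓ i) * H i ≤
      δ * H (N - 1) + (∑ i ∈ Finset.Ico m N, (c i - ℓ i) - δ) * H m := by
    intro j
    induction j with
    | zero =>
      intro m _ hmN
      rw [← hmN]; simp; linarith
    | succ j ih =>
      intro m hm hmN
      have h1 := ih (m + 1) (by omega) (by omega)
      have h2 := hsum (m + 1) (by omega) (by omega)
      have h3 := hH m hm (by omega)
      rw [Finset.sum_eq_sum_Ico_succ_bot (by omega : m < N),
        Finset.sum_eq_sum_Ico_succ_bot (by omega : m < N)]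
      have h4 : ∑ i ∈ Finset.Ico (m + 1) N, (c i - ℓ i) - δ ≤ 0 := by
        rw [Finset.sum_sub_distrib]; linarith
      nlinarith
  have h1 := key (N - 1 - k) k le_rfl (by omega)
  have h2 := hsum k le_rfl hk.le
  have h4 : ∑ i ∈ Finset.Ico k N, (c i - ℓ i) - δ ≤ 0 := by
    rw [Finset.sum_sub_distrib]; linarith
  have h5 : ∑ i ∈ Finset.Ico k N, (c i - ℓ i) * H i =
      ∑ i ∈ Finset.Ico k N, c i * H i - ∑ i ∈ Finset.Ico k N, ℓ i * H i := by
    rw [← Finset.sum_sub_distrib]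
    exact Finset.sum_congr rfl fun i _ => sub_mul _ _ _
  nlinarith

theorem sum_Ico_sub_succ (V : ℕ → ℝ) {m N : ℕ} (h : m ≤ N) :
    ∑ i ∈ Finset.Ico m N, (V i - V (i + 1)) = V m - V N := by
  induction N, h using Nat.le_induction with
  | base => simp
  | succ N h ih => rw [Finset.sum_Ico_succ_top h, ih]; ring

/-- In the variable t = log D / log n, the hypothesis on V says that the mass V(m) - V(z) of a tail
is at most V(z)(K - 1) plus the mass of the uniform density V(z) K / s on [s, t_m]. Since η(t_n)
increases with n, summation by tails compares the sum with ∫ η. -/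
theorem sum_sub_mul_antitone_le {V : ℕ → ℝ} {K D z : ℝ} {η : ℝ → ℝ} {J : ℝ} (hK : 1 ≤ K)
    (hV0 : 0 ≤ V ⌈z⌉₊)
    (hV : ∀ u : ℝ, 1 < u → u ≤ z → V ⌈u⌉₊ ≤ K * (Real.log z / Real.log u) * V ⌈z⌉₊)
    (hD : 1 < D) (hz : 1 < z)
    (hη : AntitoneOn η (Ici (Real.log D / Real.log z)))
    (hη0 : ∀ t, Real.log D / Real.log z ≤ t → 0 ≤ η t)
    (hJ : ∀ T, Real.log D / Real.log z ≤ T → ∫ t in (Real.log D / Real.log z)..T, η t ≤ J) :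
    ∑ n ∈ Finset.Ico 2 ⌈z⌉₊, (V n - V (n + 1)) * η (Real.log D / Real.log n) ≤
      V ⌈z⌉₊ * ((K - 1) * η (Real.log D / Real.log z) +
        K * (J / (Real.log D / Real.log z))) := by
  set N := ⌈z⌉₊ with hN
  set s := Real.log D / Real.log z with hs
  have hlz : 0 < Real.log z := Real.log_pos hz
  have hlD : 0 < Real.log D := Real.log_pos hD
  have hs0 : 0 < s := div_pos hlD hlz
  have hJ0 : 0 ≤ J := by simpa using hJ s le_rfl
  rcases le_or_gt N 2 with hN2 | hN2
  · rw [Finset.Ico_eq_empty (by omega), Finset.sum_empty]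
    have := hη0 s le_rfl
    have h1 : 0 ≤ K - 1 := by linarith
    positivity
  have hlt : ∀ n : ℕ, n < N → (n : ℝ) < z := fun n hn => Nat.lt_ceil.1 hn
  -- Truncation at z makes the last node give exactly t = s, although ⌈z⌉ may exceed z.
  set x : ℕ → ℝ := fun n => min n z with hx
  have hxlt : ∀ n : ℕ, n < N → x n = n := fun n hn => min_eq_left (hlt n hn).le
  have hxN : x N = z := min_eq_right (Nat.le_ceil z)
  have hx1 : ∀ n : ℕ, 2 ≤ n → 1 < x n := fun n hn => lt_min (by exact_mod_cast hn) hz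
  have hxz : ∀ n : ℕ, x n ≤ z := fun n => min_le_right _ _
  set t : ℕ → ℝ := fun n => Real.log D / Real.log (x n) with ht
  have htN : t N = s := by simp only [ht, hxN, hs]
  have hts : ∀ n : ℕ, 2 ≤ n → s ≤ t n := fun n hn =>
    div_le_div_of_nonneg_left hlD.le (Real.log_pos (hx1 n hn))
      (Real.log_le_log (by linarith [hx1 n hn]) (hxz n))
  have htanti : ∀ n : ℕ, 2 ≤ n → t (n + 1) ≤ t n := fun n hn =>
    div_le_div_of_nonneg_left hlD.le (Real.log_pos (hx1 n hn))
      (Real.log_le_log (by linarith [hx1 n hn]) (min_le_min_right z (by push_cast; linarith)))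
  have hH : ∀ n : ℕ, n < N → Real.log D / Real.log n = t n := fun n hn => by
    simp only [ht]; rw [hxlt n hn]
  have hratio : ∀ n : ℕ, Real.log z / Real.log (x n) = t n / s := fun n => by
    simp only [ht, hs]; field_simp
  have htel : ∀ m, 2 ≤ m → m ≤ N →
      ∑ i ∈ Finset.Ico m N, V N * K / s * (t i - t (i + 1)) = V N * K / s * (t m - s) := by
    intro m _ hm
    rw [← Finset.mul_sum, ← htN, sum_Ico_sub_succ t hm]
  have h1 : ∑ n ∈ Finset.Ico 2 N, (V n - V (n + 1)) * η (t n) ≤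
      V N * (K - 1) * η (t (N - 1)) +
        ∑ n ∈ Finset.Ico 2 N, V N * K / s * (t n - t (n + 1)) * η (t n) := by
    refine sum_mul_le_of_tail_sums (H := fun n => η (t n)) hN2 (fun m hm hmN => ?_)
      (fun m hm hmN => hη (hts _ (by omega)) (hts _ hm) (htanti m hm)) (hη0 _ (hts 2 le_rfl))
    rw [htel m hm hmN, sum_Ico_sub_succ V hmN]
    rcases eq_or_lt_of_le hmN with rfl | hmN
    · rw [htN]; simp only [sub_self, mul_zero, add_zero]
      exact mul_nonneg hV0 (by linarith)
    · have h2 := hV m (by exact_mod_cast (by omega : 1 < m)) (hlt m hmN).le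
      rw [Nat.ceil_natCast, ← hxlt m hmN, hratio m] at h2
      have h3 : V N * (K - 1) + V N * K / s * (t m - s) = K * (t m / s) * V N - V N := by
        field_simp; ring
      linarith
  -- The nodes decrease with n and η is decreasing, so this is a lower Riemann sum.
  have h2 : ∑ n ∈ Finset.Ico 2 N, (t n - t (n + 1)) * η (t n) ≤ ∫ y in s..(t 2), η y := by
    have h3 := intervalIntegral.sum_integral_adjacent_intervals_Ico (f := η) (μ := volume) (a := t)
      hN2.le (fun k hk => (hη.mono fun y hy => ?_).intervalIntegrable)
    · rw [htN] at h3
      rw [intervalIntegral.integral_symm, ← h3, ← Finset.sum_neg_distrib]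
      refine Finset.sum_le_sum fun n hn => ?_
      have hn2 := (Finset.mem_Ico.1 hn).1
      rw [← intervalIntegral.integral_symm]
      calc (t n - t (n + 1)) * η (t n) = ∫ _ in (t (n + 1))..(t n), η (t n) := by simp
        _ ≤ _ := by
          refine intervalIntegral.integral_mono_on (htanti n hn2) (by simp)
            (hη.mono fun y hy => ?_).intervalIntegrable
            fun y hy => hη ((hts (n + 1) (by omega)).trans hy.1) (hts n hn2) hy.2
          rw [uIcc_of_le (htanti n hn2)] at hy
          exact (hts (n + 1) (by omega)).trans hy.1
    · rw [uIcc_of_ge (htanti k hk.1)] at hy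
      exact (hts (k + 1) (by have := hk.1; omega)).trans hy.1
  have h4 : η (t (N - 1)) ≤ η s := hη (mem_Ici.2 le_rfl) (hts _ (by omega)) (hts _ (by omega))
  have h5 := hJ (t 2) (hts 2 le_rfl)
  calc ∑ n ∈ Finset.Ico 2 N, (V n - V (n + 1)) * η (Real.log D / Real.log n)
      = ∑ n ∈ Finset.Ico 2 N, (V n - V (n + 1)) * η (t n) :=
        Finset.sum_congr rfl fun n hn => by rw [hH n (Finset.mem_Ico.1 hn).2]
    _ ≤ V N * (K - 1) * η (t (N - 1)) +
        V N * K / s * ∑ n ∈ Finset.Ico 2 N, (t n - t (n + 1)) * η (t n) := by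
        rw [Finset.mul_sum]
        simpa only [mul_assoc] using h1
    _ ≤ V N * (K - 1) * η s + V N * K / s * J := by
        refine add_le_add (mul_le_mul_of_nonneg_left h4 (mul_nonneg hV0 (by linarith)))
          (mul_le_mul_of_nonneg_left (h2.trans h5) ?_)
        have : 0 ≤ K := by linarith
        positivity
    _ = _ := by ring

/-! ### The error functions -/

/-- The shape of the error term in the upper bound sieve. -/
def upperErr (s : ℝ) : ℝ := if s < 3 then 3.06 * Real.exp (-3) / s else Real.exp (-s)

theorem upperErr_pos {s : ℝ} (hs : 0 < s) : 0 < upperErr s := by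
  unfold upperErr
  split_ifs <;> positivity

/-- At the junction 3 the left branch tends to 1.02 e^(-3), so the jump goes downwards. -/
theorem antitoneOn_upperErr : AntitoneOn upperErr (Ioi 0) := by
  intro x hx y hy hxy
  have hx0 : (0 : ℝ) < x := hx
  unfold upperErr
  split_ifs with h1 h2 h2
  · exact div_le_div_of_nonneg_left (by positivity) hx hxy
  · linarith
  · have h3 : Real.exp (-y) ≤ Real.exp (-3) := Real.exp_le_exp.2 (by linarith)
    refine h3.trans ?_
    rw [le_div_iff₀ hx0]
    nlinarith [Real.exp_pos (-3)]
  · exact Real.exp_le_exp.2 (by linarith)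

theorem upperErr_sub_one_le {s : ℝ} (hs : 2 ≤ s) : upperErr (s - 1) ≤ 2.8 * Real.exp (-s) := by
  have he := Real.exp_one_lt_d9
  have h1 : Real.exp (-(s - 1)) = Real.exp 1 * Real.exp (-s) := by
    rw [← Real.exp_add]; ring_nf
  unfold upperErr
  split_ifs with h
  · rw [div_le_iff₀ (by linarith)]
    have h2 : Real.exp (-3) = Real.exp 1 * Real.exp (-s) * Real.exp (s - 4) := by
      rw [← Real.exp_add, ← Real.exp_add]; ring_nf
    -- From e^(s-4) ≤ 1/(5 - s) this reduces to (s - 2)(s - 4) ≤ 0.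
    have h3 : 3 * Real.exp (s - 4) ≤ s - 1 := by
      have h4 : Real.exp (s - 4) ≤ 1 / (1 + (4 - s)) := by
        rw [le_div_iff₀ (by linarith)]
        have h5 := Real.add_one_le_exp (4 - s)
        have h6 : Real.exp (s - 4) * Real.exp (4 - s) = 1 := by
          rw [← Real.exp_add]; simp
        nlinarith [Real.exp_pos (s - 4)]
      have h5 : 3 * (1 / (1 + (4 - s))) ≤ s - 1 := by
        rw [mul_one_div, div_le_iff₀ (by linarith)]
        nlinarith
      linarith
    rw [h2]
    have h7 := Real.exp_pos (-s)
    have h8 := Real.exp_pos (s - 4)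
    have h9 : 3.06 * Real.exp 1 * Real.exp (s - 4) ≤ 2.8 * (s - 1) := by nlinarith
    nlinarith
  · rw [h1]
    nlinarith [Real.exp_pos (-s)]

theorem integral_exp_sub_one_le (s T : ℝ) :
    ∫ t in s..T, Real.exp (-(t - 1)) ≤ Real.exp (-(s - 1)) := by
  rw [intervalIntegral.integral_eq_sub_of_hasDerivAt (f := fun t => -Real.exp (-(t - 1)))]
  · linarith [Real.exp_pos (-(T - 1))]
  · intro x _
    exact (((hasDerivAt_id x).sub_const 1).neg.exp.neg).congr_deriv (by simp)
  · exact (by fun_prop : Continuous fun t : ℝ => Real.exp (-(t - 1))).intervalIntegrable _ _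

/-- Numerical core of `integral_upperErr_le`, with x = s - 1 and a factor e^(-3) removed. On each
half of the interval the logarithm is bounded by a tangent and the exponential by its cubic Taylor
polynomial, leaving a polynomial inequality. -/
theorem log_div_le_exp {x : ℝ} (h1 : 1 ≤ x) (h3 : x ≤ 3) :
    3.06 * Real.log (3 / x) + 1 ≤ 0.91 * (x + 1) * Real.exp (2 - x) := by
  have hcubic : ∀ w : ℝ, 0 ≤ w → 1 + w + w ^ 2 / 2 + w ^ 3 / 6 ≤ Real.exp w := fun w hw => by
    have := Real.sum_le_exp_of_nonneg hw 4
    simpa [Finset.sum_range_succ, Nat.factorial] using this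
  rcases le_total x 2 with h2 | h2
  · have hl : Real.log (3 / x) ≤ 0.6932 + 1.5 / x - 1 := by
      have e : 3 / x = 2 * (1.5 / x) := by ring
      rw [e, Real.log_mul two_ne_zero (by positivity)]
      have := Real.log_le_sub_one_of_pos (show 0 < 1.5 / x by positivity)
      linarith [Real.log_two_lt_d9]
    obtain ⟨w, rfl⟩ : ∃ w, x = 2 - w := ⟨2 - x, by ring⟩
    have hw0 : 0 ≤ w := by linarith
    have hw1 : w ≤ 1 := by linarith
    have hc := hcubic w hw0
    have hd : 4.59 / (2 - w) ≤ 0.91 * (3 - w) * (1 + w + w ^ 2 / 2 + w ^ 3 / 6) - 0.0612 := by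
      rw [div_le_iff₀ (by linarith)]
      have p2 : w ^ 2 ≤ w := by nlinarith
      have p3 : w ^ 3 ≤ w := by nlinarith [pow_nonneg hw0 2]
      have p4 : w ^ 4 ≤ w := by nlinarith [pow_nonneg hw0 3]
      have p5 : 0 ≤ w ^ 5 := by positivity
      nlinarith
    have e2 : 3.06 * (1.5 / (2 - w)) = 4.59 / (2 - w) := by ring
    have hm := mul_le_mul_of_nonneg_left hc (show 0 ≤ 0.91 * (3 - w) by linarith)
    rw [show (2 : ℝ) - w + 1 = 3 - w by ring, show (2 : ℝ) - (2 - w) = w by ring]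
    linarith
  · have hl : Real.log (3 / x) ≤ 3 / x - 1 := Real.log_le_sub_one_of_pos (by positivity)
    obtain ⟨v, rfl⟩ : ∃ v, x = 3 - v := ⟨3 - x, by ring⟩
    have hv0 : 0 ≤ v := by linarith
    have hv1 : v ≤ 1 := by linarith
    have hc := hcubic v hv0
    have he : 0.3678 ≤ Real.exp (-1) := by linarith [Real.exp_neg_one_gt_d9]
    have e1 : Real.exp (2 - (3 - v)) = Real.exp (-1) * Real.exp v := by
      rw [← Real.exp_add]; ring_nf
    have hd : 3.06 * (3 / (3 - v) - 1) + 1 ≤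
        0.91 * (4 - v) * (0.3678 * (1 + v + v ^ 2 / 2 + v ^ 3 / 6)) := by
      rw [div_sub_one (by linarith), ← sub_nonneg, show 0.91 * (4 - v) * (0.3678 * (1 + v + v ^ 2 / 2 +
        v ^ 3 / 6)) - (3.06 * ((3 - (3 - v)) / (3 - v)) + 1) = (0.91 * (4 - v) * (0.3678 * (1 + v +
        v ^ 2 / 2 + v ^ 3 / 6)) * (3 - v) - (3.06 * v + (3 - v))) / (3 - v) by
          have : 3 - v ≠ 0 := by linarith
          field_simp
          ring]
      refine div_nonneg ?_ (by linarith)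
      have p2 : v ^ 2 ≤ v := by nlinarith
      have p3 : v ^ 3 ≤ v := by nlinarith [pow_nonneg hv0 2]
      have p4 : v ^ 4 ≤ v := by nlinarith [pow_nonneg hv0 3]
      have p5 : 0 ≤ v ^ 5 := by positivity
      nlinarith
    have hm := mul_le_mul he hc (by positivity) (Real.exp_pos _).le
    have hm2 := mul_le_mul_of_nonneg_left hm (show 0 ≤ 0.91 * (4 - v) by linarith)
    rw [show (3 : ℝ) - v + 1 = 4 - v by ring, e1]
    linarith

theorem intervalIntegrable_upperErr_sub_one {s T : ℝ} (hs : 1 < s) (hT : 1 < T) :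
    IntervalIntegrable (fun t => upperErr (t - 1)) volume s T := by
  refine AntitoneOn.intervalIntegrable fun x hx y hy hxy => ?_
  have h1 : 1 < x := lt_of_lt_of_le (lt_min hs hT) hx.1
  exact antitoneOn_upperErr (by simp only [mem_Ioi]; linarith) (by simp only [mem_Ioi]; linarith)
    (by linarith)

/-- The factor 0.91 < 1 is the contraction in the lower bound sieve. For s ≥ 4 the integral is at
most e · e^(-s), and e < 0.91 · 4; for s < 4 the part up to 4 is an explicit logarithm. -/
theorem integral_upperErr_le {s T : ℝ} (hs : 2 ≤ s) (hsT : s ≤ T) :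
    ∫ t in s..T, upperErr (t - 1) ≤ 0.91 * s * Real.exp (-s) := by
  have he := Real.exp_one_lt_d9
  have htail : ∀ {x y : ℝ}, 4 ≤ x → x ≤ y → ∫ t in x..y, upperErr (t - 1) ≤ Real.exp (-(x - 1)) := by
    intro x y hx hxy
    refine le_trans (le_of_eq ?_) (integral_exp_sub_one_le x y)
    refine intervalIntegral.integral_congr fun t ht => ?_
    rw [uIcc_of_le hxy] at ht
    exact if_neg (by linarith [ht.1])
  have h1 : Real.exp (-(s - 1)) = Real.exp 1 * Real.exp (-s) := by
    rw [← Real.exp_add]; ring_nf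
  rcases le_or_gt 4 s with h4 | h4
  · refine (htail h4 hsT).trans ?_
    rw [h1]
    nlinarith [Real.exp_pos (-s)]
  -- The range is enlarged so that it can be split at 4 even when T < 4.
  have h2 : ∫ t in s..T, upperErr (t - 1) ≤ ∫ t in s..(max T 4), upperErr (t - 1) := by
    refine intervalIntegral.integral_mono_interval le_rfl hsT (le_max_left _ _) ?_
      (intervalIntegrable_upperErr_sub_one (by linarith) (lt_max_of_lt_right (by norm_num)))
    refine (ae_restrict_iff' measurableSet_Ioc).2 (Eventually.of_forall fun t ht => ?_)
    exact (upperErr_pos (by linarith [ht.1])).le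
  have h3 : ∫ t in s..4, upperErr (t - 1) = 3.06 * Real.exp (-3) * Real.log (3 / (s - 1)) := by
    have h5 : ∫ t in s..4, upperErr (t - 1) =
        3.06 * Real.exp (-3) * Real.log (4 - 1) - 3.06 * Real.exp (-3) * Real.log (s - 1) := by
      refine intervalIntegral.integral_eq_sub_of_hasDerivAt_of_le
        (f := fun t => 3.06 * Real.exp (-3) * Real.log (t - 1)) h4.le ?_ (fun x hx => ?_)
        (intervalIntegrable_upperErr_sub_one (by linarith) (by norm_num))
      · exact continuousOn_const.mul (ContinuousOn.log (by fun_prop) fun x hx => by linarith [hx.1])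
      · refine ((((hasDerivAt_id x).sub_const 1).log
          (by simp only [id]; linarith [hx.1])).const_mul _).congr_deriv ?_
        rw [upperErr, if_pos (by linarith [hx.2])]
        simp only [id]
        ring
    rw [h5, Real.log_div (by norm_num) (by linarith)]
    norm_num
    ring
  rw [← intervalIntegral.integral_add_adjacent_intervals (b := 4)
    (intervalIntegrable_upperErr_sub_one (by linarith) (by norm_num))
    (intervalIntegrable_upperErr_sub_one (by norm_num) (lt_max_of_lt_right (by norm_num))), h3] at h2
  have h5 := htail (x := 4) (y := max T 4) le_rfl (le_max_right _ _)
  have h6 := log_div_le_exp (x := s - 1) (by linarith) (by linarith)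
  have h7 : Real.exp (-s) = Real.exp (-3) * Real.exp (2 - (s - 1)) := by
    rw [← Real.exp_add]; ring_nf
  rw [show -((4 : ℝ) - 1) = -3 by norm_num] at h5
  rw [h7]
  have h8 := mul_le_mul_of_nonneg_left h6 (Real.exp_pos (-3)).le
  rw [sub_add_cancel] at h8
  linarith

/-! ### The linear sieve -/

/-- The sum of the `a n` with `q ∣ n` and `n` free of the primes `p < N` in `P`. -/
def siftedSum (a : ℕ →₀ ℝ) (P : ℕ → Prop) [DecidablePred P] (q N : ℕ) : ℝ :=
  ∑ n ∈ a.support with q ∣ n ∧ ∀ p ∈ (Finset.range N).filter P, ¬ p ∣ n, a n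

/-- The remainders of the products of `q` with squarefree `d < D` composed of primes `p < N`
in `P`. -/
def siftedErr (R : ℕ → ℝ) (P : ℕ → Prop) [DecidablePred P] (q : ℕ) (D : ℝ) (N : ℕ) : ℝ :=
  ∑ S ∈ ((Finset.range N).filter P).powerset,
    if ((∏ p ∈ S, p : ℕ) : ℝ) < D then |R (q * ∏ p ∈ S, p)| else 0

/-- The product of `1 - g p` over the primes `p < N` in `P`. -/
def siftedProd (g : ℕ → ℝ) (P : ℕ → Prop) [DecidablePred P] (N : ℕ) : ℝ :=
  ∏ p ∈ (Finset.range N).filter P, (1 - g p)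

section

variable {a : ℕ →₀ ℝ} {P : ℕ → Prop} [DecidablePred P] {g R : ℕ → ℝ}

theorem siftedErr_nonneg (q : ℕ) (D : ℝ) (N : ℕ) : 0 ≤ siftedErr R P q D N :=
  Finset.sum_nonneg fun S _ => by split_ifs <;> simp

theorem siftedErr_mono (q : ℕ) (D : ℝ) {M N : ℕ} (h : M ≤ N) :
    siftedErr R P q D M ≤ siftedErr R P q D N := by
  refine Finset.sum_le_sum_of_subset_of_nonneg (Finset.powerset_mono.2
    (Finset.filter_subset_filter _ (Finset.range_mono h))) fun S _ _ => ?_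
  split_ifs <;> simp

theorem siftedSum_anti (ha : ∀ n, 0 ≤ a n) (q : ℕ) {M N : ℕ} (h : M ≤ N) :
    siftedSum a P q N ≤ siftedSum a P q M := by
  refine Finset.sum_le_sum_of_subset_of_nonneg (fun n hn => ?_) fun n _ _ => ha n
  simp only [Finset.mem_filter, Finset.mem_range] at hn ⊢
  exact ⟨hn.1, hn.2.1, fun p hp => hn.2.2 p ⟨by omega, hp.2⟩⟩

theorem filter_range_succ (P : ℕ → Prop) [DecidablePred P] (N : ℕ) :
    (Finset.range (N + 1)).filter P =
      if P N then insert N ((Finset.range N).filter P) else (Finset.range N).filter P := by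
  rw [Finset.range_add_one, Finset.filter_insert]

theorem siftedProd_succ (N : ℕ) : siftedProd g P N - siftedProd g P (N + 1) =
    if P N then g N * siftedProd g P N else 0 := by
  unfold siftedProd
  rw [filter_range_succ]
  split_ifs with h
  · rw [Finset.prod_insert (by simp)]; ring
  · ring

/-- Splitting the subsets by whether they contain N turns the constraint into level D / N. The error
thus obeys Buchstab's recursion up to sign, so the remainders of all steps add up without loss. -/
theorem siftedErr_succ (q : ℕ) (D : ℝ) (N : ℕ) (hN : P N → 0 < N) :
    siftedErr R P q D (N + 1) = siftedErr R P q D N +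
      if P N then siftedErr R P (q * N) (D / N) N else 0 := by
  unfold siftedErr
  rw [filter_range_succ]
  split_ifs with h
  · rw [Finset.sum_powerset_insert (by simp)]
    congr 1
    refine Finset.sum_congr rfl fun S hS => ?_
    have hNS : N ∉ S := fun h' => by simpa using Finset.mem_powerset.1 hS h'
    have hN0 : (0 : ℝ) < N := by exact_mod_cast hN h
    rw [Finset.prod_insert hNS, ← mul_assoc]
    refine if_congr ?_ rfl rfl
    rw [lt_div_iff₀ hN0, Nat.cast_mul, mul_comm]
  · simp

theorem siftedSum_succ (q N : ℕ) (hq : P N → Nat.Coprime q N) :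
    siftedSum a P q (N + 1) = siftedSum a P q N -
      if P N then siftedSum a P (q * N) N else 0 := by
  unfold siftedSum
  rw [filter_range_succ]
  split_ifs with h
  · rw [eq_sub_iff_add_eq, ← Finset.sum_union]
    · refine Finset.sum_congr ?_ fun _ _ => rfl
      ext n
      simp only [Finset.mem_union, Finset.mem_filter, Finset.mem_insert]
      have hdvd : q * N ∣ n ↔ q ∣ n ∧ N ∣ n := by
        constructor
        · exact fun h' => ⟨(Dvd.intro _ rfl).trans h', (Dvd.intro_left _ rfl).trans h'⟩
        · exact fun h' => (hq h).mul_dvd_of_dvd_of_dvd h'.1 h'.2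
      rw [hdvd]
      by_cases hn : N ∣ n
      · constructor
        · rintro (⟨h1, h2, h3⟩ | ⟨h1, h2, h3⟩)
          · exact ⟨h1, h2, fun p hp => h3 p (Or.inr hp)⟩
          · exact ⟨h1, h2.1, h3⟩
        · rintro ⟨h1, h2, h3⟩
          exact Or.inr ⟨h1, ⟨h2, hn⟩, h3⟩
      · constructor
        · rintro (⟨h1, h2, h3⟩ | ⟨h1, h2, h3⟩)
          · exact ⟨h1, h2, fun p hp => h3 p (Or.inr hp)⟩
          · exact absurd h2.2 hn
        · rintro ⟨h1, h2, h3⟩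
          refine Or.inl ⟨h1, h2, fun p hp => ?_⟩
          rcases hp with rfl | hp
          · exact hn
          · exact h3 p hp
    · rw [Finset.disjoint_left]
      intro n hn hn'
      simp only [Finset.mem_filter, Finset.mem_insert] at hn hn'
      exact hn.2.2 N (Or.inl rfl) ((Dvd.intro_left _ rfl).trans hn'.2.1)
  · simp

/-- Buchstab's identity: the removed terms are sorted by their least prime factor in P. -/
theorem siftedSum_eq (hP : ∀ p, P p → p.Prime) (q : ℕ) {N : ℕ} (hN : 2 ≤ N)
    (hq : ∀ p, p < N → P p → Nat.Coprime q p) :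
    siftedSum a P q N = siftedSum a P q 0 -
      ∑ n ∈ Finset.Ico 2 N, if P n then siftedSum a P (q * n) n else 0 := by
  induction N, hN using Nat.le_induction with
  | base =>
    have h0 : ¬ P 0 := fun h => Nat.not_prime_zero (hP 0 h)
    have h1 : ¬ P 1 := fun h => Nat.not_prime_one (hP 1 h)
    have e1 := siftedSum_succ (a := a) q 0 fun h => absurd h h0
    have e2 := siftedSum_succ (a := a) q 1 fun h => absurd h h1
    rw [if_neg h0] at e1
    rw [if_neg h1] at e2
    simp only [Finset.Ico_self, Finset.sum_empty]
    norm_num at e1 e2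
    linarith
  | succ N hN ih =>
    rw [siftedSum_succ q N (hq N (by omega)), ih fun p hp => hq p (by omega),
      Finset.sum_Ico_succ_top hN]
    ring

theorem siftedErr_eq (hP : ∀ p, P p → p.Prime) (q : ℕ) {D : ℝ} (hD : 1 < D) {N : ℕ} (hN : 2 ≤ N) :
    siftedErr R P q D N = |R q| +
      ∑ n ∈ Finset.Ico 2 N, if P n then siftedErr R P (q * n) (D / n) n else 0 := by
  induction N, hN using Nat.le_induction with
  | base =>
    have h0 : ¬ P 0 := fun h => Nat.not_prime_zero (hP 0 h)
    have h1 : ¬ P 1 := fun h => Nat.not_prime_one (hP 1 h)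
    have e1 := siftedErr_succ (R := R) q D 0 fun h => absurd h h0
    have e2 := siftedErr_succ (R := R) q D 1 fun h => absurd h h1
    rw [if_neg h0] at e1
    rw [if_neg h1] at e2
    have e3 : siftedErr R P q D 0 = |R q| := by simp [siftedErr, hD]
    simp only [Finset.Ico_self, Finset.sum_empty]
    norm_num at e1 e2
    linarith
  | succ N hN ih =>
    rw [siftedErr_succ q D N (fun h => (hP N h).pos), ih, Finset.sum_Ico_succ_top hN]
    ring

theorem siftedProd_two (hP : ∀ p, P p → p.Prime) : siftedProd g P 2 = 1 := by
  refine Finset.prod_eq_one fun p hp => ?_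
  rw [Finset.mem_filter, Finset.mem_range] at hp
  have := (hP p hp.2).two_le
  omega

theorem siftedProd_nonneg (hg1 : ∀ p, P p → g p ≤ 1) (N : ℕ) : 0 ≤ siftedProd g P N :=
  Finset.prod_nonneg fun p hp => by linarith [hg1 p (Finset.mem_filter.1 hp).2]

/-- The constant in the error terms of the linear sieve. -/
def errConst : ℝ := 100 * (sieveConst * Real.exp 4)

theorem errConst_pos : 0 < errConst := by have := sieveConst_pos; unfold errConst; positivity

/-- Write E for `errConst * exp (-s)`. The inherited error is multiplied by (1 + ε) e/s ≤ 1.01 ·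
0.9062. The factor 100 in `errConst` makes F - 1 at most E/100 and 1 - f(s-1) at most 0.028 E, so
the new terms cost at most 0.066 ε E; the total stays below ε E. -/
theorem upper_error_step {s ε : ℝ} (hs : 3 ≤ s) (hε0 : 0 < ε) (hε1 : ε ≤ 1 / 100) :
    1 + ((1 + ε - 1) * (1 - lowerFun (s - 1) + errConst * ε * Real.exp (-(s - 1))) + (1 + ε) *
      ((s * (upperFun s - 1) + errConst * ε * (Real.exp 1 * Real.exp (-s))) / s)) ≤
      upperFun s + errConst * ε * Real.exp (-s) := by
  have hC := errConst_pos
  have hexp : Real.exp (-(s - 1)) = Real.exp 1 * Real.exp (-s) := by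
    rw [← Real.exp_add]; ring_nf
  have h1 : (s * (upperFun s - 1) + errConst * ε * (Real.exp 1 * Real.exp (-s))) / s =
      upperFun s - 1 + Real.exp 1 / s * (ε * (errConst * Real.exp (-s))) := by
    have : s ≠ 0 := by linarith
    field_simp
  have he := Real.exp_one_lt_d9
  have h2 : Real.exp 1 / s ≤ 0.9062 := by
    rw [div_le_iff₀ (by linarith)]
    linarith
  have h3 := one_sub_lowerFun_le (s := s - 1) (by linarith)
  have h4 := upperFun_sub_one_le (s := s) (by linarith)
  have hc : sieveConst * Real.exp 4 = errConst / 100 := by rw [errConst]; ring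
  rw [h1, hexp, show errConst * ε * Real.exp (-s) = ε * (errConst * Real.exp (-s)) by ring,
    show errConst * ε * (Real.exp 1 * Real.exp (-s)) =
      ε * Real.exp 1 * (errConst * Real.exp (-s)) by ring]
  rw [hexp, hc, show errConst / 100 * (Real.exp 1 * Real.exp (-s)) =
    Real.exp 1 / 100 * (errConst * Real.exp (-s)) by ring] at h3
  rw [hc, show errConst / 100 * Real.exp (-s) = 0.01 * (errConst * Real.exp (-s)) by ring] at h4
  set E := errConst * Real.exp (-s)
  have hE0 : 0 < E := by positivity
  have hεE : 0 < ε * E := by positivity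
  have h5 : Real.exp 1 * E ≤ 2.8 * E := mul_le_mul_of_nonneg_right (by linarith) hE0.le
  have h6 : ε * (Real.exp 1 * E) ≤ 0.01 * (2.8 * E) :=
    mul_le_mul (by linarith) h5 (by positivity) (by norm_num)
  have e1 : ε * (1 - lowerFun (s - 1) + ε * Real.exp 1 * E) ≤ ε * (0.056 * E) :=
    mul_le_mul_of_nonneg_left (by linarith) hε0.le
  have e2 : ε * (upperFun s - 1) ≤ ε * (0.01 * E) := mul_le_mul_of_nonneg_left h4 hε0.le
  have e3 : (1 + ε) * (Real.exp 1 / s * (ε * E)) ≤ 1.01 * (0.9062 * (ε * E)) :=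
    mul_le_mul (by linarith) (mul_le_mul_of_nonneg_right h2 hεE.le) (by positivity) (by norm_num)
  linarith

/-- The same balance with the contraction factor 1.01 · 0.91 from `integral_upperErr_le`, plus new
terms of at most 0.066 in the same unit. -/
theorem lower_error_step {s ε : ℝ} (hs : 2 ≤ s) (hε0 : 0 < ε) (hε1 : ε ≤ 1 / 100) :
    (1 + ε - 1) * (upperFun (s - 1) - 1 + errConst * ε * upperErr (s - 1)) + (1 + ε) *
      ((s * (1 - lowerFun s) + errConst * ε * (0.91 * s * Real.exp (-s))) / s) ≤
      1 - lowerFun s + errConst * ε * Real.exp (-s) := by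
  have hC := errConst_pos
  have h1 : (s * (1 - lowerFun s) + errConst * ε * (0.91 * s * Real.exp (-s))) / s =
      1 - lowerFun s + 0.91 * (ε * (errConst * Real.exp (-s))) := by
    have : s ≠ 0 := by linarith
    field_simp
  have he := Real.exp_one_lt_d9
  have h3 := upperFun_sub_one_le (s := s - 1) (by linarith)
  have h4 := one_sub_lowerFun_le (s := s) (by linarith)
  have h5 := mul_le_mul_of_nonneg_left (upperErr_sub_one_le hs) hC.le
  have hexp : Real.exp (-(s - 1)) = Real.exp 1 * Real.exp (-s) := by
    rw [← Real.exp_add]; ring_nf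
  have hc : sieveConst * Real.exp 4 = errConst / 100 := by rw [errConst]; ring
  rw [hexp, hc, show errConst / 100 * (Real.exp 1 * Real.exp (-s)) =
    Real.exp 1 / 100 * (errConst * Real.exp (-s)) by ring] at h3
  rw [hc, show errConst / 100 * Real.exp (-s) = 0.01 * (errConst * Real.exp (-s)) by ring] at h4
  rw [show errConst * (2.8 * Real.exp (-s)) = 2.8 * (errConst * Real.exp (-s)) by ring] at h5
  rw [h1, show errConst * ε * Real.exp (-s) = ε * (errConst * Real.exp (-s)) by ring,
    show errConst * ε * upperErr (s - 1) = ε * (errConst * upperErr (s - 1)) by ring]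
  have hp : 0 < errConst * upperErr (s - 1) := mul_pos hC (upperErr_pos (by linarith))
  set E := errConst * Real.exp (-s)
  set Y := errConst * upperErr (s - 1)
  have hE0 : 0 < E := by positivity
  have hεE : 0 < ε * E := by positivity
  have h6 : ε * Y ≤ 0.01 * (2.8 * E) := mul_le_mul (by linarith) h5 hp.le (by norm_num)
  have h7 : Real.exp 1 / 100 * E ≤ 0.028 * E := mul_le_mul_of_nonneg_right (by linarith) hE0.le
  have e1 : ε * (upperFun (s - 1) - 1 + ε * Y) ≤ ε * (0.056 * E) :=
    mul_le_mul_of_nonneg_left (by linarith) hε0.le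
  have e2 : ε * (1 - lowerFun s) ≤ ε * (0.01 * E) := mul_le_mul_of_nonneg_left h4 hε0.le
  have e3 : ε * (ε * E) ≤ 1 / 100 * (ε * E) := mul_le_mul_of_nonneg_right hε1 hεE.le
  linarith

/-- The assertion of the upper bound sieve for `⌈z⌉ = N`. -/
def UpperBoundAt (a : ℕ →₀ ℝ) (P : ℕ → Prop) [DecidablePred P] (g R : ℕ → ℝ) (X ε : ℝ) (N : ℕ) :
    Prop :=
  ∀ (q : ℕ) (D z : ℝ), (∀ p, p < N → P p → Nat.Coprime q p) → 1 < D → 1 < z → ⌈z⌉₊ = N →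
    siftedSum a P q N ≤ g q * X * siftedProd g P N * (upperFun (Real.log D / Real.log z) +
      errConst * ε * upperErr (Real.log D / Real.log z)) + siftedErr R P q D N

/-- The assertion of the lower bound sieve for `⌈z⌉ = N`. -/
def LowerBoundAt (a : ℕ →₀ ℝ) (P : ℕ → Prop) [DecidablePred P] (g R : ℕ → ℝ) (X ε : ℝ) (N : ℕ) :
    Prop :=
  ∀ (q : ℕ) (D z : ℝ), (∀ p, p < N → P p → Nat.Coprime q p) → 1 < z → z ^ 2 ≤ D → ⌈z⌉₊ = N →
    g q * X * siftedProd g P N * (lowerFun (Real.log D / Real.log z) -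
      errConst * ε * Real.exp (-(Real.log D / Real.log z))) - siftedErr R P q D N ≤
      siftedSum a P q N

/-! ### The Buchstab induction. -/

omit [DecidablePred P] in
theorem coprime_mul_of_lt (hP : ∀ p, P p → p.Prime) {q n N : ℕ}
    (hq : ∀ p, p < N → P p → Nat.Coprime q p) (hn : n < N) (hPn : P n) :
    ∀ p, p < n → P p → Nat.Coprime (q * n) p := fun p hp hPp =>
  (hq p (by omega) hPp).mul_left
    ((Nat.coprime_primes (hP n hPn) (hP p hPp)).2 (by omega))

theorem log_div_log_sub_one {D : ℝ} {n : ℕ} (hD : 0 < D) (hn : 2 ≤ n) :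
    Real.log (D / n) / Real.log n = Real.log D / Real.log n - 1 := by
  have h1 : (1 : ℝ) < n := by exact_mod_cast hn
  have h2 := Real.log_pos h1
  rw [Real.log_div hD.ne' (by linarith)]
  field_simp

theorem le_log_div_log {D z : ℝ} {k : ℕ} (hz : 1 < z) (h : z ^ k ≤ D) :
    (k : ℝ) ≤ Real.log D / Real.log z := by
  rw [le_div_iff₀ (Real.log_pos hz), ← Real.log_pow]
  exact Real.log_le_log (by positivity) h

/-- Each subtracted term of Buchstab's identity is bounded below at level D / n, where the sieve
parameter log D / log n drops by 1. As V(n) - V(n+1) = g(n) V(n) for n in P, the main terms form the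
sum treated by `sum_sub_mul_antitone_le`. -/
theorem upperBoundAt_of_pow_le (hP : ∀ p, P p → p.Prime) (hg0 : ∀ n, 0 ≤ g n)
    (hgm : ∀ m n, Nat.Coprime m n → g (m * n) = g m * g n) (hg1 : ∀ p, P p → g p ≤ 1)
    {X ε : ℝ} (hX : 0 ≤ X) (hε0 : 0 < ε) (hε1 : ε ≤ 1 / 100)
    (hR : ∀ q, siftedSum a P q 0 = g q * X + R q)
    (hV : ∀ u z : ℝ, 1 < u → u ≤ z →
      siftedProd g P ⌈u⌉₊ ≤ (1 + ε) * (Real.log z / Real.log u) * siftedProd g P ⌈z⌉₊)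
    {N : ℕ} (ih : ∀ n < N, LowerBoundAt a P g R X ε n) (q : ℕ) (D z : ℝ)
    (hq : ∀ p, p < N → P p → Nat.Coprime q p) (hz : 1 < z) (hzD : z ^ 3 ≤ D) (hzN : ⌈z⌉₊ = N) :
    siftedSum a P q N ≤ g q * X * siftedProd g P N * (upperFun (Real.log D / Real.log z) +
      errConst * ε * Real.exp (-(Real.log D / Real.log z))) + siftedErr R P q D N := by
  have hD : 1 < D := lt_of_lt_of_le (one_lt_pow₀ hz (by norm_num)) hzD
  set s := Real.log D / Real.log z with hs
  have hs3 : 3 ≤ s := by exact_mod_cast le_log_div_log hz hzD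
  have hN2 : 2 ≤ N := by rw [← hzN]; exact Nat.lt_ceil.2 (by exact_mod_cast hz)
  have hC := errConst_pos
  set η : ℝ → ℝ := fun t => 1 - lowerFun (t - 1) + errConst * ε * Real.exp (-(t - 1)) with hη
  have hηanti : AntitoneOn η (Ici s) := fun x (hx : s ≤ x) y (hy : s ≤ y) hxy => by
    have h1 := monotoneOn_lowerFun (show 0 < x - 1 by linarith) (show 0 < y - 1 by linarith)
      (by linarith)
    have h2 : Real.exp (-(y - 1)) ≤ Real.exp (-(x - 1)) := Real.exp_le_exp.2 (by linarith)
    have h3 := mul_le_mul_of_nonneg_left h2 (show 0 ≤ errConst * ε by positivity)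
    simp only [hη]; linarith
  have hη0 : ∀ t, s ≤ t → 0 ≤ η t := fun t ht => by
    have h1 := lowerFun_le_one (s := t - 1) (by linarith)
    have h2 : 0 ≤ errConst * ε * Real.exp (-(t - 1)) := by positivity
    simp only [hη]; linarith
  have hexp : Real.exp (-(s - 1)) = Real.exp 1 * Real.exp (-s) := by
    rw [← Real.exp_add]; ring_nf
  have hJ : ∀ T, s ≤ T → ∫ t in s..T, η t ≤
      s * (upperFun s - 1) + errConst * ε * (Real.exp 1 * Real.exp (-s)) := by
    intro T hT
    have h1 := integral_one_sub_lowerFun_le (s := s) (t := T) (by linarith) hT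
    have h2 := integral_exp_sub_one_le s T
    have h3 := mul_le_mul_of_nonneg_left h2 (show 0 ≤ errConst * ε by positivity)
    rw [hexp] at h3
    rw [intervalIntegral.integral_add, intervalIntegral.integral_const_mul]
    · linarith
    · exact (intervalIntegrable_const).sub
        (intervalIntegrable_comp_sub_one continuousOn_lowerFun (by linarith) (by linarith))
    · exact (by fun_prop : Continuous fun t : ℝ =>
        errConst * ε * Real.exp (-(t - 1))).intervalIntegrable _ _
  have hVN := siftedProd_nonneg hg1 N
  have hps := sum_sub_mul_antitone_le (V := siftedProd g P) (K := 1 + ε) (D := D) (z := z) (η := η)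
    (by linarith) (by rw [hzN]; exact hVN) (fun u hu huz => hV u z hu huz) hD hz hηanti hη0 hJ
  rw [hzN, ← hs] at hps
  have hstep : ∀ n ∈ Finset.Ico 2 N, g q * X * ((siftedProd g P n - siftedProd g P (n + 1)) *
      (1 - η (Real.log D / Real.log n))) - (if P n then siftedErr R P (q * n) (D / n) n else 0) ≤
      if P n then siftedSum a P (q * n) n else 0 := by
    intro n hn
    rw [Finset.mem_Ico] at hn
    rw [siftedProd_succ]
    split_ifs with h
    · have hnz : (n : ℝ) < z := Nat.lt_ceil.1 (by rw [hzN]; exact hn.2)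
      have hn1 : (1 : ℝ) < n := by exact_mod_cast hn.1
      -- This is where z³ ≤ D is used: the lower bound sieve requires the level to be at least the
      -- square of the sifting limit.
      have h3 : (n : ℝ) ^ 2 ≤ D / n := by
        rw [le_div_iff₀ (by linarith)]
        calc (n : ℝ) ^ 2 * n = n ^ 3 := by ring
          _ ≤ z ^ 3 := pow_le_pow_left₀ (by linarith) hnz.le 3
          _ ≤ D := hzD
      have := ih n hn.2 (q * n) (D / n) n (coprime_mul_of_lt hP hq hn.2 h) hn1 h3 (Nat.ceil_natCast n)
      rw [log_div_log_sub_one (by linarith) hn.1, hgm q n (hq n hn.2 h)] at this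
      refine le_trans (le_of_eq ?_) this
      simp only [hη]
      ring
    · simp
  have hsum := Finset.sum_le_sum hstep
  rw [Finset.sum_sub_distrib, ← Finset.mul_sum] at hsum
  have hsplit : ∑ n ∈ Finset.Ico 2 N, (siftedProd g P n - siftedProd g P (n + 1)) *
      (1 - η (Real.log D / Real.log n)) = 1 - siftedProd g P N -
      ∑ n ∈ Finset.Ico 2 N, (siftedProd g P n - siftedProd g P (n + 1)) *
        η (Real.log D / Real.log n) := by
    have h1 := sum_Ico_sub_succ (siftedProd g P) hN2
    rw [siftedProd_two hP] at h1
    rw [← h1, ← Finset.sum_sub_distrib]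
    exact Finset.sum_congr rfl fun n _ => by ring
  rw [hsplit] at hsum
  rw [siftedSum_eq hP q hN2 hq, siftedErr_eq hP q hD hN2, hR q]
  have hgX : 0 ≤ g q * X := mul_nonneg (hg0 q) hX
  have hps' := mul_le_mul_of_nonneg_left hps hgX
  have hkey := upper_error_step hs3 hε0 hε1
  have hfin := mul_le_mul_of_nonneg_left hkey (mul_nonneg hgX hVN)
  have hRq := le_abs_self (R q)
  linarith

theorem upperBoundAt_of_lower (ha : ∀ n, 0 ≤ a n) (hP : ∀ p, P p → p.Prime) (hg0 : ∀ n, 0 ≤ g n)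
    (hgm : ∀ m n, Nat.Coprime m n → g (m * n) = g m * g n) (hg1 : ∀ p, P p → g p ≤ 1)
    {X ε : ℝ} (hX : 0 ≤ X) (hε0 : 0 < ε) (hε1 : ε ≤ 1 / 100)
    (hR : ∀ q, siftedSum a P q 0 = g q * X + R q)
    (hV : ∀ u z : ℝ, 1 < u → u ≤ z →
      siftedProd g P ⌈u⌉₊ ≤ (1 + ε) * (Real.log z / Real.log u) * siftedProd g P ⌈z⌉₊)
    {N : ℕ} (ih : ∀ n < N, LowerBoundAt a P g R X ε n) : UpperBoundAt a P g R X ε N := by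
  intro q D z hq hD hz hzN
  have hlz := Real.log_pos hz
  have hlD := Real.log_pos hD
  rcases le_or_gt (z ^ 3) D with hzD | hzD
  · have h3 : 3 ≤ Real.log D / Real.log z := by exact_mod_cast le_log_div_log hz hzD
    rw [upperErr, if_neg (by linarith)]
    exact upperBoundAt_of_pow_le hP hg0 hgm hg1 hX hε0 hε1 hR hV ih q D z hq hz hzD hzN
  have hs3 : Real.log D / Real.log z < 3 := by
    rw [div_lt_iff₀ hlz]
    have := Real.log_lt_log (by linarith) hzD
    rwa [Real.log_pow] at this
  have hs0 : 0 < Real.log D / Real.log z := div_pos hlD hlz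
  -- For z³ > D it suffices to sift up to D^(1/3), with parameter exactly 3. Passing from V(y) to
  -- V(z) costs (1 + ε) 3/s, and since uF(u) is constant on (0, 3] the main term comes out as F(s).
  set y : ℝ := D ^ ((1 : ℝ) / 3) with hy
  have hy3 : y ^ 3 = D := by
    rw [hy, ← Real.rpow_natCast, ← Real.rpow_mul (by linarith)]
    norm_num
  have hy1 : 1 < y := Real.one_lt_rpow hD (by norm_num)
  have hyz : y ≤ z := by
    by_contra! h
    have := pow_lt_pow_left₀ h (by linarith) (n := 3) (by norm_num)
    linarith
  have hMN : ⌈y⌉₊ ≤ N := by rw [← hzN]; exact Nat.ceil_mono hyz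
  have hly : Real.log D / Real.log y = 3 := by
    rw [hy, Real.log_rpow (by linarith)]
    field_simp
  have h1 := upperBoundAt_of_pow_le hP hg0 hgm hg1 hX hε0 hε1 hR hV
    (fun n hn => ih n (lt_of_lt_of_le hn hMN)) q D y (fun p hp => hq p (by omega)) hy1 hy3.le rfl
  rw [hly, upperFun_of_le_three three_pos le_rfl] at h1
  have h2 := siftedSum_anti (a := a) (P := P) ha q hMN
  have h3 := siftedErr_mono (R := R) (P := P) q D hMN
  have h4 := hV y z hy1 hyz
  rw [hzN] at h4
  have hC := errConst_pos
  have hS := sieveConst_pos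
  have hgX : 0 ≤ g q * X := mul_nonneg (hg0 q) hX
  have hVN := siftedProd_nonneg hg1 N
  set s := Real.log D / Real.log z with hs
  have h5 : Real.log z / Real.log y = 3 / s := by
    rw [hy, Real.log_rpow (by linarith), hs]
    field_simp
  rw [h5] at h4
  rw [upperFun_of_le_three hs0 hs3.le, upperErr, if_pos hs3]
  have h6 : 0 ≤ sieveConst / 3 + errConst * ε * Real.exp (-3) := by positivity
  have h7 : g q * X * siftedProd g P ⌈y⌉₊ * (sieveConst / 3 + errConst * ε * Real.exp (-3)) ≤
      g q * X * ((1 + ε) * (3 / s) * siftedProd g P N) *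
        (sieveConst / 3 + errConst * ε * Real.exp (-3)) :=
    mul_le_mul_of_nonneg_right (mul_le_mul_of_nonneg_left h4 hgX) h6
  have h8 : (1 + ε) * (3 / s) * (sieveConst / 3 + errConst * ε * Real.exp (-3)) ≤
      sieveConst / s + errConst * ε * (3.06 * Real.exp (-3) / s) := by
    rw [show (1 + ε) * (3 / s) * (sieveConst / 3 + errConst * ε * Real.exp (-3)) =
      ((1 + ε) * (sieveConst + 3 * (errConst * ε * Real.exp (-3)))) / s by field_simp,
      show sieveConst / s + errConst * ε * (3.06 * Real.exp (-3) / s) =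
      (sieveConst + 3.06 * (errConst * ε * Real.exp (-3))) / s by field_simp]
    refine div_le_div_of_nonneg_right ?_ hs0.le
    -- The margin of 3.06 over 3 · 1.01 is 0.03, which times 100 e ε `sieveConst` covers the stray
    -- main-term error ε `sieveConst`.
    have h9 : errConst * Real.exp (-3) = 100 * sieveConst * Real.exp 1 := by
      rw [errConst, show (1 : ℝ) = 4 + -3 by norm_num, Real.exp_add]; ring
    have he : 2 ≤ Real.exp 1 := by linarith [Real.add_one_le_exp 1]
    have h10 : errConst * ε * Real.exp (-3) = ε * (100 * sieveConst * Real.exp 1) := by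
      rw [← h9]; ring
    rw [h10]
    have h11 : sieveConst * 2 ≤ sieveConst * Real.exp 1 := mul_le_mul_of_nonneg_left he hS.le
    set W := sieveConst * Real.exp 1
    have hεW : 0 ≤ ε * W := by positivity
    have h12 : ε * (sieveConst * 2) ≤ ε * W := mul_le_mul_of_nonneg_left h11 hε0.le
    have h13 : ε * (ε * W) ≤ 1 / 100 * (ε * W) := mul_le_mul_of_nonneg_right hε1 hεW
    have e : ε * (100 * sieveConst * Real.exp 1) = 100 * (ε * W) := by simp only [W]; ring
    rw [e]
    nlinarith
  have h9 := mul_le_mul_of_nonneg_left h8 (mul_nonneg hgX hVN)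
  linarith

theorem lowerBoundAt_of_upper (hP : ∀ p, P p → p.Prime) (hg0 : ∀ n, 0 ≤ g n)
    (hgm : ∀ m n, Nat.Coprime m n → g (m * n) = g m * g n) (hg1 : ∀ p, P p → g p ≤ 1)
    {X ε : ℝ} (hX : 0 ≤ X) (hε0 : 0 < ε) (hε1 : ε ≤ 1 / 100)
    (hR : ∀ q, siftedSum a P q 0 = g q * X + R q)
    (hV : ∀ u z : ℝ, 1 < u → u ≤ z →
      siftedProd g P ⌈u⌉₊ ≤ (1 + ε) * (Real.log z / Real.log u) * siftedProd g P ⌈z⌉₊)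
    {N : ℕ} (ih : ∀ n < N, UpperBoundAt a P g R X ε n) : LowerBoundAt a P g R X ε N := by
  intro q D z hq hz hzD hzN
  have hD : 1 < D := lt_of_lt_of_le (one_lt_pow₀ hz (by norm_num)) hzD
  set s := Real.log D / Real.log z with hs
  have hs2 : 2 ≤ s := by exact_mod_cast le_log_div_log hz hzD
  have hN2 : 2 ≤ N := by rw [← hzN]; exact Nat.lt_ceil.2 (by exact_mod_cast hz)
  have hC := errConst_pos
  set η : ℝ → ℝ := fun t => upperFun (t - 1) - 1 + errConst * ε * upperErr (t - 1) with hη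
  have hηanti : AntitoneOn η (Ici s) := fun x (hx : s ≤ x) y (hy : s ≤ y) hxy => by
    have h1 := antitoneOn_upperFun (show 0 < x - 1 by linarith) (show 0 < y - 1 by linarith)
      (by linarith)
    have h2 := antitoneOn_upperErr (show 0 < x - 1 by linarith) (show 0 < y - 1 by linarith)
      (by linarith)
    have h3 := mul_le_mul_of_nonneg_left h2 (show 0 ≤ errConst * ε by positivity)
    simp only [hη]; linarith
  have hη0 : ∀ t, s ≤ t → 0 ≤ η t := fun t ht => by
    have h1 := one_le_upperFun (s := t - 1) (by linarith)
    have h2 := upperErr_pos (s := t - 1) (by linarith)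
    have h3 : 0 ≤ errConst * ε * upperErr (t - 1) := by positivity
    simp only [hη]; linarith
  have hJ : ∀ T, s ≤ T → ∫ t in s..T, η t ≤
      s * (1 - lowerFun s) + errConst * ε * (0.91 * s * Real.exp (-s)) := by
    intro T hT
    have h1 := integral_upperFun_sub_one_le (s := s) (t := T) hs2 hT
    have h2 := integral_upperErr_le hs2 hT
    have h3 := mul_le_mul_of_nonneg_left h2 (show 0 ≤ errConst * ε by positivity)
    rw [intervalIntegral.integral_add, intervalIntegral.integral_const_mul]
    · linarith
    · exact (intervalIntegrable_comp_sub_one continuousOn_upperFun (by linarith)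
        (by linarith)).sub intervalIntegrable_const
    · exact (intervalIntegrable_upperErr_sub_one (by linarith) (by linarith)).const_mul _
  have hVN := siftedProd_nonneg hg1 N
  have hps := sum_sub_mul_antitone_le (V := siftedProd g P) (K := 1 + ε) (D := D) (z := z) (η := η)
    (by linarith) (by rw [hzN]; exact hVN) (fun u hu huz => hV u z hu huz) hD hz hηanti hη0 hJ
  rw [hzN, ← hs] at hps
  have hstep : ∀ n ∈ Finset.Ico 2 N, (if P n then siftedSum a P (q * n) n else 0) ≤
      g q * X * ((siftedProd g P n - siftedProd g P (n + 1)) *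
      (1 + η (Real.log D / Real.log n))) + (if P n then siftedErr R P (q * n) (D / n) n else 0) := by
    intro n hn
    rw [Finset.mem_Ico] at hn
    rw [siftedProd_succ]
    split_ifs with h
    · have hnz : (n : ℝ) < z := Nat.lt_ceil.1 (by rw [hzN]; exact hn.2)
      have hn1 : (1 : ℝ) < n := by exact_mod_cast hn.1
      -- From n < z and z² ≤ D; this is all that the upper bound sieve requires.
      have h3 : 1 < D / n := by
        rw [lt_div_iff₀ (by linarith)]
        nlinarith
      have := ih n hn.2 (q * n) (D / n) n (coprime_mul_of_lt hP hq hn.2 h) h3 hn1 (Nat.ceil_natCast n)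
      rw [log_div_log_sub_one (by linarith) hn.1, hgm q n (hq n hn.2 h)] at this
      refine this.trans (le_of_eq ?_)
      simp only [hη]
      ring
    · simp
  have hsum := Finset.sum_le_sum hstep
  rw [Finset.sum_add_distrib, ← Finset.mul_sum] at hsum
  have hsplit : ∑ n ∈ Finset.Ico 2 N, (siftedProd g P n - siftedProd g P (n + 1)) *
      (1 + η (Real.log D / Real.log n)) = 1 - siftedProd g P N +
      ∑ n ∈ Finset.Ico 2 N, (siftedProd g P n - siftedProd g P (n + 1)) *
        η (Real.log D / Real.log n) := by
    have h1 := sum_Ico_sub_succ (siftedProd g P) hN2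
    rw [siftedProd_two hP] at h1
    rw [← h1, ← Finset.sum_add_distrib]
    exact Finset.sum_congr rfl fun n _ => by ring
  rw [hsplit] at hsum
  rw [siftedSum_eq hP q hN2 hq, siftedErr_eq hP q hD hN2, hR q]
  have hgX : 0 ≤ g q * X := mul_nonneg (hg0 q) hX
  have hps' := mul_le_mul_of_nonneg_left hps hgX
  have hkey := lower_error_step hs2 hε0 hε1
  have hfin := mul_le_mul_of_nonneg_left hkey (mul_nonneg hgX hVN)
  have hRq := neg_abs_le (R q)
  linarith

/-- Both bounds are proved simultaneously, uniformly in q and D, because Buchstab's identity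
replaces (q, D) by (qn, D/n) and exchanges upper and lower bounds. -/
theorem linear_sieve (ha : ∀ n, 0 ≤ a n) (hP : ∀ p, P p → p.Prime) (hg0 : ∀ n, 0 ≤ g n)
    (hgm : ∀ m n, Nat.Coprime m n → g (m * n) = g m * g n) (hg1 : ∀ p, P p → g p ≤ 1)
    {X ε : ℝ} (hX : 0 ≤ X) (hε0 : 0 < ε) (hε1 : ε ≤ 1 / 100)
    (hR : ∀ q, siftedSum a P q 0 = g q * X + R q)
    (hV : ∀ u z : ℝ, 1 < u → u ≤ z →
      siftedProd g P ⌈u⌉₊ ≤ (1 + ε) * (Real.log z / Real.log u) * siftedProd g P ⌈z⌉₊) (N : ℕ) :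
    UpperBoundAt a P g R X ε N ∧ LowerBoundAt a P g R X ε N := by
  induction N using Nat.strong_induction_on with
  | _ N ih =>
    exact ⟨upperBoundAt_of_lower ha hP hg0 hgm hg1 hX hε0 hε1 hR hV fun n hn => (ih n hn).2,
      lowerBoundAt_of_upper hP hg0 hgm hg1 hX hε0 hε1 hR hV fun n hn => (ih n hn).1⟩

end

/-! ### Removing the small primes -/

section

variable {a : ℕ →₀ ℝ} {P : ℕ → Prop} [DecidablePred P] {g R : ℕ → ℝ}

/-- The exact sieve of Legendre. -/
theorem abs_siftedSum_sub_le (hP : ∀ p, P p → p.Prime)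
    (hgm : ∀ m n, Nat.Coprime m n → g (m * n) = g m * g n) {X : ℝ}
    (hR : ∀ q, siftedSum a P q 0 = g q * X + R q) (N : ℕ) (q : ℕ)
    (hq : ∀ p, p < N → P p → Nat.Coprime q p) :
    |siftedSum a P q N - g q * X * siftedProd g P N| ≤
      ∑ S ∈ ((Finset.range N).filter P).powerset, |R (q * ∏ p ∈ S, p)| := by
  induction N generalizing q with
  | zero => simp [hR q, siftedProd]
  | succ N ih =>
    have h1 := ih q fun p hp => hq p (by omega)
    have h2 := siftedProd_succ (P := P) (g := g) N
    rw [siftedSum_succ q N (hq N (by omega)), filter_range_succ]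
    split_ifs at h2 ⊢ with h
    · rw [Finset.sum_powerset_insert (by simp)]
      have h3 := ih (q * N) (coprime_mul_of_lt hP hq (by omega) h)
      rw [hgm q N (hq N (by omega) h)] at h3
      have h4 : ∑ S ∈ ((Finset.range N).filter P).powerset, |R (q * N * ∏ p ∈ S, p)| =
          ∑ S ∈ ((Finset.range N).filter P).powerset, |R (q * ∏ p ∈ insert N S, p)| := by
        refine Finset.sum_congr rfl fun S hS => ?_
        have hNS : N ∉ S := fun h' => by simpa using Finset.mem_powerset.1 hS h'
        rw [Finset.prod_insert hNS, ← mul_assoc]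
      rw [h4] at h3
      have h5 : siftedProd g P (N + 1) = siftedProd g P N - g N * siftedProd g P N := by linarith
      rw [h5]
      rw [show siftedSum a P q N - siftedSum a P (q * N) N -
        g q * X * (siftedProd g P N - g N * siftedProd g P N) =
        (siftedSum a P q N - g q * X * siftedProd g P N) -
        (siftedSum a P (q * N) N - g q * g N * X * siftedProd g P N) by ring]
      exact (abs_sub _ _).trans (add_le_add h1 h3)
    · have h5 : siftedProd g P (N + 1) = siftedProd g P N := by linarith
      rw [h5, sub_zero]
      exact h1

/-- The sequence obtained by removing the multiples of the primes `p < u` in `P`. -/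
def removeSmall (a : ℕ →₀ ℝ) (P : ℕ → Prop) [DecidablePred P] (u : ℕ) : ℕ →₀ ℝ :=
  a.filter fun n => ∀ p ∈ (Finset.range u).filter P, ¬ p ∣ n

theorem siftedSum_removeSmall (u q N : ℕ) (hN : u ≤ N) :
    siftedSum (removeSmall a P u) (fun p => P p ∧ u ≤ p) q N = siftedSum a P q N := by
  unfold siftedSum removeSmall
  rw [Finsupp.support_filter, Finset.filter_filter]
  refine Finset.sum_congr ?_ fun n hn => ?_
  · ext n
    simp only [Finset.mem_filter, Finset.mem_range]
    refine and_congr_right fun _ => ⟨fun ⟨h1, h2, h3⟩ => ⟨h2, fun p hp => ?_⟩,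
      fun ⟨h2, h3⟩ => ⟨fun p hp => h3 p ⟨by omega, hp.2⟩, h2, fun p hp => h3 p ⟨hp.1, hp.2.1⟩⟩⟩
    rcases lt_or_ge p u with h | h
    · exact h1 p ⟨h, hp.2⟩
    · exact h3 p ⟨hp.1, hp.2, h⟩
  · rw [Finsupp.filter_apply_pos]
    simp only [Finset.mem_filter, Finset.mem_range] at hn ⊢
    exact fun p hp => hn.2.2 p ⟨by omega, hp.2⟩

theorem siftedSum_removeSmall_zero (u q : ℕ) :
    siftedSum (removeSmall a P u) (fun p => P p ∧ u ≤ p) q 0 = siftedSum a P q u := by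
  rw [← siftedSum_removeSmall u q u le_rfl]
  unfold siftedSum
  congr 1
  ext n
  simp only [Finset.mem_filter, Finset.mem_range]
  refine and_congr_right fun _ => and_congr_right fun _ => ⟨fun _ p hp => ?_, fun _ p hp => ?_⟩ <;>
    omega

theorem siftedProd_eq_one_of_le {u N : ℕ} (h : N ≤ u) :
    siftedProd g (fun p => P p ∧ u ≤ p) N = 1 := by
  refine Finset.prod_eq_one fun p hp => ?_
  simp only [Finset.mem_filter, Finset.mem_range] at hp
  omega

theorem siftedProd_mul_large (u N : ℕ) (hN : u ≤ N) :
    siftedProd g P u * siftedProd g (fun p => P p ∧ u ≤ p) N = siftedProd g P N := by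
  induction N, hN using Nat.le_induction with
  | base => rw [siftedProd_eq_one_of_le le_rfl, mul_one]
  | succ N hN ih =>
    have h1 := siftedProd_succ (P := P) (g := g) N
    have h2 := siftedProd_succ (P := fun p => P p ∧ u ≤ p) (g := g) N
    by_cases h : P N
    · rw [if_pos h] at h1
      rw [if_pos ⟨h, hN⟩] at h2
      have e1 : siftedProd g P (N + 1) = siftedProd g P N * (1 - g N) := by linarith
      have e2 : siftedProd g (fun p => P p ∧ u ≤ p) (N + 1) =
        siftedProd g (fun p => P p ∧ u ≤ p) N * (1 - g N) := by linarith
      rw [e1, e2, ← mul_assoc, ih]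
    · rw [if_neg h] at h1
      rw [if_neg fun h' => h h'.1] at h2
      rw [show siftedProd g P (N + 1) = siftedProd g P N by linarith, ← ih]
      rw [show siftedProd g (fun p => P p ∧ u ≤ p) (N + 1) =
        siftedProd g (fun p => P p ∧ u ≤ p) N by linarith]

/-- The product of the primes `p < u` in `P`. -/
def smallProd (P : ℕ → Prop) [DecidablePred P] (u : ℕ) : ℕ := ∏ p ∈ (Finset.range u).filter P, p

theorem smallProd_pos (hP : ∀ p, P p → p.Prime) (u : ℕ) : 0 < smallProd P u :=
  Finset.prod_pos fun p hp => (hP p (Finset.mem_filter.1 hp).2).pos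

/-- The remainder of the reduced sequence is, by Legendre's sieve, at most a sum of |R| over
products of small primes. Each such product is at most `smallProd P u`, so shrinking the level by
this factor keeps everything below D. Larger primes are added by the common recursion. -/
theorem siftedErr_removeSmall_le (hP : ∀ p, P p → p.Prime)
    (hgm : ∀ m n, Nat.Coprime m n → g (m * n) = g m * g n) {X : ℝ}
    (hR : ∀ q, siftedSum a P q 0 = g q * X + R q) (u N : ℕ) (hN : u ≤ N) (q : ℕ) (D : ℝ)
    (hq : ∀ p, p < N → P p → Nat.Coprime q p) :
    siftedErr (fun q => siftedSum (removeSmall a P u) (fun p => P p ∧ u ≤ p) q 0 -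
      g q * (X * siftedProd g P u)) (fun p => P p ∧ u ≤ p) q (D / smallProd P u) N ≤
      siftedErr R P q D N := by
  have hQ : (0 : ℝ) < smallProd P u := by exact_mod_cast smallProd_pos hP u
  induction N, hN using Nat.le_induction generalizing q D with
  | base =>
    have hempty : (Finset.range u).filter (fun p => P p ∧ u ≤ p) = ∅ := by
      ext p
      simp only [Finset.mem_filter, Finset.mem_range, Finset.notMem_empty, iff_false]
      omega
    rw [siftedErr, hempty, Finset.powerset_empty, Finset.sum_singleton]
    split_ifs with h
    · rw [Finset.prod_empty, Nat.cast_one, lt_div_iff₀ hQ, one_mul] at h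
      rw [Finset.prod_empty, mul_one, siftedSum_removeSmall_zero, ← mul_assoc]
      refine (abs_siftedSum_sub_le hP hgm hR u q hq).trans (le_of_eq ?_)
      refine Finset.sum_congr rfl fun S hS => ?_
      rw [if_pos]
      refine lt_of_le_of_lt ?_ h
      have : ∏ p ∈ S, p ≤ smallProd P u :=
        Finset.prod_le_prod_of_subset_of_one_le' (Finset.mem_powerset.1 hS)
          fun p hp _ => (hP p (Finset.mem_filter.1 hp).2).one_le
      exact_mod_cast this
    · exact siftedErr_nonneg _ _ _
  | succ N hN ih =>
    rw [siftedErr_succ q _ N (fun h => (hP N h.1).pos), siftedErr_succ q D N fun h => (hP N h).pos]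
    refine add_le_add (ih q D fun p hp => hq p (by omega)) ?_
    by_cases h : P N
    · rw [if_pos ⟨h, hN⟩, if_pos h, div_right_comm]
      exact ih (q * N) (D / N) (coprime_mul_of_lt hP hq (by omega) h)
    · rw [if_neg h, if_neg fun h' => h h'.1]

theorem siftedProd_pos (hg1 : ∀ p, P p → g p < 1) (N : ℕ) : 0 < siftedProd g P N :=
  Finset.prod_pos fun p hp => by linarith [hg1 p (Finset.mem_filter.1 hp).2]

/-- Below u₀ the reduced product is constantly 1, so the ratio at u < u₀ follows from that at u₀,
where log z / log u₀ is smaller. -/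
theorem siftedProd_large_ratio (hg1 : ∀ p, P p → g p < 1) {ε : ℝ} (hε : 0 < ε) {u₀ : ℕ}
    (hV : ∀ u z : ℝ, (u₀ : ℝ) ≤ u → u ≤ z →
      siftedProd g P ⌈u⌉₊ ≤ (1 + ε) * (Real.log z / Real.log u) * siftedProd g P ⌈z⌉₊)
    (u z : ℝ) (hu : 1 < u) (huz : u ≤ z) :
    siftedProd g (fun p => P p ∧ u₀ ≤ p) ⌈u⌉₊ ≤
      (1 + ε) * (Real.log z / Real.log u) * siftedProd g (fun p => P p ∧ u₀ ≤ p) ⌈z⌉₊ := by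
  have hV0 := siftedProd_pos (P := P) hg1 u₀
  have hlu := Real.log_pos hu
  have hluz : Real.log u ≤ Real.log z := Real.log_le_log (by linarith) huz
  have large : ∀ v : ℝ, (u₀ : ℝ) ≤ v → v ≤ z → siftedProd g (fun p => P p ∧ u₀ ≤ p) ⌈v⌉₊ ≤
      (1 + ε) * (Real.log z / Real.log v) * siftedProd g (fun p => P p ∧ u₀ ≤ p) ⌈z⌉₊ := by
    intro v hv hvz
    have h := hV v z hv hvz
    have h1 : u₀ ≤ ⌈v⌉₊ := by exact_mod_cast hv.trans (Nat.le_ceil v)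
    have h2 : u₀ ≤ ⌈z⌉₊ := by exact_mod_cast (hv.trans hvz).trans (Nat.le_ceil z)
    rw [← siftedProd_mul_large u₀ _ h1, ← siftedProd_mul_large u₀ _ h2] at h
    refine le_of_mul_le_mul_left ?_ hV0
    linarith
  rcases le_total (u₀ : ℝ) u with h | h
  · exact large u h huz
  rw [siftedProd_eq_one_of_le (Nat.ceil_le.2 h)]
  rcases le_total z u₀ with h' | h'
  · rw [siftedProd_eq_one_of_le (Nat.ceil_le.2 h'), mul_one]
    have : 1 ≤ Real.log z / Real.log u := (one_le_div hlu).2 hluz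
    nlinarith
  · have h1 := large u₀ le_rfl h'
    rw [siftedProd_eq_one_of_le (by rw [Nat.ceil_natCast])] at h1
    refine h1.trans (mul_le_mul_of_nonneg_right ?_
      (siftedProd_pos (fun p hp => hg1 p hp.1) _).le)
    refine mul_le_mul_of_nonneg_left ?_ (by linarith)
    exact div_le_div_of_nonneg_left (by linarith) hlu (Real.log_le_log (by linarith) h)

theorem sieve_upper_and_lower (ha : ∀ n, 0 ≤ a n) (hP : ∀ p, P p → p.Prime) (hg0 : ∀ n, 0 ≤ g n)
    (hgm : ∀ m n, Nat.Coprime m n → g (m * n) = g m * g n) (hg1 : ∀ p, P p → g p < 1)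
    {X ε : ℝ} (hX : 0 ≤ X) (hε0 : 0 < ε) (hε1 : ε ≤ 1 / 100)
    (hR : ∀ q, siftedSum a P q 0 = g q * X + R q) {u₀ : ℕ} (hu₀ : 2 ≤ u₀)
    (hV : ∀ u z : ℝ, (u₀ : ℝ) ≤ u → u ≤ z →
      siftedProd g P ⌈u⌉₊ ≤ (1 + ε) * (Real.log z / Real.log u) * siftedProd g P ⌈z⌉₊)
    {q : ℕ} {D z : ℝ} (hz : (u₀ : ℝ) ≤ z) (hq : ∀ p, p < ⌈z⌉₊ → P p → Nat.Coprime q p) :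
    (1 < D / smallProd P u₀ → siftedSum a P q ⌈z⌉₊ ≤ g q * X * siftedProd g P ⌈z⌉₊ *
      (upperFun (Real.log (D / smallProd P u₀) / Real.log z) +
        errConst * ε * upperErr (Real.log (D / smallProd P u₀) / Real.log z)) +
      siftedErr R P q D ⌈z⌉₊) ∧
    (z ^ 2 ≤ D / smallProd P u₀ → g q * X * siftedProd g P ⌈z⌉₊ *
      (lowerFun (Real.log (D / smallProd P u₀) / Real.log z) -
        errConst * ε * Real.exp (-(Real.log (D / smallProd P u₀) / Real.log z))) -
      siftedErr R P q D ⌈z⌉₊ ≤ siftedSum a P q ⌈z⌉₊) := by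
  have hN : u₀ ≤ ⌈z⌉₊ := by exact_mod_cast hz.trans (Nat.le_ceil z)
  have hz1 : 1 < z := lt_of_lt_of_le (by exact_mod_cast hu₀) hz
  have key := linear_sieve (a := removeSmall a P u₀) (P := fun p => P p ∧ u₀ ≤ p) (g := g)
    (R := fun q => siftedSum (removeSmall a P u₀) (fun p => P p ∧ u₀ ≤ p) q 0 -
      g q * (X * siftedProd g P u₀)) (fun n => ?_) (fun p hp => hP p hp.1) hg0 hgm
    (fun p hp => (hg1 p hp.1).le) (mul_nonneg hX (siftedProd_pos hg1 u₀).le) hε0 hε1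
    (fun q => by ring) (siftedProd_large_ratio hg1 hε0 hV) ⌈z⌉₊
  · have herr := siftedErr_removeSmall_le hP hgm hR u₀ ⌈z⌉₊ hN q D hq
    have hprod : X * siftedProd g P u₀ * siftedProd g (fun p => P p ∧ u₀ ≤ p) ⌈z⌉₊ =
        X * siftedProd g P ⌈z⌉₊ := by rw [mul_assoc, siftedProd_mul_large u₀ _ hN]
    constructor
    · intro hD
      have h1 := key.1 q (D / smallProd P u₀) z (fun p hp hPp => hq p hp hPp.1) hD hz1 rfl
      rw [siftedSum_removeSmall u₀ q _ hN, mul_assoc (g q), hprod, ← mul_assoc] at h1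
      linarith
    · intro hD
      have h1 := key.2 q (D / smallProd P u₀) z (fun p hp hPp => hq p hp hPp.1) hz1 hD rfl
      rw [siftedSum_removeSmall u₀ q _ hN, mul_assoc (g q), hprod, ← mul_assoc] at h1
      linarith
  · rw [removeSmall, Finsupp.filter_apply]
    split_ifs
    · exact ha n
    · exact le_rfl

end

/-! ### The weighted sum -/

/-- The primes outside `B`. -/
def SievePrime (B : Finset ℕ) (p : ℕ) : Prop := p.Prime ∧ p ∉ B

instance (B : Finset ℕ) : DecidablePred (SievePrime B) :=
  fun p => inferInstanceAs (Decidable (p.Prime ∧ p ∉ B))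

theorem siftedSum_eq_sum_ite (a : ℕ →₀ ℝ) (P : ℕ → Prop) [DecidablePred P] (q N : ℕ) :
    siftedSum a P q N =
      ∑ n ∈ a.support with ∀ p ∈ (Finset.range N).filter P, ¬ p ∣ n, if q ∣ n then a n else 0 := by
  rw [siftedSum, ← Finset.sum_filter, Finset.filter_filter]
  refine Finset.sum_congr ?_ fun _ _ => rfl
  ext n
  simp only [Finset.mem_filter]
  tauto

/-- Primes p ≥ y have 1 - log p / log y ≤ 0, so including them only lowers the sum. Over all prime
divisors outside B the logarithms add up to at most log n ≤ log X. -/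
theorem sum_prime_weights_ge {B : Finset ℕ} {X y : ℝ} {r N n : ℕ} (hy : 1 < y)
    (hn : 0 < n) (hnX : (n : ℝ) ≤ X) (hnN : ∀ p ∈ (Finset.range N).filter (SievePrime B), ¬ p ∣ n)
    (hr : r < (n.primeFactors \ B).card) :
    (r : ℝ) + 1 - Real.log X / Real.log y ≤ ∑ p ∈ Finset.Ico N ⌈y⌉₊,
      if SievePrime B p ∧ p ∣ n then 1 - Real.log p / Real.log y else 0 := by
  have hly := Real.log_pos hy
  have h1 : ∑ p ∈ n.primeFactors \ B, (1 - Real.log p / Real.log y) ≤ ∑ p ∈ Finset.Ico N ⌈y⌉₊,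
      if SievePrime B p ∧ p ∣ n then 1 - Real.log p / Real.log y else 0 := by
    rw [← Finset.sum_filter]
    have hsub : (Finset.Ico N ⌈y⌉₊).filter (fun p => SievePrime B p ∧ p ∣ n) ⊆ n.primeFactors \ B := by
      intro p hp
      rw [Finset.mem_filter] at hp
      exact Finset.mem_sdiff.2 ⟨Nat.mem_primeFactors.2 ⟨hp.2.1.1, hp.2.2, hn.ne'⟩, hp.2.1.2⟩
    rw [← Finset.sum_sdiff hsub]
    refine add_le_of_nonpos_left (Finset.sum_nonpos fun p hp => ?_)
    simp only [Finset.mem_filter, Finset.mem_sdiff, Nat.mem_primeFactors] at hp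
    obtain ⟨⟨⟨hpp, hpn, _⟩, hpB⟩, hnot⟩ := hp
    have hpN : N ≤ p := by
      by_contra! h
      exact hnN p (Finset.mem_filter.2 ⟨Finset.mem_range.2 h, hpp, hpB⟩) hpn
    have hpy : y ≤ p := by
      by_contra! h
      exact hnot ⟨Finset.mem_Ico.2 ⟨hpN, Nat.lt_ceil.2 h⟩, ⟨hpp, hpB⟩, hpn⟩
    have := (one_le_div hly).2 (Real.log_le_log (by linarith) hpy)
    linarith
  refine le_trans ?_ h1
  rw [Finset.sum_sub_distrib, ← Finset.sum_div, Finset.sum_const, nsmul_eq_mul, mul_one]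
  have h2 : ∑ p ∈ n.primeFactors \ B, Real.log p ≤ Real.log X := by
    rw [← Real.log_prod fun p hp => by
      have := (Nat.prime_of_mem_primeFactors (Finset.mem_sdiff.1 hp).1).pos
      positivity]
    have h3 : ∏ p ∈ n.primeFactors \ B, p ≤ n := by
      refine Nat.le_of_dvd hn (dvd_trans ?_ (Nat.prod_primeFactors_dvd n))
      exact Finset.prod_dvd_prod_of_subset _ _ _ Finset.sdiff_subset
    have h4 : 0 < ∏ p ∈ n.primeFactors \ B, p := Finset.prod_pos fun p hp =>
      (Nat.prime_of_mem_primeFactors (Finset.mem_sdiff.1 hp).1).pos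
    rw [← Nat.cast_prod]
    refine Real.log_le_log ?_ (le_trans ?_ hnX)
    · exact_mod_cast h4
    · exact_mod_cast h3
  have h3 : (r : ℝ) + 1 ≤ (n.primeFactors \ B).card := by exact_mod_cast hr
  have h4 := div_le_div_of_nonneg_right h2 hly.le
  linarith

theorem weighted_sum_le {B : Finset ℕ} {w : ℕ →₀ ℝ} (hw : ∀ n, 0 ≤ w n) {X y lam : ℝ} {r N : ℕ}
    (hpos : ∀ n ∈ w.support, 0 < n) (hX : ∀ n ∈ w.support, (n : ℝ) ≤ X) (hy : 1 < y)
    (hlam : 0 ≤ lam) (hr : 1 ≤ lam * ((r : ℝ) + 1 - Real.log X / Real.log y)) :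
    siftedSum w (SievePrime B) 1 N - lam * ∑ p ∈ Finset.Ico N ⌈y⌉₊,
      (if SievePrime B p then (1 - Real.log p / Real.log y) * siftedSum w (SievePrime B) p N else 0) ≤
      ∑ n ∈ w.support with n ∈ almostPrimes r B, w n := by
  set T := w.support.filter fun n => ∀ p ∈ (Finset.range N).filter (SievePrime B), ¬ p ∣ n with hT
  have hswap : ∑ p ∈ Finset.Ico N ⌈y⌉₊, (if SievePrime B p then
      (1 - Real.log p / Real.log y) * siftedSum w (SievePrime B) p N else 0) =
      ∑ n ∈ T, w n * ∑ p ∈ Finset.Ico N ⌈y⌉₊,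
        if SievePrime B p ∧ p ∣ n then 1 - Real.log p / Real.log y else 0 := by
    simp_rw [Finset.mul_sum]
    rw [Finset.sum_comm]
    refine Finset.sum_congr rfl fun p _ => ?_
    rw [siftedSum_eq_sum_ite, Finset.mul_sum]
    by_cases h : SievePrime B p
    · rw [if_pos h]
      refine Finset.sum_congr rfl fun n _ => ?_
      by_cases h' : p ∣ n <;> simp [h, h', mul_comm]
    · simp [h]
  have h1 : siftedSum w (SievePrime B) 1 N = ∑ n ∈ T, w n := by
    rw [siftedSum_eq_sum_ite]
    simp [hT]
  rw [hswap, h1, Finset.mul_sum, ← Finset.sum_sub_distrib]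
  have h2 : ∀ n ∈ T, w n - lam * (w n * ∑ p ∈ Finset.Ico N ⌈y⌉₊,
        if SievePrime B p ∧ p ∣ n then 1 - Real.log p / Real.log y else 0) ≤
      if n ∈ almostPrimes r B then w n else 0 := by
    intro n hn
    rw [hT, Finset.mem_filter] at hn
    have hσ : 0 ≤ ∑ p ∈ Finset.Ico N ⌈y⌉₊,
        if SievePrime B p ∧ p ∣ n then 1 - Real.log p / Real.log y else 0 := by
      refine Finset.sum_nonneg fun p hp => ?_
      split_ifs with h
      · have hpy : (p : ℝ) < y := Nat.lt_ceil.1 (Finset.mem_Ico.1 hp).2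
        have := (div_le_one (Real.log_pos hy)).2
          (Real.log_le_log (by exact_mod_cast h.1.1.pos) hpy.le)
        linarith
      · exact le_rfl
    split_ifs with h
    · have := mul_nonneg hlam (mul_nonneg (hw n) hσ)
      linarith
    · have hcard : r < (n.primeFactors \ B).card := by
        by_contra! h'
        exact h ⟨hpos n hn.1, h'⟩
      have h3 := sum_prime_weights_ge hy (hpos n hn.1) (hX n hn.1) hn.2 hcard
      have h4 := mul_le_mul_of_nonneg_left h3 hlam
      have h5 := mul_le_mul_of_nonneg_left (hr.trans h4) (hw n)
      linarith
  refine (Finset.sum_le_sum h2).trans ?_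
  rw [← Finset.sum_filter]
  refine Finset.sum_le_sum_of_subset_of_nonneg (fun n hn => ?_) fun n _ _ => hw n
  simp only [hT, Finset.mem_filter] at hn ⊢
  exact ⟨hn.1.1, hn.2⟩

/-! ### Sums over primes -/

/-- Partial summation in u = log n / log z against the measure du/u, whose mass on [1, u] is log u.
-/
theorem sum_mul_antitone_le_integral {c : ℕ → ℝ} {z v ε : ℝ} {H : ℝ → ℝ} (hz : 1 < z) (hv : 1 ≤ v)
    (hε : 0 ≤ ε) (hH : AntitoneOn H (Icc 1 v)) (hH0 : ∀ u ∈ Icc 1 v, 0 ≤ H u)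
    (hc : ∀ x, z < x → x ≤ z ^ v →
      ∑ n ∈ Finset.Ico ⌈z⌉₊ ⌈x⌉₊, c n ≤ ε + Real.log (Real.log x / Real.log z)) :
    ∑ n ∈ Finset.Ico ⌈z⌉₊ ⌈z ^ v⌉₊, c n * H (Real.log n / Real.log z) ≤
      ε * H 1 + ∫ u in (1 : ℝ)..v, H u / u := by
  set N := ⌈z⌉₊ with hN
  set Y := ⌈z ^ v⌉₊ with hY
  have hlz := Real.log_pos hz
  have hHint : ∀ s t : ℝ, 1 ≤ s → s ≤ t → t ≤ v →
      IntervalIntegrable (fun u => H u / u) volume s t := fun s t hs hst ht => by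
    refine AntitoneOn.intervalIntegrable fun x hx y hy hxy => ?_
    rw [uIcc_of_le hst] at hx hy
    have hx' : x ∈ Icc 1 v := ⟨hs.trans hx.1, hx.2.trans ht⟩
    have hy' : y ∈ Icc 1 v := ⟨hs.trans hy.1, hy.2.trans ht⟩
    exact div_le_div₀ (hH0 x hx') (hH hx' hy' hxy) (by linarith [hx'.1]) hxy
  have hI0 : ∀ s t : ℝ, 1 ≤ s → s ≤ t → t ≤ v → 0 ≤ ∫ u in s..t, H u / u := fun s t hs hst ht =>
    intervalIntegral.integral_nonneg hst fun u hu =>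
      div_nonneg (hH0 u ⟨hs.trans hu.1, hu.2.trans ht⟩) (by linarith [hu.1])
  rcases le_or_gt Y N with hYN | hYN
  · rw [Finset.Ico_eq_empty (by omega), Finset.sum_empty]
    exact add_nonneg (mul_nonneg hε (hH0 1 ⟨le_rfl, hv⟩)) (hI0 1 v le_rfl hv le_rfl)
  set u : ℕ → ℝ := fun n => Real.log n / Real.log z with hu
  have hNz : z ≤ N := Nat.le_ceil z
  have hpos : ∀ n : ℕ, N ≤ n → (1 : ℝ) < n := fun n hn =>
    lt_of_lt_of_le hz (hNz.trans (by exact_mod_cast hn))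
  have hu1 : ∀ n : ℕ, N ≤ n → 1 ≤ u n := fun n hn => (one_le_div hlz).2
    (Real.log_le_log (by linarith) (hNz.trans (by exact_mod_cast hn)))
  have huv : ∀ n : ℕ, N ≤ n → n < Y → u n ≤ v := fun n hn hnY => by
    rw [hu, div_le_iff₀ hlz, ← Real.log_rpow (by linarith)]
    exact Real.log_le_log (by linarith [hpos n hn]) (Nat.lt_ceil.1 hnY).le
  have humono : ∀ n : ℕ, N ≤ n → u n ≤ u (n + 1) := fun n hn =>
    div_le_div_of_nonneg_right (Real.log_le_log (by linarith [hpos n hn]) (by push_cast; linarith))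
      hlz.le
  -- Letting x decrease to n keeps the term i = n in the sum while the bound tends to its value at
  -- n; the point n + 1 could lie beyond z^v.
  have hpartial : ∀ n : ℕ, N ≤ n → n < Y → ∑ i ∈ Finset.Ico N (n + 1), c i ≤ ε + Real.log (u n) := by
    intro n hn hnY
    have hnv : (n : ℝ) < z ^ v := Nat.lt_ceil.1 hnY
    have hcont : ContinuousAt (fun x : ℝ => ε + Real.log (Real.log x / Real.log z)) n := by
      have h1 : (n : ℝ) ≠ 0 := by linarith [hpos n hn]
      have h2 : Real.log n / Real.log z ≠ 0 := by
        have := hu1 n hn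
        simp only [hu] at this
        linarith
      exact continuousAt_const.add (((Real.continuousAt_log h1).div_const _).log h2)
    have hlim : Tendsto (fun x : ℝ => ε + Real.log (Real.log x / Real.log z)) (𝓝[>] (n : ℝ))
        (𝓝 (ε + Real.log (u n))) := hcont.tendsto.mono_left nhdsWithin_le_nhds
    refine ge_of_tendsto hlim ?_
    filter_upwards [Ioo_mem_nhdsGT (show (n : ℝ) < min ((n : ℝ) + 1) (z ^ v) from
      lt_min (by linarith) hnv)] with x hx
    have hx2 := lt_min_iff.1 hx.2
    have hceil : ⌈x⌉₊ = n + 1 := by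
      rw [Nat.ceil_eq_iff (by omega)]
      exact ⟨by simpa using hx.1, by push_cast; exact hx2.1.le⟩
    rw [← hceil]
    exact hc x (lt_of_le_of_lt (hNz.trans (by exact_mod_cast hn)) hx.1) hx2.2.le
  -- The nodes are shifted by one so that u n is the right end of its interval, where the decreasing
  -- H is smallest.
  set t : ℕ → ℝ := fun n => if n ≤ N then 1 else u (n - 1) with ht
  have htN : t N = 1 := if_pos le_rfl
  have htsucc : ∀ n, N ≤ n → t (n + 1) = u n := fun n hn => by
    simp only [ht]
    rw [if_neg (by omega), Nat.add_sub_cancel]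
  have ht1 : ∀ n, N ≤ n → n ≤ Y → t n ∈ Icc 1 v := fun n hn hnY => by
    rcases eq_or_lt_of_le hn with rfl | h
    · rw [htN]; exact ⟨le_rfl, hv⟩
    · obtain ⟨m, rfl⟩ : ∃ m, n = m + 1 := ⟨n - 1, by omega⟩
      rw [htsucc m (by omega)]
      exact ⟨hu1 m (by omega), huv m (by omega) (by omega)⟩
  have htmono : ∀ n, N ≤ n → t n ≤ t (n + 1) := fun n hn => by
    rw [htsucc n hn]
    rcases eq_or_lt_of_le hn with rfl | h
    · rw [htN]; exact hu1 _ le_rfl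
    · obtain ⟨m, rfl⟩ : ∃ m, n = m + 1 := ⟨n - 1, by omega⟩
      rw [htsucc m (by omega)]
      exact humono m (by omega)
  have hmain := sum_mul_le_of_partial_sums (c := c) (δ := ε) (H := fun n => H (u n))
    (ℓ := fun n => -Real.log (t n) - -Real.log (t (n + 1))) hYN (fun m hm hmY => ?_)
    (fun m hm hmY => hH ⟨hu1 m hm, huv m hm (by omega)⟩ ⟨hu1 _ (by omega), huv _ (by omega) hmY⟩
      (humono m hm)) (hH0 _ ⟨hu1 _ (by omega), huv _ (by omega) (by omega)⟩)
  · refine hmain.trans (add_le_add (mul_le_mul_of_nonneg_left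
      (hH ⟨le_rfl, hv⟩ ⟨hu1 N le_rfl, huv N le_rfl hYN⟩ (hu1 N le_rfl)) hε) ?_)
    have hsum := intervalIntegral.sum_integral_adjacent_intervals_Ico (f := fun u => H u / u)
      (μ := volume) (a := t) hYN.le fun k hk => hHint _ _ (ht1 k hk.1 (by have := hk.2; omega)).1
        (htmono k hk.1) (ht1 (k + 1) (by have := hk.1; omega) hk.2).2
    have hle : ∑ n ∈ Finset.Ico N Y, (-Real.log (t n) - -Real.log (t (n + 1))) * H (u n) ≤
        ∑ n ∈ Finset.Ico N Y, ∫ x in (t n)..(t (n + 1)), H x / x := by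
      refine Finset.sum_le_sum fun n hn => ?_
      rw [Finset.mem_Ico] at hn
      have hn1 := ht1 n hn.1 hn.2.le
      have hn2 := ht1 (n + 1) (by omega) (by omega)
      have hlog : ∫ x in (t n)..(t (n + 1)), H (u n) / x =
          (-Real.log (t n) - -Real.log (t (n + 1))) * H (u n) := by
        simp_rw [div_eq_mul_inv]
        rw [intervalIntegral.integral_const_mul, integral_inv_of_pos (by linarith [hn1.1])
          (by linarith [hn2.1]), Real.log_div (by linarith [hn2.1]) (by linarith [hn1.1])]
        ring
      rw [← hlog]
      refine intervalIntegral.integral_mono_on (htmono n hn.1) ?_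
        (hHint _ _ hn1.1 (htmono n hn.1) hn2.2) fun x hx => ?_
      · refine ContinuousOn.intervalIntegrable (continuousOn_const.div continuousOn_id fun x hx => ?_)
        rw [uIcc_of_le (htmono n hn.1)] at hx
        linarith [hx.1, hn1.1, show id x = x from rfl]
      · refine div_le_div_of_nonneg_right ?_ (by linarith [hx.1, hn1.1])
        rw [← htsucc n hn.1]
        exact hH ⟨hn1.1.trans hx.1, hx.2.trans hn2.2⟩ hn2 hx.2
    refine hle.trans ?_
    rw [hsum, htN]
    have hY1 := ht1 Y hYN.le le_rfl
    have hadd := intervalIntegral.integral_add_adjacent_intervals (hHint 1 (t Y) le_rfl hY1.1 hY1.2)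
      (hHint (t Y) v hY1.1 hY1.2 le_rfl)
    linarith [hI0 (t Y) v hY1.1 hY1.2 le_rfl]
  · rw [sum_Ico_sub_succ (fun n => -Real.log (t n)) hm, htN, Real.log_one]
    rcases eq_or_lt_of_le hm with rfl | h
    · simpa [htN] using hε
    · obtain ⟨k, rfl⟩ : ∃ k, m = k + 1 := ⟨m - 1, by omega⟩
      rw [htsucc k (by omega)]
      have := hpartial k (by omega) (by omega)
      linarith

/-- The inequality g ≤ -log(1 - g) makes the sum telescope into a logarithm of the product ratio;
then log(1 + ε) ≤ ε. -/
theorem sum_density_le {P : ℕ → Prop} [DecidablePred P] {g : ℕ → ℝ} (hg1 : ∀ p, P p → g p < 1)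
    {z x ε : ℝ} (hz : 1 < z) (hzx : z ≤ x) (hε : 0 < ε)
    (hV : siftedProd g P ⌈z⌉₊ ≤ (1 + ε) * (Real.log x / Real.log z) * siftedProd g P ⌈x⌉₊) :
    ∑ n ∈ Finset.Ico ⌈z⌉₊ ⌈x⌉₊, (if P n then g n else 0) ≤
      ε + Real.log (Real.log x / Real.log z) := by
  have key : ∀ M, ⌈z⌉₊ ≤ M → ∑ n ∈ Finset.Ico ⌈z⌉₊ M, (if P n then g n else 0) ≤
      Real.log (siftedProd g P ⌈z⌉₊) - Real.log (siftedProd g P M) := by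
    intro M hM
    induction M, hM using Nat.le_induction with
    | base => simp
    | succ M hM ih =>
      rw [Finset.sum_Ico_succ_top hM]
      have h1 := siftedProd_succ (P := P) (g := g) M
      split_ifs at h1 ⊢ with h
      · have e1 : siftedProd g P (M + 1) = siftedProd g P M * (1 - g M) := by linarith
        have hg := hg1 M h
        rw [e1, Real.log_mul (siftedProd_pos hg1 M).ne' (by linarith)]
        have := Real.log_le_sub_one_of_pos (show 0 < 1 - g M by linarith)
        linarith
      · rw [show siftedProd g P (M + 1) = siftedProd g P M by linarith]
        linarith
  refine (key _ (Nat.ceil_mono hzx)).trans ?_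
  have h1 := siftedProd_pos (P := P) hg1 ⌈z⌉₊
  have h2 := siftedProd_pos (P := P) hg1 ⌈x⌉₊
  have h3 := Real.log_le_log h1 hV
  have hlz := Real.log_pos hz
  have hlx := Real.log_pos (lt_of_lt_of_le hz hzx)
  have h4 : 0 < Real.log x / Real.log z := by positivity
  rw [Real.log_mul (by positivity) h2.ne', Real.log_mul (by positivity) h4.ne'] at h3
  have := Real.log_le_sub_one_of_pos (show 0 < 1 + ε by linarith)
  linarith

/-- Sets of primes correspond injectively to squarefree products, so each d occurs at most once and
the factor 4^ν(d) ≥ 1 is only a surplus. -/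
theorem siftedErr_le_sum {B : Finset ℕ} (hB : ∀ p ∈ B, p.Prime) (R : ℕ → ℝ) (D : ℝ) (N : ℕ) :
    siftedErr R (SievePrime B) 1 D N ≤
      ∑ d ∈ Finset.range ⌈D⌉₊ with ∀ p ∈ B, Nat.Coprime d p,
        (ArithmeticFunction.moebius d : ℝ) ^ 2 *
          4 ^ (ArithmeticFunction.cardDistinctFactors d) * |R d| := by
  set f : ℕ → ℝ := fun d => (ArithmeticFunction.moebius d : ℝ) ^ 2 *
          4 ^ (ArithmeticFunction.cardDistinctFactors d) * |R d| with hf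
  have hf0 : ∀ d, 0 ≤ f d := fun d => by positivity
  rw [siftedErr, ← Finset.sum_filter]
  set T := ((Finset.range N).filter (SievePrime B)).powerset.filter
    fun S => ((∏ p ∈ S, p : ℕ) : ℝ) < D with hT
  have hmem : ∀ S ∈ T, (∀ p ∈ S, p.Prime ∧ p ∉ B) ∧ ((∏ p ∈ S, p : ℕ) : ℝ) < D := fun S hS => by
    rw [hT, Finset.mem_filter, Finset.mem_powerset] at hS
    exact ⟨fun p hp => (Finset.mem_filter.1 (hS.1 hp)).2, hS.2⟩
  calc ∑ S ∈ T, |R (1 * ∏ p ∈ S, p)| ≤ ∑ S ∈ T, f (∏ p ∈ S, p) := by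
        refine Finset.sum_le_sum fun S hS => ?_
        have hsq : Squarefree (∏ p ∈ S, p) := by
          refine Finset.squarefree_prod_of_pairwise_isCoprime (fun p hp q hq hpq => ?_) fun p hp =>
            ((hmem S hS).1 p hp).1.prime.squarefree
          exact Nat.coprime_iff_isRelPrime.1 ((Nat.coprime_primes ((hmem S hS).1 p hp).1
            ((hmem S hS).1 q hq).1).2 hpq)
        rw [one_mul, hf]
        have h1 : (ArithmeticFunction.moebius (∏ p ∈ S, p) : ℝ) ^ 2 = 1 := by
          exact_mod_cast ArithmeticFunction.moebius_sq_eq_one_of_squarefree hsq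
        simp only
        rw [h1, one_mul]
        exact le_mul_of_one_le_left (abs_nonneg _) (one_le_pow₀ (by norm_num))
    _ = ∑ d ∈ T.image fun S => ∏ p ∈ S, p, f d := by
        rw [Finset.sum_image]
        intro S hS S' hS' h
        simp only at h
        rw [← Nat.primeFactors_prod fun p hp => ((hmem S hS).1 p hp).1, h,
          Nat.primeFactors_prod fun p hp => ((hmem S' hS').1 p hp).1]
    _ ≤ _ := by
        refine Finset.sum_le_sum_of_subset_of_nonneg (fun d hd => ?_) fun d _ _ => hf0 d
        obtain ⟨S, hS, rfl⟩ := Finset.mem_image.1 hd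
        rw [Finset.mem_filter, Finset.mem_range]
        refine ⟨Nat.lt_ceil.2 (hmem S hS).2, fun p hp => Nat.Coprime.prod_left fun q hq => ?_⟩
        refine (Nat.coprime_primes ((hmem S hS).1 q hq).1 (hB p hp)).2 ?_
        rintro rfl
        exact ((hmem S hS).1 q hq).2 hp

/-! ### Consequences of the hypotheses on the sequence -/

namespace IsSetup

variable {B : Finset ℕ} {τ A A₁ A₂ X : ℝ} {ω : ArithmeticFunction ℝ} {w : ℕ →₀ ℝ}

theorem siftedSum_zero (q : ℕ) :
    siftedSum w (SievePrime B) q 0 = ω q / q * X + remainder w ω X q := by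
  rw [remainder, add_sub_cancel, siftedSum, congruenceSum]
  simp

theorem density_nonneg' (h : IsSetup B τ A A₁ A₂ X ω w) (n : ℕ) : 0 ≤ ω n / n :=
  div_nonneg (h.density_nonneg n) n.cast_nonneg

theorem density_mul (h : IsSetup B τ A A₁ A₂ X ω w) (m n : ℕ) (hmn : Nat.Coprime m n) :
    ω (m * n) / ((m * n : ℕ) : ℝ) = ω m / m * (ω n / n) := by
  rw [h.multiplicative.map_mul_of_coprime hmn, Nat.cast_mul, mul_div_mul_comm]

theorem density_lt_one (h : IsSetup B τ A A₁ A₂ X ω w) (p : ℕ) (hp : SievePrime B p) :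
    ω p / p < 1 :=
  (div_lt_one (by exact_mod_cast hp.1.pos)).2 (h.density_lt p hp.1 hp.2)

theorem siftedProd_eq (h : IsSetup B τ A A₁ A₂ X ω w) (N : ℕ) :
    siftedProd (fun n => ω n / n) (SievePrime B) N =
      ∏ p ∈ Finset.range N with p.Prime, (1 - ω p / p) := by
  refine Finset.prod_subset (fun p hp => ?_) fun p hp hp' => ?_
  · rw [Finset.mem_filter] at hp ⊢
    exact ⟨hp.1, hp.2.1⟩
  · rw [Finset.mem_filter] at hp
    have hpB : p ∈ B := by
      by_contra hpB
      exact hp' (Finset.mem_filter.2 ⟨hp.1, hp.2, hpB⟩)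
    simp [h.density_bad p hpB]

theorem siftedProd_le (h : IsSetup B τ A A₁ A₂ X ω w) (hA : 0 ≤ A) {u z : ℝ} (hu : 2 ≤ u)
    (huz : u ≤ z) : siftedProd (fun n => ω n / n) (SievePrime B) ⌈u⌉₊ ≤
      Real.log z / Real.log u * (1 + A / Real.log u) *
        siftedProd (fun n => ω n / n) (SievePrime B) ⌈z⌉₊ := by
  have hlu : 0 < Real.log u := Real.log_pos (by linarith)
  have hVz := siftedProd_pos h.density_lt_one ⌈z⌉₊
  rcases eq_or_lt_of_le huz with rfl | hlt
  · rw [div_self hlu.ne', one_mul]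
    have : 0 ≤ A / Real.log u := by positivity
    nlinarith
  have hd := h.dimension u z hu hlt
  rw [Finset.prod_inv_distrib] at hd
  set T := ∏ p ∈ (Finset.range ⌈z⌉₊).filter (fun p : ℕ => p.Prime ∧ u ≤ (p : ℝ)), (1 - ω p / p)
  have hmul : siftedProd (fun n => ω n / n) (SievePrime B) ⌈u⌉₊ * T =
      siftedProd (fun n => ω n / n) (SievePrime B) ⌈z⌉₊ := by
    rw [h.siftedProd_eq, h.siftedProd_eq, ← Finset.prod_union]
    · refine Finset.prod_congr ?_ fun _ _ => rfl
      ext p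
      have hceil := Nat.ceil_mono huz
      simp only [Finset.mem_union, Finset.mem_filter, Finset.mem_range]
      constructor
      · rintro (⟨h1, h2⟩ | ⟨h1, h2, _⟩)
        · exact ⟨by omega, h2⟩
        · exact ⟨h1, h2⟩
      · rintro ⟨h1, h2⟩
        rcases lt_or_ge (p : ℝ) u with h3 | h3
        · exact Or.inl ⟨Nat.lt_ceil.2 h3, h2⟩
        · exact Or.inr ⟨h1, h2, h3⟩
    · rw [Finset.disjoint_left]
      intro p hp hp'
      simp only [Finset.mem_filter, Finset.mem_range] at hp hp'
      exact absurd hp'.2.2 (not_le.2 (Nat.lt_ceil.1 hp.1))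
  have hVu := siftedProd_pos h.density_lt_one ⌈u⌉₊
  have hT : 0 < T := by
    rw [← hmul] at hVz
    exact pos_of_mul_pos_right hVz hVu.le
  have h1 := mul_le_mul_of_nonneg_right hd hVz.le
  have h2 : T⁻¹ * siftedProd (fun n => ω n / n) (SievePrime B) ⌈z⌉₊ =
      siftedProd (fun n => ω n / n) (SievePrime B) ⌈u⌉₊ := by
    rw [← hmul]; field_simp
  linarith

theorem siftedErr_le (h : IsSetup B τ A A₁ A₂ X ω w) (hB : ∀ p ∈ B, p.Prime) (N : ℕ) :
    siftedErr (remainder w ω X) (SievePrime B) 1 (X ^ τ * Real.log X ^ (-A₁)) N ≤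
      A₂ * (X / Real.log X ^ 2) :=
  (siftedErr_le_sum hB _ _ N).trans h.distribution

end IsSetup

/-! ### The weight function and the combined remainders. -/

theorem monotoneOn_mul_upperFun : MonotoneOn (fun t => t * upperFun t) (Ioi 0) := by
  have h1 : ∀ s t : ℝ, 2 ≤ s → s ≤ t → s * upperFun s ≤ t * upperFun t := fun s t hs hst => by
    have h2 := integral_lowerFun_sub_one hs hst
    have h3 : 0 ≤ ∫ x in s..t, lowerFun (x - 1) := intervalIntegral.integral_nonneg hst
      fun x hx => lowerFun_nonneg (by linarith [hx.1])
    linarith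
  have h2 : ∀ s : ℝ, 0 < s → s ≤ 2 → s * upperFun s = sieveConst := fun s h0 hs => by
    rw [upperFun_of_le_two h0 hs, mul_div_cancel₀ _ h0.ne']
  intro s hs t ht hst
  have hs0 : (0 : ℝ) < s := hs
  have ht0 : (0 : ℝ) < t := ht
  simp only
  rcases le_total 2 s with h | h
  · exact h1 s t h hst
  · rw [h2 s hs0 h, ← h2 2 two_pos le_rfl]
    rcases le_total t 2 with h' | h'
    · rw [h2 t ht0 h', h2 2 two_pos le_rfl]
    · exact h1 2 t le_rfl h'

/-- F(b - u) increases with u, but up to the constant b - a the product is (1 - a/(b-u)) · (b-u)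
F(b-u), whose two factors are nonnegative and decrease, since tF(t) is increasing. -/
theorem antitoneOn_weight_upperFun {a b κ : ℝ} (ha : 0 < a) (hab : a < b - 1) (hκ : 0 ≤ κ) :
    AntitoneOn (fun u => (1 - u / (b - a)) * (upperFun (b - u) + κ)) (Icc 1 (b - a)) := by
  have hba : 0 < b - a := by linarith
  have h1 : AntitoneOn (fun u => (1 - u / (b - a)) * upperFun (b - u)) (Icc 1 (b - a)) := by
    intro u hu v hv huv
    have hu1 : a ≤ b - u := by linarith [hu.2]
    have hv1 : a ≤ b - v := by linarith [hv.2]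
    have e : ∀ x : ℝ, a ≤ b - x → (1 - x / (b - a)) * upperFun (b - x) =
        (1 - a / (b - x)) * ((b - x) * upperFun (b - x)) / (b - a) := fun x hx => by
      have : b - x ≠ 0 := by linarith
      field_simp
      ring
    simp only
    rw [e u hu1, e v hv1]
    refine div_le_div_of_nonneg_right ?_ hba.le
    have h2 : (b - v) * upperFun (b - v) ≤ (b - u) * upperFun (b - u) :=
      monotoneOn_mul_upperFun (show (0 : ℝ) < b - v by linarith) (show (0 : ℝ) < b - u by linarith)
        (by linarith)
    have h3 : a / (b - u) ≤ a / (b - v) :=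
      div_le_div_of_nonneg_left ha.le (by linarith) (by linarith)
    have h4 : a / (b - u) ≤ 1 := div_le_one_of_le₀ hu1 (by linarith)
    have h5 : 0 ≤ (b - v) * upperFun (b - v) :=
      mul_nonneg (by linarith) (by linarith [one_le_upperFun (s := b - v) (by linarith)])
    exact mul_le_mul (by linarith) h2 h5 (by linarith)
  have h2 : AntitoneOn (fun u => (1 - u / (b - a)) * κ) (Icc 1 (b - a)) := fun u _ v _ huv =>
    mul_le_mul_of_nonneg_right
      (sub_le_sub_left (div_le_div_of_nonneg_right huv hba.le) 1) hκ
  refine (h1.add h2).congr fun u _ => ?_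
  ring

theorem integral_weight_le {a b κ : ℝ} (ha₁ : 1 ≤ a) (ha₃ : a < 3) (hab : a + 5 < b)
    (hb : b ≤ 8) (hκ : 0 ≤ κ) :
    ∫ u in (1 : ℝ)..(b - a), (1 - u / (b - a)) * (upperFun (b - u) + κ) / u ≤
      sieveConst * (I₁ a b + I₂ a b + I₃ a b) + 8 * κ := by
  rw [← integral_weight_upperFun ha₁ ha₃ hab hb]
  have hle : (1 : ℝ) ≤ b - a := by linarith
  have hc : ContinuousOn (fun u => (1 - u / (b - a)) * upperFun (b - u) / u) (Icc 1 (b - a)) := by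
    refine ContinuousOn.div (ContinuousOn.mul (by fun_prop) ?_) continuousOn_id fun u hu => ?_
    · exact continuousOn_upperFun.comp (by fun_prop) fun u hu => by
        simp only [mem_Ioi]; linarith [hu.2]
    · linarith [hu.1, show id u = u from rfl]
  have hk : ContinuousOn (fun u => (1 - u / (b - a)) * κ / u) (Icc 1 (b - a)) := by
    refine ContinuousOn.div (by fun_prop) continuousOn_id fun u hu => ?_
    linarith [hu.1, show id u = u from rfl]
  have e : ∀ u : ℝ, (1 - u / (b - a)) * (upperFun (b - u) + κ) / u =
      (1 - u / (b - a)) * upperFun (b - u) / u + (1 - u / (b - a)) * κ / u := fun u => by ring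
  simp_rw [e]
  rw [intervalIntegral.integral_add (hc.intervalIntegrable_of_Icc hle)
    (hk.intervalIntegrable_of_Icc hle)]
  refine add_le_add le_rfl ?_
  calc ∫ u in (1 : ℝ)..(b - a), (1 - u / (b - a)) * κ / u ≤ ∫ _ in (1 : ℝ)..(b - a), κ := by
        refine intervalIntegral.integral_mono_on hle (hk.intervalIntegrable_of_Icc hle) (by simp)
          fun u hu => ?_
        rw [div_le_iff₀ (by linarith [hu.1])]
        have h1 : 0 ≤ u / (b - a) := div_nonneg (by linarith [hu.1]) (by linarith)
        nlinarith [hu.1]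
    _ = (b - a - 1) * κ := by simp
    _ ≤ 8 * κ := mul_le_mul_of_nonneg_right (by linarith) hκ

/-- The sieves for the individual p use moduli p d with d composed of primes below N ≤ p, all of
them distinct terms of the expansion of one error at level D. The sum over p therefore costs no more
than a single sieve. -/
theorem sum_siftedErr_le {P : ℕ → Prop} [DecidablePred P] {R : ℕ → ℝ} (hP : ∀ p, P p → p.Prime)
    {D : ℝ} (hD : 1 < D) {N Y : ℕ} (hN : 2 ≤ N) (hNY : N ≤ Y) :
    ∑ p ∈ Finset.Ico N Y, (if P p then siftedErr R P p (D / p) N else 0) ≤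
      siftedErr R P 1 D Y := by
  rw [siftedErr_eq hP 1 hD (hN.trans hNY)]
  refine le_add_of_nonneg_of_le (abs_nonneg _) ?_
  refine (Finset.sum_le_sum (g := fun n => if P n then siftedErr R P (1 * n) (D / n) n else 0)
    fun p hp => ?_).trans (Finset.sum_le_sum_of_subset_of_nonneg
      (Finset.Ico_subset_Ico_left hN) fun n _ _ => ?_)
  · simp only [one_mul]
    split_ifs
    · exact siftedErr_mono _ _ (Finset.mem_Ico.1 hp).1
    · exact le_rfl
  · split_ifs
    · exact siftedErr_nonneg _ _ _
    · exact le_rfl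

/-! ### The main inequality -/

/-- The actual sieve parameter is only known to be at least b - η, because of `smallProd` and the
power of log X in the level; κ is the resulting loss in F and f, by continuity. -/
theorem weighted_sieve {B : Finset ℕ} {τ A A₁ A₂ X : ℝ} {ω : ArithmeticFunction ℝ} {w : ℕ →₀ ℝ}
    (h : IsSetup B τ A A₁ A₂ X ω w) {a b : ℝ} (ha₁ : 1 ≤ a) (ha₃ : a < 3) (hab : a + 5 < b)
    (hb : b ≤ 8) (hX : 0 ≤ X) {r : ℕ} {lam ε κ η : ℝ} (hε0 : 0 < ε) (hε1 : ε ≤ 1 / 100)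
    (hκ : 0 ≤ κ) (hη : η ≤ 1 / 2)
    (hupper : ∀ t, a ≤ t → t ≤ b → upperFun (t - η) ≤ upperFun t + κ)
    (hlower : lowerFun b - κ ≤ lowerFun (b - η)) (hlam : 0 ≤ lam) {u₀ : ℕ} (hu₀ : 2 ≤ u₀)
    (hV : ∀ u z : ℝ, (u₀ : ℝ) ≤ u → u ≤ z → siftedProd (fun n => ω n / n) (SievePrime B) ⌈u⌉₊ ≤
      (1 + ε) * (Real.log z / Real.log u) * siftedProd (fun n => ω n / n) (SievePrime B) ⌈z⌉₊)
    {D z : ℝ} (hz : (u₀ : ℝ) ≤ z) (hD : 0 < D)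
    (hr : 1 ≤ lam * ((r : ℝ) + 1 - Real.log X / Real.log (z ^ (b - a))))
    (hs : b - η ≤ Real.log (D / smallProd (SievePrime B) u₀) / Real.log z) :
    X * siftedProd (fun n => ω n / n) (SievePrime B) ⌈z⌉₊ *
      (lowerFun b - κ - errConst * ε - lam * (ε * (sieveConst + (κ + errConst * ε * upperErr (1 / 2)))
        + (sieveConst * (I₁ a b + I₂ a b + I₃ a b) + 8 * (κ + errConst * ε * upperErr (1 / 2))))) -
      (1 + lam) * siftedErr (remainder w ω X) (SievePrime B) 1 D ⌈z ^ (b - a)⌉₊ ≤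
      ∑ n ∈ w.support with n ∈ almostPrimes r B, w n := by
  set P := SievePrime B with hPdef
  set g : ℕ → ℝ := fun n => ω n / n with hg
  set R := remainder w ω X with hRdef
  set Q := smallProd P u₀ with hQdef
  set V := siftedProd g P ⌈z⌉₊ with hVdef
  set E := siftedErr R P 1 D ⌈z ^ (b - a)⌉₊ with hE
  set U := upperErr (1 / 2) with hU
  have hP : ∀ p, P p → p.Prime := fun p hp => hp.1
  have hC := errConst_pos
  have hS := sieveConst_pos
  have hU0 : 0 < U := upperErr_pos (by norm_num)
  have hz1 : 1 < z := lt_of_lt_of_le (by exact_mod_cast hu₀) hz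
  have hlz := Real.log_pos hz1
  have hQ1 : (1 : ℝ) ≤ Q := by exact_mod_cast smallProd_pos hP u₀
  have hV0 : 0 < V := siftedProd_pos h.density_lt_one _
  have hXV : 0 ≤ X * V := mul_nonneg hX hV0.le
  have hDQ : 0 < D / Q := by positivity
  have hy1 : 1 < z ^ (b - a) := Real.one_lt_rpow hz1 (by linarith)
  have hzy : z ≤ z ^ (b - a) := by
    simpa using Real.rpow_le_rpow_of_exponent_le hz1.le (show 1 ≤ b - a by linarith)
  have hNY : ⌈z⌉₊ ≤ ⌈z ^ (b - a)⌉₊ := Nat.ceil_mono hzy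
  have hN2 : 2 ≤ ⌈z⌉₊ := Nat.lt_ceil.2 (by exact_mod_cast hz1)
  have hlogDQ : (b - η) * Real.log z ≤ Real.log (D / Q) := (le_div_iff₀ hlz).1 hs
  have hzD : z ^ 2 ≤ D / Q := by
    rw [← Real.log_le_log_iff (by positivity) hDQ, Real.log_pow]
    refine le_trans ?_ hlogDQ
    push_cast
    nlinarith
  have hD1 : 1 < D := by
    have h1 : 1 < z ^ 2 := one_lt_pow₀ hz1 two_ne_zero
    have h2 : D / Q ≤ D := div_le_self hD.le hQ1
    linarith
  have hE0 : 0 ≤ E := siftedErr_nonneg _ _ _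
  have hlowS : X * V * (lowerFun b - κ - errConst * ε) - E ≤ siftedSum w P 1 ⌈z⌉₊ := by
    have h1 : g 1 * X * V * (lowerFun (Real.log (D / Q) / Real.log z) -
        errConst * ε * Real.exp (-(Real.log (D / Q) / Real.log z))) -
        siftedErr R P 1 D ⌈z⌉₊ ≤ siftedSum w P 1 ⌈z⌉₊ :=
      (sieve_upper_and_lower h.nonneg hP h.density_nonneg' h.density_mul h.density_lt_one
        hX hε0 hε1 (IsSetup.siftedSum_zero (X := X) (ω := ω)) hu₀ hV hz
        (q := 1) (D := D) fun p _ _ => Nat.coprime_one_left p).2 hzD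
    have h2 : siftedErr R P 1 D ⌈z⌉₊ ≤ E := siftedErr_mono _ _ hNY
    have h3 : lowerFun (b - η) ≤ lowerFun (Real.log (D / Q) / Real.log z) :=
      monotoneOn_lowerFun (show (0 : ℝ) < b - η by linarith)
        (show (0 : ℝ) < _ by linarith) hs
    have h4 : Real.exp (-(Real.log (D / Q) / Real.log z)) ≤ 1 := Real.exp_le_one_iff.2 (by linarith)
    have h5 := mul_le_mul_of_nonneg_left h4 (show 0 ≤ errConst * ε by positivity)
    have h6 : g 1 = 1 := by simp [hg, h.multiplicative.map_one]
    have h7 : X * V * (lowerFun b - κ - errConst * ε) ≤ g 1 * X * V *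
        (lowerFun (Real.log (D / Q) / Real.log z) -
          errConst * ε * Real.exp (-(Real.log (D / Q) / Real.log z))) := by
      rw [h6, one_mul]
      exact mul_le_mul_of_nonneg_left (by linarith) hXV
    linarith
  set H : ℝ → ℝ := fun u => (1 - u / (b - a)) * (upperFun (b - u) + (κ + errConst * ε * U)) with hH
  have hκ1 : 0 ≤ κ + errConst * ε * U := by positivity
  have hterm : ∀ p ∈ Finset.Ico ⌈z⌉₊ ⌈z ^ (b - a)⌉₊,
      (if P p then (1 - Real.log p / Real.log (z ^ (b - a))) * siftedSum w P p ⌈z⌉₊ else 0) ≤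
      X * V * ((if P p then g p else 0) * H (Real.log p / Real.log z)) +
        (if P p then siftedErr R P p (D / p) ⌈z⌉₊ else 0) := by
    intro p hp
    rw [Finset.mem_Ico] at hp
    split_ifs with hPp
    · have hpz : z ≤ p := (Nat.le_ceil z).trans (by exact_mod_cast hp.1)
      have hpy : (p : ℝ) < z ^ (b - a) := Nat.lt_ceil.1 hp.2
      have hp0 : (0 : ℝ) < p := by linarith
      set u := Real.log p / Real.log z with hu
      have hu1 : 1 ≤ u := (one_le_div hlz).2 (Real.log_le_log (by linarith) hpz)
      have huv : u ≤ b - a := by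
        rw [hu, div_le_iff₀ hlz, ← Real.log_rpow (by linarith)]
        exact Real.log_le_log hp0 hpy.le
      have hweight : 1 - Real.log p / Real.log (z ^ (b - a)) = 1 - u / (b - a) := by
        rw [Real.log_rpow (by linarith), hu, div_div, mul_comm (b - a)]
      have hw0 : 0 ≤ 1 - u / (b - a) := by
        have := div_le_one_of_le₀ huv (by linarith : 0 ≤ b - a)
        linarith
      have hlogp : Real.log p = u * Real.log z := by rw [hu]; field_simp
      have hquot : Real.log (D / p / Q) / Real.log z = Real.log (D / Q) / Real.log z - u := by
        rw [div_right_comm, Real.log_div hDQ.ne' hp0.ne', sub_div]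
      -- Since u ≤ b - a, the left side is at least a - η ≥ 1/2, which is why `upperErr (1 / 2)`
      -- bounds the error profile for all p.
      have hs' : b - u - η ≤ Real.log (D / p / Q) / Real.log z := by rw [hquot]; linarith
      have hDp : 1 < D / p / Q := by
        rw [← Real.log_pos_iff (by positivity)]
        have : 0 < Real.log (D / p / Q) / Real.log z := by linarith
        exact (div_pos_iff_of_pos_right hlz).1 this
      have h1 := (sieve_upper_and_lower h.nonneg hP h.density_nonneg' h.density_mul
        h.density_lt_one hX hε0 hε1 (IsSetup.siftedSum_zero (X := X) (ω := ω)) hu₀ hV hz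
        (q := p) (D := D / p) fun p' hp' hPp' =>
          (Nat.coprime_primes (hP p hPp) (hP p' hPp')).2 (by omega)).1 hDp
      have h2 : upperFun (Real.log (D / p / Q) / Real.log z) ≤ upperFun (b - u) + κ :=
        (antitoneOn_upperFun (show (0 : ℝ) < b - u - η by linarith)
          (show (0 : ℝ) < _ by linarith) hs').trans (hupper (b - u) (by linarith) (by linarith))
      have h3 : upperErr (Real.log (D / p / Q) / Real.log z) ≤ U :=
        antitoneOn_upperErr (show (0 : ℝ) < 1 / 2 by norm_num) (show (0 : ℝ) < _ by linarith)
          (by linarith)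
      have h4 := mul_le_mul_of_nonneg_left h3 (show 0 ≤ errConst * ε by positivity)
      have h5 : siftedSum w P p ⌈z⌉₊ ≤ g p * X * V * (upperFun (b - u) + (κ + errConst * ε * U)) +
          siftedErr R P p (D / p) ⌈z⌉₊ := by
        refine h1.trans (add_le_add (mul_le_mul_of_nonneg_left (by linarith) ?_) le_rfl)
        exact mul_nonneg (mul_nonneg (h.density_nonneg' p) hX) hV0.le
      rw [hweight]
      have h6 := mul_le_mul_of_nonneg_left h5 hw0
      have h7 : (1 - u / (b - a)) * siftedErr R P p (D / p) ⌈z⌉₊ ≤ siftedErr R P p (D / p) ⌈z⌉₊ :=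
        mul_le_of_le_one_left (siftedErr_nonneg _ _ _)
          (by linarith [div_nonneg (show 0 ≤ u by linarith) (show 0 ≤ b - a by linarith)])
      have h8 : (1 - u / (b - a)) * (g p * X * V * (upperFun (b - u) + (κ + errConst * ε * U))) =
          X * V * (g p * H u) := by simp only [hH]; ring
      linarith
    · simp
  have hsumErr := sum_siftedErr_le (R := R) hP hD1 hN2 hNY
  have hHint := sum_mul_antitone_le_integral (c := fun n => if P n then g n else 0) (ε := ε) (H := H)
    hz1 (show 1 ≤ b - a by linarith) hε0.le (antitoneOn_weight_upperFun (by linarith) (by linarith) hκ1)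
    (fun u hu => mul_nonneg (by
      have := div_le_one_of_le₀ hu.2 (by linarith : 0 ≤ b - a)
      linarith) (by linarith [one_le_upperFun (s := b - u) (by linarith [hu.2])]))
    (fun x hx _ => sum_density_le h.density_lt_one hz1 hx.le hε0 (hV z x hz hx.le))
  have hI := integral_weight_le ha₁ ha₃ hab hb hκ1
  have hH1 : H 1 ≤ sieveConst + (κ + errConst * ε * U) := by
    have h1 : upperFun (b - 1) ≤ sieveConst := by
      have := antitoneOn_upperFun (mem_Ioi.2 one_pos) (show (0 : ℝ) < b - 1 by linarith)
        (by linarith)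
      rwa [upperFun_of_le_two one_pos one_le_two, div_one] at this
    have h2 : 0 ≤ 1 / (b - a) := one_div_nonneg.2 (by linarith)
    have h3 := one_le_upperFun (s := b - 1) (by linarith)
    refine (mul_le_of_le_one_left (by linarith) (by linarith)).trans ?_
    linarith
  have hsum := Finset.sum_le_sum hterm
  rw [Finset.sum_add_distrib, ← Finset.mul_sum] at hsum
  have hεH := mul_le_mul_of_nonneg_left hH1 hε0.le
  have hXVH := mul_le_mul_of_nonneg_left (hHint.trans (add_le_add hεH hI)) hXV
  have hfin := mul_le_mul_of_nonneg_left (hsum.trans (add_le_add hXVH hsumErr)) hlam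
  have hcomb := weighted_sum_le (B := B) (N := ⌈z⌉₊) h.nonneg h.index_pos h.index_le hy1 hlam hr
  linarith

/-! ### Choice of the parameters -/

theorem lowerFun_pos {s : ℝ} (hs : 3 ≤ s) : 0 < lowerFun s := by
  have h1 := mul_lowerFun_of_le_four (s := 3) (by norm_num) (by norm_num)
  have h2 : 0 < Real.log ((3 : ℝ) - 1) := Real.log_pos (by norm_num)
  have h3 := mul_pos sieveConst_pos h2
  have h4 := monotoneOn_lowerFun (show (0 : ℝ) < 3 by norm_num) (show 0 < s by linarith) hs
  linarith

theorem sum_integrals_nonneg {a b : ℝ} (ha₁ : 1 ≤ a) (ha₃ : a < 3) (hab : a + 5 < b)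
    (hb : b ≤ 8) : 0 ≤ I₁ a b + I₂ a b + I₃ a b := by
  have h := integral_weight_upperFun ha₁ ha₃ hab hb
  have h1 : 0 ≤ ∫ u in (1 : ℝ)..(b - a), (1 - u / (b - a)) * upperFun (b - u) / u := by
    refine intervalIntegral.integral_nonneg (by linarith) fun u hu => ?_
    have h2 : u / (b - a) ≤ 1 := div_le_one_of_le₀ hu.2 (by linarith)
    have h3 := one_le_upperFun (s := b - u) (by linarith [hu.2])
    exact div_nonneg (mul_nonneg (by linarith) (by linarith)) (by linarith [hu.1])
  rw [h] at h1
  exact nonneg_of_mul_nonneg_right h1 sieveConst_pos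

theorem exists_shift {a b κ : ℝ} (ha : 1 ≤ a) (hb : 0 < b) (hκ : 0 < κ) :
    ∃ η : ℝ, 0 < η ∧ η ≤ 1 / 2 ∧ (∀ t, a ≤ t → t ≤ b → upperFun (t - η) ≤ upperFun t + κ) ∧
      lowerFun b - κ ≤ lowerFun (b - η) := by
  have huc : UniformContinuousOn upperFun (Icc (1 / 2) b) :=
    isCompact_Icc.uniformContinuousOn_of_continuous
      (continuousOn_upperFun.mono fun x hx => by simp only [mem_Ioi]; linarith [hx.1])
  obtain ⟨δ₁, hδ₁, h1⟩ := Metric.uniformContinuousOn_iff.1 huc κ hκ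
  obtain ⟨δ₂, hδ₂, h2⟩ := Metric.continuousAt_iff.1
    (continuousOn_lowerFun.continuousAt (Ioi_mem_nhds hb)) κ hκ
  set η := min (1 / 2) (min (δ₁ / 2) (δ₂ / 2)) with hη
  have hη0 : 0 < η := by positivity
  have hηh : η ≤ 1 / 2 := min_le_left _ _
  have hη1 : η ≤ δ₁ / 2 := (min_le_right _ _).trans (min_le_left _ _)
  have hη2 : η ≤ δ₂ / 2 := (min_le_right _ _).trans (min_le_right _ _)
  have hdist : ∀ t : ℝ, dist (t - η) t = η := fun t => by
    rw [Real.dist_eq, sub_sub_cancel_left, abs_neg, abs_of_pos hη0]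
  refine ⟨η, hη0, hηh, fun t hat htb => ?_, ?_⟩
  · have h3 := h1 (t - η) ⟨by linarith, by linarith⟩ t ⟨by linarith, htb⟩ (by rw [hdist]; linarith)
    rw [Real.dist_eq] at h3
    linarith [(abs_lt.1 h3).2]
  · have h3 := h2 (x := b - η) (by rw [hdist]; linarith)
    rw [Real.dist_eq] at h3
    linarith [(abs_lt.1 h3).1]

/-- The ratio equals b up to terms of order log log X / log X and log Q / log X. -/
theorem exists_level_ratio_ge {τ A₁ b η : ℝ} (hτ : 0 < τ) (hb : 0 < b) (hη : 0 < η) {Q : ℝ}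
    (hQ : 1 ≤ Q) : ∀ᶠ X : ℝ in atTop,
      b - η ≤ Real.log (X ^ τ * Real.log X ^ (-A₁) / Q) / Real.log (X ^ (τ / b)) := by
  have hlim : Tendsto (fun L : ℝ => b / τ * (A₁ * (Real.log L / L) + Real.log Q / L)) atTop
      (𝓝 0) := by
    have h1 : Tendsto (fun L : ℝ => Real.log L / L) atTop (𝓝 0) :=
      Real.isLittleO_log_id_atTop.tendsto_div_nhds_zero
    have h2 : Tendsto (fun L : ℝ => Real.log Q / L) atTop (𝓝 0) := tendsto_id.const_div_atTop _
    simpa using ((h1.const_mul A₁).add h2).const_mul (b / τ)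
  filter_upwards [Real.tendsto_log_atTop.eventually (hlim.eventually (ge_mem_nhds hη)),
    Real.tendsto_log_atTop.eventually (eventually_gt_atTop 0), eventually_gt_atTop 0]
    with X hX hL hX0
  rw [Real.log_div (by positivity) (by positivity), Real.log_mul (by positivity) (by positivity),
    Real.log_rpow hX0, Real.log_rpow hL, Real.log_rpow hX0]
  have e : (τ * Real.log X + -A₁ * Real.log (Real.log X) - Real.log Q) / (τ / b * Real.log X) =
      b - b / τ * (A₁ * (Real.log (Real.log X) / Real.log X) + Real.log Q / Real.log X) := by
    field_simp
    ring
  rw [e]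
  linarith

/-- The dimension condition from z₁ = 2 onwards gives V(z) ≫ 1 / log z, which lets the main term
dominate the remainder X / log² X. -/
theorem IsSetup.one_le_log_mul_siftedProd {B : Finset ℕ} {τ A A₁ A₂ X : ℝ}
    {ω : ArithmeticFunction ℝ} {w : ℕ →₀ ℝ} (h : IsSetup B τ A A₁ A₂ X ω w) (hA : 0 ≤ A) {z : ℝ}
    (hz : 2 ≤ z) : 1 ≤ (1 + A / Real.log 2) / Real.log 2 * Real.log z *
      siftedProd (fun n => ω n / n) (SievePrime B) ⌈z⌉₊ := by
  have h1 := h.siftedProd_le hA le_rfl hz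
  rw [show ⌈(2 : ℝ)⌉₊ = 2 by simp, siftedProd_two fun p hp => hp.1] at h1
  refine h1.trans_eq ?_
  ring

end
end LinearSieve

/-! ### Choice of constants and conclusion. -/

theorem proposition3p5
    (B : Finset ℕ) (hB : ∀ p ∈ B, p.Prime)
    (τ A A₁ A₂ : ℝ) (hτ₀ : 0 < τ) (hτ₁ : τ < 1) (hA : 2 ≤ A) (hA₁ : 1 ≤ A₁) (hA₂ : 2 ≤ A₂)
    (a b : ℝ) (ha₁ : 1 ≤ a) (ha₃ : a < 3) (hab : a + 5 < b) (hb : b ≤ 8)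
    (r : ℕ)
    (hr : b / ((b - a) * τ) - 1 +
        2 * Real.exp Real.eulerMascheroniConstant / LinearSieve.lowerFun b *
          (LinearSieve.I₁ a b + LinearSieve.I₂ a b + LinearSieve.I₃ a b) < (r : ℝ)) :
    ∃ c : ℝ, 0 < c ∧ ∃ X₀ : ℝ, ∀ (X : ℝ) (ω : ArithmeticFunction ℝ) (w : ℕ →₀ ℝ),
      X₀ ≤ X → LinearSieve.IsSetup B τ A A₁ A₂ X ω w →
        c * (X * ∏ p ∈ Finset.range ⌈X ^ (τ / b)⌉₊ with p.Prime, (1 - ω p / p)) ≤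
          ∑ n ∈ w.support with n ∈ LinearSieve.almostPrimes r B, w n := by
  open LinearSieve Filter in
  have hb0 : 0 < b := by linarith
  have hba : 0 < b - a := by linarith
  have hf : 0 < lowerFun b := lowerFun_pos (by linarith)
  have hI := sum_integrals_nonneg ha₁ ha₃ hab hb
  set I := I₁ a b + I₂ a b + I₃ a b with hIdef
  have hC := sieveConst_pos
  have hE := errConst_pos
  set U := upperErr (1 / 2) with hU
  have hU0 : 0 < U := upperErr_pos (by norm_num)
  set ρ := (r : ℝ) + 1 - b / ((b - a) * τ) with hρ
  have hρI : sieveConst * I / lowerFun b < ρ := by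
    rw [mul_div_right_comm]
    change sieveConst / lowerFun b * I < ρ
    have : b / ((b - a) * τ) - 1 + sieveConst / lowerFun b * I < r := hr
    linarith
  have hρ0 : 0 < ρ := lt_of_le_of_lt (by positivity) hρI
  set lam := 1 / ρ with hlam
  have hlam0 : 0 < lam := by positivity
  -- The limiting value of the sieve bracket; with λ = 1/ρ its positivity is the hypothesis on r.
  -- The choices of κ and ε below each cost at most κ₀/4, leaving κ₀/2.
  set κ₀ := lowerFun b - lam * (sieveConst * I) with hκ₀
  have hκ₀0 : 0 < κ₀ := by
    rw [div_lt_iff₀ hf] at hρI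
    have : lam * (sieveConst * I) < lowerFun b := by
      rw [hlam, one_div_mul_eq_div, div_lt_iff₀ hρ0]
      linarith
    linarith
  set κ := min 1 (κ₀ / (4 * (1 + 8 * lam))) with hκ
  have hκ0 : 0 < κ := by positivity
  have hκ1 : κ ≤ 1 := min_le_left _ _
  have hκ2 : κ * (1 + 8 * lam) ≤ κ₀ / 4 := by
    have h1 : κ ≤ κ₀ / (4 * (1 + 8 * lam)) := min_le_right _ _
    rw [le_div_iff₀ (by positivity)] at h1
    linarith
  set M := errConst + lam * (sieveConst + 1 + 9 * (errConst * U)) with hM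
  have hM0 : 0 < M := by positivity
  set ε := min (1 / 100) (κ₀ / (4 * M)) with hε
  have hε0 : 0 < ε := by positivity
  have hε1 : ε ≤ 1 / 100 := min_le_left _ _
  have hε2 : ε * M ≤ κ₀ / 4 := by
    have h1 : ε ≤ κ₀ / (4 * M) := min_le_right _ _
    rw [le_div_iff₀ (by positivity)] at h1
    linarith
  have hbracket : κ₀ / 2 ≤ lowerFun b - κ - errConst * ε -
      lam * (ε * (sieveConst + (κ + errConst * ε * U)) +
        (sieveConst * I + 8 * (κ + errConst * ε * U))) := by
    have h1 : ε * (errConst * ε * U) ≤ ε * (errConst * U) := by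
      have : errConst * U * ε ≤ errConst * U * 1 :=
        mul_le_mul_of_nonneg_left (by linarith) (by positivity)
      exact mul_le_mul_of_nonneg_left (by linarith) hε0.le
    have h2 : ε * κ ≤ ε * 1 := mul_le_mul_of_nonneg_left hκ1 hε0.le
    have h3 : lam * (ε * (sieveConst + (κ + errConst * ε * U)) +
        (sieveConst * I + 8 * (κ + errConst * ε * U))) ≤
        lam * (ε * (sieveConst + 1 + 9 * (errConst * U)) + sieveConst * I + 8 * κ) :=
      mul_le_mul_of_nonneg_left (by linarith) hlam0.le
    have h4 : ε * M = errConst * ε + lam * (ε * (sieveConst + 1 + 9 * (errConst * U))) := by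
      rw [hM]; ring
    linarith
  obtain ⟨η, hη0, hη, hupper, hlower⟩ := exists_shift (a := a) ha₁ hb0 hκ0
  -- Beyond u₀ the factor 1 + A / log u of the dimension condition is at most 1 + ε. This u₀ does
  -- not depend on X or ω.
  obtain ⟨u₀, hu₀, hu₀A⟩ : ∃ u₀ : ℕ, 2 ≤ u₀ ∧ A / ε ≤ Real.log u₀ :=
    ((eventually_ge_atTop 2).and ((Real.tendsto_log_atTop.comp
      tendsto_natCast_atTop_atTop).eventually (eventually_ge_atTop (A / ε)))).exists
  have hu₀2 : (2 : ℝ) ≤ u₀ := by exact_mod_cast hu₀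
  set Q := smallProd (SievePrime B) u₀ with hQ
  have hQ1 : (1 : ℝ) ≤ Q := by exact_mod_cast smallProd_pos ((fun p hp => hp.1 : ∀ p, SievePrime B p → p.Prime)) u₀
  set K := (1 + A / Real.log 2) / Real.log 2 with hK
  have hl2 : 0 < Real.log 2 := Real.log_pos one_lt_two
  have hK0 : 0 < K := by positivity
  obtain ⟨X₀, hX₀⟩ := eventually_atTop.1
    (((exists_level_ratio_ge (A₁ := A₁) hτ₀ hb0 hη0 hQ1).and
      ((tendsto_rpow_atTop (show 0 < τ / b by positivity)).eventually
        (eventually_ge_atTop (u₀ : ℝ)))).and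
      ((eventually_gt_atTop (1 : ℝ)).and (Real.tendsto_log_atTop.eventually
        (eventually_ge_atTop ((1 + lam) * A₂ * K * 4 / κ₀)))))
  refine ⟨κ₀ / 4, by positivity, X₀, fun X ω w hX h => ?_⟩
  obtain ⟨⟨hs, hz⟩, hX1, hL⟩ := hX₀ X hX
  rw [← h.siftedProd_eq]
  have hX0 : 0 < X := by linarith
  have hL0 : 0 < Real.log X := Real.log_pos hX1
  set z := X ^ (τ / b) with hzdef
  have hlogz : Real.log z = τ / b * Real.log X := Real.log_rpow hX0 _
  have hz0 : 0 < z := by linarith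
  have hV0 := siftedProd_pos h.density_lt_one ⌈z⌉₊
  have hV : ∀ u z : ℝ, (u₀ : ℝ) ≤ u → u ≤ z →
      siftedProd (fun n => ω n / n) (SievePrime B) ⌈u⌉₊ ≤ (1 + ε) * (Real.log z / Real.log u) *
        siftedProd (fun n => ω n / n) (SievePrime B) ⌈z⌉₊ := by
    intro u z hu huz
    refine (h.siftedProd_le (by linarith) (by linarith) huz).trans ?_
    refine mul_le_mul_of_nonneg_right ?_ (siftedProd_pos h.density_lt_one _).le
    rw [mul_comm (1 + ε)]
    have hlu : 0 < Real.log u := Real.log_pos (by linarith)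
    have hlz : 0 < Real.log z := Real.log_pos (by linarith)
    refine mul_le_mul_of_nonneg_left (add_le_add le_rfl ?_) (by positivity)
    have h1 := hu₀A.trans (Real.log_le_log (by linarith) hu)
    rw [div_le_iff₀ hε0] at h1
    rw [div_le_iff₀ hlu]
    linarith
  have hr' : 1 ≤ lam * ((r : ℝ) + 1 - Real.log X / Real.log (z ^ (b - a))) := by
    have e : Real.log X / Real.log (z ^ (b - a)) = b / ((b - a) * τ) := by
      rw [Real.log_rpow hz0, hlogz]
      field_simp
    rw [e, ← hρ, hlam, one_div_mul_cancel hρ0.ne']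
  have hmain := weighted_sieve h ha₁ ha₃ hab hb hX0.le hε0 hε1 hκ0.le hη hupper hlower
    hlam0.le hu₀ hV hz (show 0 < X ^ τ * Real.log X ^ (-A₁) by positivity) hr' hs
  refine le_trans ?_ hmain
  have herr := h.siftedErr_le hB ⌈z ^ (b - a)⌉₊
  set V := siftedProd (fun n => ω n / n) (SievePrime B) ⌈z⌉₊ with hVdef
  have hKV : 1 ≤ K * Real.log X * V := by
    refine (h.one_le_log_mul_siftedProd (by linarith) (hu₀2.trans hz)).trans ?_
    refine mul_le_mul_of_nonneg_right (mul_le_mul_of_nonneg_left ?_ hK0.le) hV0.le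
    rw [hlogz]
    exact mul_le_of_le_one_left hL0.le (div_le_one_of_le₀ (by linarith) hb0.le)
  -- The remainder takes another κ₀/4 of the remaining κ₀/2, so c = κ₀/4 is left.
  have hfin : (1 + lam) * (A₂ * (X / Real.log X ^ 2)) ≤ κ₀ / 4 * (X * V) := by
    rw [div_le_iff₀ hκ₀0] at hL
    have h1 : (1 + lam) * (A₂ * (X / Real.log X ^ 2)) =
        (1 + lam) * A₂ * X / Real.log X ^ 2 := by ring
    rw [h1, div_le_iff₀ (by positivity)]
    calc (1 + lam) * A₂ * X = (1 + lam) * A₂ * X * 1 := (mul_one _).symm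
      _ ≤ (1 + lam) * A₂ * X * (K * Real.log X * V) :=
          mul_le_mul_of_nonneg_left hKV (by positivity)
      _ = (1 + lam) * A₂ * K * 4 * (X * V * Real.log X / 4) := by ring
      _ ≤ Real.log X * κ₀ * (X * V * Real.log X / 4) :=
          mul_le_mul_of_nonneg_right hL (by positivity)
      _ = κ₀ / 4 * (X * V) * Real.log X ^ 2 := by ring
  have h1 := mul_le_mul_of_nonneg_left hbracket (show 0 ≤ X * V by positivity)
  have h2 := mul_le_mul_of_nonneg_left herr (show 0 ≤ 1 + lam by linarith)
  linarith
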